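/- Let $R$ be a commutative ring, let $f\colon X\to Y$ be a continuous map of topological spaces, and let $\mathcal U=(U_\alpha)_{\alpha\in I}$ be an open cover of $Y$, indexed by a linearly ordered set $I$, such that the open cover $f^{-1}\mathcal U=(f^{-1}(U_\alpha))_{\alpha\in I}$ of $X$ is locally finite. Let $X=K_0\supseteq K_1\supseteq\cdots\supseteq K_N=\emptyset$ be a filtration of $X$ by subspaces, and put $K_i=X$ for $i\le 0$ and $K_i=\emptyset$ for $i\ge N$. Write $H^*$ for singular cohomology with coefficients in $R$. For a persistence module $M=(M_i,\varphi_i\colon M_i\to M_{i+1})_{i\in\mathbb Z}$ let $\alpha(M)=\bigoplus_{i\in\mathbb Z}M_i$ be the graded $R[t]$-module on which $t$ sends $m\in M_i$ to $\varphi_i(m)\in M_{i+1}$. Let $PH^n(X)=\bigoplus_{i\in\mathbb Z}H^n(K_i)$ be the graded $R[t]$-module of the persistence module $i\mapsto H^n(K_i)$ with the restriction maps, and for $V\subseteq Y$ let $PH^q(f^{-1}V)=\bigoplus_{i\in\mathbb Z}H^q(K_i\cap f^{-1}V)$; this is a presheaf of graded $R[t]$-modules on $Y$. Let $H^p_\delta(\mathcal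 U,PH^q(f^{-1}\mathcal U))$ be the cohomology of its Čech complex $$C^p=\prod_{\alpha_0<\dots<\alpha_p}PH^q\bigl(f^{-1}(U_{\alpha_0}\cap\dots\cap U_{\alpha_p})\bigr),\qquad (\delta c)_{\alpha_0\dots\alpha_{p+1}}=\sum_{j=0}^{p+1}(-1)^j\,c_{\alpha_0\dots\widehat{\alpha_j}\dots\alpha_{p+1}}\big|_{f^{-1}(U_{\alpha_0}\cap\dots\cap U_{\alpha_{p+1}})},$$ where the product is taken in the category of graded $R[t]$-modules (that is, it consists of the families all of whose members are supported in a common finite set of degrees; this is the full product if $\mathcal U$ is finite). Then there is a first quadrant cohomological spectral sequence $(E_r^{p,q},d_r)_{r\ge 2}$ of graded $R[t]$-modules, with $R[t]$-linear differentials $d_r\colon E_r^{p,q}\to E_r^{p+r,q-r+1}$ of degree $0$ in the grading and isomorphisms $H(E_r,d_r)\cong E_{r+1}$ of graded $R[t]$-modules, such that for all $p,q\ge 0$ there is an isomorphism of graded $R[t]$-modules $$E_2^{p,q}\cong H^p_\delta(\mathcal U,PH^q(f^{-1}\mathcal U)),$$ and which converges to $PH^*(X)$: for every $n$ there is a filtration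 $PH^n(X)=F^0\supseteq F^1\supseteq\dots\supseteq F^{n+1}=0$ by graded $R[t]$-submodules such that $F^p/F^{p+1}\cong E_\infty^{p,n-p}$ as graded $R[t]$-modules for $0\le p\le n$, where $E_\infty^{p,q}=E_r^{p,q}$ for $r>\max(p,q+1)$. -/

import Mathlib

open CategoryTheory Opposite Polynomial DirectSum

universe u v w

noncomputable section

namespace PersistentLeray

/-! ### Singular cohomology -/

/-- The contravariant functor sending a set `S` to the `R`-module of functions `S → R`. -/
def functionsFunctor (R : Type v) [CommRing R] : (Type u)ᵒᵖ ⥤ ModuleCat.{max u v} R where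
  obj S := ModuleCat.of R (S.unop → R)
  map g := ModuleCat.ofHom (LinearMap.funLeft R R g.unop)

/-- The singular cochain complex with coefficients in `R`: in degree `q` it is the module of all
functions from the set of singular `q`-simplices to `R`, and the coboundary is the alternating sum
of the maps induced by the faces. -/
def singularCochainFunctor (R : Type v) [CommRing R] :
    TopCat.{u}ᵒᵖ ⥤ CochainComplex (ModuleCat.{max u v} R) ℕ :=
  TopCat.toSSet.op ⋙ (simplicialCosimplicialEquiv (Type u)).functor ⋙
    (CosimplicialObject.whiskering _ _).obj (functionsFunctor R) ⋙
      AlgebraicTopology.alternatingCofaceMapComplex _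

/-- Singular cohomology `H^q(-; R)`. -/
def singularCohomology (R : Type v) [CommRing R] (q : ℕ) :
    TopCat.{u}ᵒᵖ ⥤ ModuleCat.{max u v} R :=
  singularCochainFunctor R ⋙ HomologicalComplex.homologyFunctor _ _ q

/-- Subsets of a topological space, as topological spaces, with the inclusions. -/
def subspaceFunctor (X : Type u) [TopologicalSpace X] : Set X ⥤ TopCat.{u} where
  obj A := TopCat.of A
  map h := TopCat.ofHom ⟨Set.inclusion (leOfHom h), continuous_inclusion (leOfHom h)⟩

/-- `H^q(A; R)` as a contravariant functor of the subspace `A` of `X`. -/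
def subspaceCohomology (R : Type v) [CommRing R] (X : Type u) [TopologicalSpace X] (q : ℕ) :
    (Set X)ᵒᵖ ⥤ ModuleCat.{max u v} R :=
  (subspaceFunctor X).op ⋙ singularCohomology R q

/-! ### Persistence modules and graded `R[t]`-modules -/

/-- Persistence modules: `R`-modules `M i`, `i ∈ ℤ`, with maps `M i → M (i + 1)`
(and their composites). -/
abbrev PersistenceModule (R : Type v) [CommRing R] := ℤ ⥤ ModuleCat.{w} R

section Alpha

variable {R : Type v} [CommRing R]

/-- The endomorphism of `⨁ i, M i` sending the summand `M i` to the summand `M (i + 1)` by the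
structure map of `M`. -/
def shift (M : PersistenceModule.{v, w} R) : (⨁ i : ℤ, M.obj i) →ₗ[R] (⨁ i : ℤ, M.obj i) :=
  DirectSum.toModule R ℤ _ fun i =>
    DirectSum.lof R ℤ (fun i => M.obj i) (i + 1) ∘ₗ
      (M.map (homOfLE (Int.le_add_one le_rfl) : i ⟶ i + 1)).hom

/-- The `R[t]`-module `α(M) = ⨁ i, M i` of a persistence module; `t` acts by `shift M`. -/
def Alpha (M : PersistenceModule.{v, w} R) : Type w := ⨁ i : ℤ, M.obj i

instance (M : PersistenceModule.{v, w} R) : AddCommGroup (Alpha M) :=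
  inferInstanceAs (AddCommGroup (⨁ i : ℤ, M.obj i))

instance (M : PersistenceModule.{v, w} R) : Module R (Alpha M) :=
  inferInstanceAs (Module R (⨁ i : ℤ, M.obj i))

/-- The identification of `⨁ i, M i` with `α(M)`. -/
def Alpha.of (M : PersistenceModule.{v, w} R) : (⨁ i : ℤ, M.obj i) ≃ₗ[R] Alpha M :=
  LinearEquiv.refl R _

/-- Multiplication by `t` on `α(M)`. -/
def Alpha.t (M : PersistenceModule.{v, w} R) : Module.End R (Alpha M) :=
  (Alpha.of M).toLinearMap ∘ₗ shift M ∘ₗ (Alpha.of M).symm.toLinearMap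

/-- A polynomial `P` acts on `α(M)` as `P(t)`. -/
instance (M : PersistenceModule.{v, w} R) : Module R[X] (Alpha M) :=
  Module.compHom (Alpha M) (aeval (Alpha.t M)).toRingHom

lemma Alpha.X_smul (M : PersistenceModule.{v, w} R) (m : Alpha M) :
    (X : R[X]) • m = Alpha.t M m :=
  congrArg (fun φ : Module.End R (Alpha M) => φ m) (aeval_X (Alpha.t M))

lemma Alpha.C_smul (M : PersistenceModule.{v, w} R) (a : R) (m : Alpha M) :
    (C a : R[X]) • m = a • m :=
  congrArg (fun φ : Module.End R (Alpha M) => φ m) (aeval_C (Alpha.t M) a)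

instance (M : PersistenceModule.{v, w} R) : IsScalarTower R R[X] (Alpha M) where
  smul_assoc a P m := by
    rw [Polynomial.smul_eq_C_mul, mul_smul, Alpha.C_smul]

/-- The homogeneous component of degree `i` of an element of `α(M)`. -/
def Alpha.component (M : PersistenceModule.{v, w} R) (i : ℤ) : Alpha M →ₗ[R] M.obj i :=
  DirectSum.component R ℤ (fun i => M.obj i) i ∘ₗ (Alpha.of M).symm.toLinearMap

/-- The grading of `α(M)`: the degree `i` part is the summand `M i`. -/
def Alpha.grading (M : PersistenceModule.{v, w} R) (i : ℤ) : AddSubgroup (Alpha M) :=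
  (LinearMap.range ((Alpha.of M).toLinearMap ∘ₗ
    DirectSum.lof R ℤ (fun i => M.obj i) i)).toAddSubgroup

lemma shift_lof (M : PersistenceModule.{v, w} R) (i : ℤ) (x : M.obj i) :
    shift M (DirectSum.lof R ℤ (fun i => M.obj i) i x) =
      DirectSum.lof R ℤ (fun i => M.obj i) (i + 1)
        ((M.map (homOfLE (Int.le_add_one le_rfl) : i ⟶ i + 1)).hom x) := by
  simp [shift]

lemma shift_apply_succ (M : PersistenceModule.{v, w} R) (m : ⨁ i : ℤ, M.obj i) (j : ℤ) :
    shift M m (j + 1) = (M.map (homOfLE (Int.le_add_one le_rfl) : j ⟶ j + 1)).hom (m j) := by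
  induction m using DirectSum.induction_on with
  | zero => simp
  | of i x =>
    have h := shift_lof M i x
    rw [DirectSum.lof_eq_of, DirectSum.lof_eq_of] at h
    rw [h]
    by_cases hij : i = j
    · subst hij
      simp [DirectSum.of_eq_same]
    · rw [DirectSum.of_eq_of_ne _ _ _ (by lia), DirectSum.of_eq_of_ne _ _ _ (by lia), map_zero]
  | add x y hx hy => rw [map_add, DirectSum.add_apply, hx, hy, DirectSum.add_apply, map_add]

lemma Alpha.component_X_smul (M : PersistenceModule.{v, w} R) (m : Alpha M) (j : ℤ) :
    Alpha.component M (j + 1) ((X : R[X]) • m) =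
      (M.map (homOfLE (Int.le_add_one le_rfl) : j ⟶ j + 1)).hom (Alpha.component M j m) := by
  rw [Alpha.X_smul]
  exact shift_apply_succ M _ j

/-- The `R[t]`-linear map `α(M) → α(M')` induced by a morphism of persistence modules. -/
def Alpha.map {M M' : PersistenceModule.{v, w} R} (g : M ⟶ M') : Alpha M →ₗ[R[X]] Alpha M' :=
  let φ : Alpha M →ₗ[R] Alpha M' := (Alpha.of M').toLinearMap ∘ₗ
    DirectSum.lmap (fun i => (g.app i).hom) ∘ₗ (Alpha.of M).symm.toLinearMap
  { φ with
    map_smul' := by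
      have h : DirectSum.lmap (fun i => (g.app i).hom) ∘ₗ shift M =
          shift M' ∘ₗ DirectSum.lmap (fun i => (g.app i).hom) := by
        refine DirectSum.linearMap_ext _ fun i => LinearMap.ext fun x => ?_
        simp only [LinearMap.comp_apply, shift_lof, DirectSum.lmap_lof]
        congr 1
        exact congrArg (fun k => k.hom x)
          (g.naturality (homOfLE (Int.le_add_one le_rfl) : i ⟶ i + 1))
      have hX (m : Alpha M) : φ ((X : R[X]) • m) = (X : R[X]) • φ m := by
        rw [Alpha.X_smul, Alpha.X_smul]
        exact LinearMap.congr_fun h m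
      have hP (P : R[X]) : ∀ m : Alpha M, φ (P • m) = P • φ m := by
        induction P using Polynomial.induction_on with
        | C a => intro m; rw [Alpha.C_smul, Alpha.C_smul, map_smul]
        | add P Q hP hQ => intro m; rw [add_smul, add_smul, map_add, hP, hQ]
        | monomial n a ih =>
          intro m
          rw [pow_succ, ← mul_assoc, mul_smul, ih, hX, mul_smul (C a * X ^ n)]
      exact hP }

lemma Alpha.component_map {M M' : PersistenceModule.{v, w} R} (g : M ⟶ M') (m : Alpha M) (i : ℤ) :
    Alpha.component M' i (Alpha.map g m) = (g.app i).hom (Alpha.component M i m) :=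
  rfl

lemma Alpha.ext {M : PersistenceModule.{v, w} R} {m m' : Alpha M}
    (h : ∀ i, Alpha.component M i m = Alpha.component M i m') : m = m' :=
  (Alpha.of M).symm.injective (DFinsupp.ext h)

lemma Alpha.map_map {M M' M'' : PersistenceModule.{v, w} R} (g : M ⟶ M') (g' : M' ⟶ M'')
    (m : Alpha M) : Alpha.map g' (Alpha.map g m) = Alpha.map (g ≫ g') m :=
  Alpha.ext fun _ => by simp [Alpha.component_map]

end Alpha

/-- A grading of an `R[t]`-module by `ℤ`, where `R` has degree `0` and `t` has degree `1`. -/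
structure IsGrading {R : Type v} [CommRing R] {M : Type w} [AddCommGroup M] [Module R[X] M]
    (gr : ℤ → AddSubgroup M) : Prop where
  isInternal : DirectSum.IsInternal gr
  C_smul_mem : ∀ (a : R) (i : ℤ) (m : M), m ∈ gr i → (C a : R[X]) • m ∈ gr i
  X_smul_mem : ∀ (i : ℤ) (m : M), m ∈ gr i → (X : R[X]) • m ∈ gr (i + 1)

/-- The grading induced on the homology of a complex of graded modules: the degree `i` part
consists of the classes of the cycles of degree `i`. -/
def homologyGrading {S : Type v} [Ring S] {κ : Type*} {c : ComplexShape κ}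
    (K : HomologicalComplex (ModuleCat.{w} S) c) (gr : ∀ k, ℤ → AddSubgroup (K.X k)) (k : κ)
    (i : ℤ) : AddSubgroup (K.homology k) :=
  ((gr k i).comap (K.iCycles k).hom.toAddMonoidHom).map (K.homologyπ k).hom.toAddMonoidHom

/-! ### Persistent cohomology -/

/-- The persistence module `i ↦ H^q(L_i; R)` of a decreasing sequence `L_0 ⊇ L_1 ⊇ ⋯` of subspaces,
where `L_i = L_0` for `i ≤ 0`. The structure maps are the restrictions. The graded `R[t]`-module
`PH^q` is `Alpha` of it. -/
def persistentCohomology (R : Type v) [CommRing R] {X : Type u} [TopologicalSpace X]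
    (L : ℕ → Set X) (hL : Antitone L) (q : ℕ) : PersistenceModule.{v, max u v} R where
  obj i := (subspaceCohomology R X q).obj (op (L i.toNat))
  map h := (subspaceCohomology R X q).map (homOfLE (hL (Int.toNat_le_toNat (leOfHom h)))).op
  map_id _ := (subspaceCohomology R X q).map_id _
  map_comp _ _ := (subspaceCohomology R X q).map_comp _ _

/-- The presheaf of persistence modules `V ↦ (i ↦ H^q(K_i ∩ f⁻¹ V; R))` on `Y`. -/
def persistentCohomologyPresheaf (R : Type v) [CommRing R] {X : Type u} [TopologicalSpace X]
    {Y : Type*} (f : X → Y) (K : ℕ → Set X) (hK : Antitone K) (q : ℕ) :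
    (Set Y)ᵒᵖ ⥤ PersistenceModule.{v, max u v} R where
  obj V := persistentCohomology R (fun i => K i ∩ f ⁻¹' V.unop)
    (fun _ _ h => Set.inter_subset_inter_left _ (hK h)) q
  map {V W} h :=
    { app := fun i => (subspaceCohomology R X q).map
        (homOfLE (Set.inter_subset_inter_right (K i.toNat)
          (Set.preimage_mono (f := f) (leOfHom h.unop)))).op
      naturality := fun _ _ _ => by
        dsimp only [persistentCohomology]
        rw [← (subspaceCohomology R X q).map_comp, ← (subspaceCohomology R X q).map_comp]
        rfl }
  map_id _ := by
    ext1; funext i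
    exact (subspaceCohomology R X q).map_id _
  map_comp _ _ := by
    ext1; funext i
    exact (subspaceCohomology R X q).map_comp _ _

/-! ### Čech cohomology -/

section Cech

variable {R : Type v} [CommRing R] {Y : Type*} {ι : Type*} [LinearOrder ι]

/-- `U_{α₀} ∩ ⋯ ∩ U_{αₚ}` for `α₀ < ⋯ < αₚ`. -/
def cechInter (U : ι → Set Y) {p : ℕ} (σ : Fin (p + 1) ↪o ι) : Set Y := ⋂ k, U (σ k)

/-- Omit `αⱼ` from `α₀ < ⋯ < αₚ₊₁`. -/
def cechFace {p : ℕ} (σ : Fin (p + 2) ↪o ι) (j : Fin (p + 2)) : Fin (p + 1) ↪o ι :=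
  (Fin.succAboveOrderEmb j).trans σ

lemma cechInter_subset (U : ι → Set Y) {p : ℕ} (σ : Fin (p + 2) ↪o ι) (j : Fin (p + 2)) :
    cechInter U σ ⊆ cechInter U (cechFace σ j) :=
  Set.subset_iInter fun k => Set.iInter_subset (fun k => U (σ k)) (j.succAbove k)

variable (U : ι → Set Y) (F : (Set Y)ᵒᵖ ⥤ PersistenceModule.{v, w} R)

/-- The Čech `p`-cochains of `U` with values in the presheaf of graded `R[t]`-modules `α ∘ F`. The
product over `α₀ < ⋯ < αₚ` is that of graded modules: it consists of the families
whose components lie in finitely many degrees, so that it is the direct sum of its homogeneous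
parts `∏ F(U_{α₀…αₚ})_i`. For a finite cover it is the full product. -/
def cechCochains (p : ℕ) :
    Submodule R[X] (∀ σ : Fin (p + 1) ↪o ι, Alpha (F.obj (op (cechInter U σ)))) where
  carrier := {c | ∃ S : Finset ℤ, ∀ σ, ∀ i ∉ S, Alpha.component _ i (c σ) = 0}
  zero_mem' := ⟨∅, fun _ _ _ => map_zero _⟩
  add_mem' := by
    rintro a b ⟨S, hS⟩ ⟨T, hT⟩
    refine ⟨S ∪ T, fun σ i hi => ?_⟩
    rw [Finset.notMem_union] at hi
    rw [Pi.add_apply, map_add, hS σ i hi.1, hT σ i hi.2, add_zero]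
  smul_mem' := by
    intro P
    induction P using Polynomial.induction_on' with
    | add P Q hP hQ =>
      intro c hc
      obtain ⟨S, hS⟩ := hP hc
      obtain ⟨T, hT⟩ := hQ hc
      refine ⟨S ∪ T, fun σ i hi => ?_⟩
      rw [Finset.notMem_union] at hi
      rw [add_smul, Pi.add_apply, map_add, hS σ i hi.1, hT σ i hi.2, add_zero]
    | monomial n a =>
      rintro c ⟨S, hS⟩
      rw [← Polynomial.C_mul_X_pow_eq_monomial]
      have hX : ∀ n : ℕ, ∃ S : Finset ℤ, ∀ σ, ∀ i ∉ S,
          Alpha.component _ i (((X : R[X]) ^ n • c) σ) = 0 := by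
        intro n
        induction n with
        | zero => exact ⟨S, by simpa using hS⟩
        | succ n ih =>
          obtain ⟨T, hT⟩ := ih
          refine ⟨T.image (· + 1), fun σ i hi => ?_⟩
          obtain ⟨j, rfl⟩ : ∃ j, i = j + 1 := ⟨i - 1, by ring⟩
          have hj : j ∉ T := fun h => hi (Finset.mem_image_of_mem _ h)
          rw [pow_succ', mul_smul, Pi.smul_apply, Alpha.component_X_smul, hT σ j hj, map_zero]
      obtain ⟨T, hT⟩ := hX n
      refine ⟨T, fun σ i hi => ?_⟩
      rw [mul_smul, Pi.smul_apply, Alpha.C_smul, map_smul, hT σ i hi, smul_zero]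

/-- The restriction `α(F(U_{α₀…α̂ⱼ…αₚ₊₁})) → α(F(U_{α₀…αₚ₊₁}))`. -/
def cechRes {p : ℕ} (σ : Fin (p + 2) ↪o ι) (j : Fin (p + 2)) :
    Alpha (F.obj (op (cechInter U (cechFace σ j)))) →ₗ[R[X]] Alpha (F.obj (op (cechInter U σ))) :=
  Alpha.map (F.map (homOfLE (cechInter_subset U σ j)).op)

/-- The Čech differential
`(δ c)_{α₀…αₚ₊₁} = ∑ j, (-1)^j c_{α₀…α̂ⱼ…αₚ₊₁}` (restricted to `U_{α₀…αₚ₊₁}`). -/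
def cechDelta (p : ℕ) : cechCochains U F p →ₗ[R[X]] cechCochains U F (p + 1) :=
  LinearMap.codRestrict _
    (LinearMap.pi fun σ => ∑ j : Fin (p + 2),
      (-1 : ℤ) ^ (j : ℕ) • (cechRes U F σ j ∘ₗ LinearMap.proj (cechFace σ j) ∘ₗ
        (cechCochains U F p).subtype))
    (by
      rintro ⟨c, S, hS⟩
      refine ⟨S, fun σ i hi => ?_⟩
      simp only [LinearMap.pi_apply, LinearMap.sum_apply, map_sum]
      refine Finset.sum_eq_zero fun j _ => ?_
      rw [LinearMap.smul_apply, map_zsmul]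
      refine (congrArg _ ((Alpha.component_map _ _ i).trans ?_)).trans (smul_zero _)
      exact (congrArg _ (hS (cechFace σ j) i hi)).trans (map_zero _))

lemma cechDelta_apply (p : ℕ) (c : cechCochains U F p) (σ : Fin (p + 2) ↪o ι) :
    (cechDelta U F p c).1 σ =
      ∑ j : Fin (p + 2), (-1 : ℤ) ^ (j : ℕ) • cechRes U F σ j (c.1 (cechFace σ j)) := by
  simp [cechDelta]

lemma cechRes_comp_eq {p : ℕ} (c : cechCochains U F p) (σ : Fin (p + 3) ↪o ι)
    {j j' : Fin (p + 3)} {k k' : Fin (p + 2)}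
    (h : cechFace (cechFace σ j) k = cechFace (cechFace σ j') k') :
    cechRes U F σ j (cechRes U F (cechFace σ j) k (c.1 (cechFace (cechFace σ j) k))) =
      cechRes U F σ j' (cechRes U F (cechFace σ j') k' (c.1 (cechFace (cechFace σ j') k'))) := by
  have key : ∀ (τ : Fin (p + 1) ↪o ι) (hτ : cechFace (cechFace σ j) k = τ)
      (hle : cechInter U σ ⊆ cechInter U τ),
      cechRes U F σ j (cechRes U F (cechFace σ j) k (c.1 (cechFace (cechFace σ j) k))) =
        Alpha.map (F.map (homOfLE hle).op) (c.1 τ) := by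
    rintro _ rfl hle
    refine (Alpha.map_map _ _ _).trans ?_
    rw [← F.map_comp]
    rfl
  rw [key _ h ((cechInter_subset U σ j').trans (cechInter_subset U _ k'))]
  refine ((Alpha.map_map _ _ _).trans ?_).symm
  rw [← F.map_comp]
  rfl

lemma cechFace_cechFace {p : ℕ} (σ : Fin (p + 3) ↪o ι) {j k : Fin (p + 2)} (h : k ≤ j) :
    cechFace (cechFace σ j.succ) k = cechFace (cechFace σ k.castSucc) j := by
  refine RelEmbedding.ext fun l => ?_
  change σ (j.succ.succAbove (k.succAbove l)) = σ (k.castSucc.succAbove (j.succAbove l))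
  congr 1
  simp only [Fin.succAbove, Fin.lt_def, Fin.le_def, Fin.ext_iff] at h ⊢
  split_ifs <;> simp_all <;> lia

lemma cechDelta_cechDelta (p : ℕ) (c : cechCochains U F p) :
    cechDelta U F (p + 1) (cechDelta U F p c) = 0 := by
  refine Subtype.ext (funext fun σ => ?_)
  rw [cechDelta_apply]
  simp only [cechDelta_apply, map_sum, map_zsmul, Finset.smul_sum, smul_smul, ← pow_add]
  rw [← Finset.sum_product', Finset.univ_product_univ,
    ← Finset.sum_filter_add_sum_filter_not _ (fun x : Fin (p + 3) × Fin (p + 2) =>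
      x.2.castSucc < x.1)]
  refine (eq_neg_iff_add_eq_zero (G := Alpha _)).1 ?_
  rw [← Finset.sum_neg_distrib]
  refine Finset.sum_bij' (fun x hx => (x.2.castSucc, x.1.pred
      (Fin.ne_zero_of_lt (Finset.mem_filter.1 hx).2)))
    (fun x hx => (x.2.succ, x.1.castPred
      (Fin.ne_last_of_lt (lt_of_le_of_lt (not_lt.1 (Finset.mem_filter.1 hx).2)
        (Fin.castSucc_lt_succ (i := x.2)))))) ?_ ?_ ?_ ?_ ?_
  · rintro ⟨j, k⟩ h
    simp only [Finset.mem_filter, Finset.mem_univ, true_and, Fin.lt_def, Fin.val_castSucc,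
      Fin.val_pred, not_lt] at h ⊢
    lia
  · rintro ⟨j, k⟩ h
    simp only [Finset.mem_filter, Finset.mem_univ, true_and, Fin.lt_def, Fin.val_castSucc,
      Fin.val_succ, Fin.coe_castPred, not_lt] at h ⊢
    lia
  · rintro ⟨j, k⟩ h
    simp
  · rintro ⟨j, k⟩ h
    simp
  · rintro ⟨j, k⟩ h
    have h' : k.castSucc < j := (Finset.mem_filter.1 h).2
    obtain ⟨j, rfl⟩ := Fin.exists_succ_eq.2 (Fin.ne_zero_of_lt h')
    have hkj : k ≤ j := by
      simp only [Fin.lt_def, Fin.le_def, Fin.val_castSucc, Fin.val_succ] at h' ⊢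
      lia
    simp only [Fin.pred_succ, Fin.val_succ, Fin.val_castSucc]
    rw [cechRes_comp_eq U F c σ (cechFace_cechFace σ hkj), ← neg_smul]
    congr 1
    ring

/-- The Čech complex of `U` with values in the presheaf of graded `R[t]`-modules `α ∘ F`. -/
def cechComplex : CochainComplex (ModuleCat R[X]) ℕ :=
  CochainComplex.of (fun p => ModuleCat.of R[X] (cechCochains U F p))
    (fun p => ModuleCat.ofHom (cechDelta U F p))
    (fun p => by
      refine ModuleCat.hom_ext (LinearMap.ext fun c => ?_)
      exact cechDelta_cechDelta U F p c)

/-- The grading of the Čech cochains: `c` has degree `i` if all its values have degree `i`. -/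
def cechGrading (p : ℕ) (i : ℤ) : AddSubgroup ((cechComplex U F).X p) :=
  (AddSubgroup.pi Set.univ fun σ : Fin (p + 1) ↪o ι =>
    Alpha.grading (F.obj (op (cechInter U σ))) i).comap
      (cechCochains U F p).subtype.toAddMonoidHom

/-- Čech cohomology `H^p(U, α ∘ F)`, an `R[t]`-module. -/
abbrev cechCohomology (p : ℕ) : ModuleCat R[X] := (cechComplex U F).homology p

end Cech

/-! ### Spectral sequences of graded `R[t]`-modules -/

/-- A first quadrant `E₂` cohomological spectral sequence of `ℤ`-graded `R[t]`-modules: the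
differentials and the identifications `H(E_r) ≅ E_{r+1}` are `R[t]`-linear of degree `0`. -/
structure GradedSpectralSequence (R : Type v) [CommRing R] where
  /-- the underlying spectral sequence of `R[t]`-modules -/
  E : E₂CohomologicalSpectralSequenceNat (ModuleCat.{w} R[X])
  /-- the gradings of the terms of the pages -/
  gr (r : ℤ) (hr : 2 ≤ r) (pq : ℕ × ℕ) : ℤ → AddSubgroup ((E.page r hr).X pq)
  isGrading (r : ℤ) (hr : 2 ≤ r) (pq : ℕ × ℕ) : IsGrading (R := R) (gr r hr pq)
  d_mem (r : ℤ) (hr : 2 ≤ r) (pq pq' : ℕ × ℕ) (i : ℤ) (x : (E.page r hr).X pq)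
    (hx : x ∈ gr r hr pq i) : ((E.page r hr).d pq pq').hom x ∈ gr r hr pq' i
  iso_map (r : ℤ) (hr : 2 ≤ r) (pq : ℕ × ℕ) (i : ℤ) :
    (homologyGrading (E.page r hr) (gr r hr) pq i).map
      (E.iso r (r + 1) pq rfl hr).hom.hom.toAddMonoidHom = gr (r + 1) (by lia) pq i

/-- Convergence of a first quadrant spectral sequence of graded `R[t]`-modules to a sequence `A` of
graded `R[t]`-modules. Each `A n` has a decreasing filtration
`A n = F⁰ ⊇ F¹ ⊇ ⋯ ⊇ Fⁿ⁺¹ = 0` by homogeneous `R[t]`-submodules such that `F^p / F^{p+1}` is, as a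
graded `R[t]`-module, isomorphic to `E_∞^{p,q}` for `p + q = n`. Here `E_∞^{p,q} = E_r^{p,q}` for
all `r > max (p, q + 1)`: then no differential of `E_r` at `(p,q)` stays in the first quadrant. -/
def GradedSpectralSequence.ConvergesTo {R : Type v} [CommRing R]
    (𝓔 : GradedSpectralSequence.{v, w} R) (A : ℕ → Type*) [∀ n, AddCommGroup (A n)]
    [∀ n, Module R[X] (A n)] (grA : ∀ n, ℤ → AddSubgroup (A n)) : Prop :=
  ∃ F : ∀ n, ℕ → Submodule R[X] (A n),
    (∀ n, Antitone (F n)) ∧ (∀ n, F n 0 = ⊤) ∧ (∀ n, F n (n + 1) = ⊥) ∧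
    (∀ n p, (F n p).toAddSubgroup = ⨆ i, (F n p).toAddSubgroup ⊓ grA n i) ∧
    ∀ (p q : ℕ) (r : ℤ) (hr : 2 ≤ r), (p : ℤ) < r → (q : ℤ) + 1 < r →
      ∃ e : (𝓔.E.page r hr).X (p, q) ≃ₗ[R[X]]
          (F (p + q) p ⧸ (F (p + q) (p + 1)).submoduleOf (F (p + q) p)),
        ∀ i, (𝓔.gr r hr (p, q) i).map e.toLinearMap.toAddMonoidHom =
          ((grA (p + q) i).comap (F (p + q) p).subtype.toAddMonoidHom).map
            ((F (p + q) (p + 1)).submoduleOf (F (p + q) p)).mkQ.toAddMonoidHom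

end PersistentLeray

end

noncomputable section

namespace PersistentLeray

/-! The spectral sequence is that of the double complex $A^{p,q}$ of Čech $p$-cochains with values
in the presheaf $V\mapsto\bigoplus_i S^q(K_i\cap f^{-1}V)$ of singular cochains, with the total
complex filtered by the Čech degree $p$. All maps in sight are $R[t]$-linear of degree $0$, so
gradings are carried along by choosing homogeneous representatives.

Second page: products of modules are exact, and an element of a graded product lives in finitely
many degrees. Cocycles, primitives and representatives can therefore be chosen degree by degree and
index by index, with $0$ outside a finite set of degrees. Hence the cohomology of the columns
consists of the Čech cochains with values in $PH^q$ (`isCohomologyRel_cechClassRel`), the induced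
horizontal differential is $\delta$ (`cechClassRel_cechDelta`), and $E_2$ is Čech cohomology
(`exists_secondPage_iso`).

Limit: fix a degree $i$ and a singular simplex $s$ of $K_i$. By local finiteness only finitely many
$f^{-1}U_\alpha$ contain $s$. The values at $s$ of Čech cochains form the ordered cochain complex of
the full simplex on these indices, which is contracted by inserting the smallest index in front
(`sum_coneHomotopy`). So the rows are exact in positive Čech degree, and a Čech $0$-cocycle is a
cochain on the simplices lying in some $f^{-1}U_\alpha$, which extends to $K_i$ by zero. The kernel
of $S^*(K_i)\to A^{0,*}$ consists of the cochains vanishing on these small simplices. It is acyclic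
by barycentric subdivision (`exists_coboundary_eq_of_vanishes_on_small`). Thus the total complex
computes $PH^*(X)$ (`Augmentation.convergesTo`).

Algebra: the pages are the classical subquotients $Z_r/B_r$ of a filtered complex. Isomorphisms such
as $H(E_r)\cong E_{r+1}$ come from linear relations of the form "having a common representative":
one checks that the relation is single valued and that exactly the boundaries are related to $0$, so
no map has to be built on chosen representatives (`exists_homology_iso_of_rel`). -/

/-! ### Ordered chains on a set of vertices -/

/-- Integral chains on `k`-tuples of elements of `V`; the tuples need not be injective. -/
abbrev TupleChain (V : Type*) (k : ℕ) := (Fin k → V) →₀ ℤ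

namespace TupleChain

variable {V V' : Type*}

/-- The boundary of a chain, the alternating sum of the faces (augmented, for `k = 0`). -/
def bd (k : ℕ) : TupleChain V (k + 1) →ₗ[ℤ] TupleChain V k :=
  Finsupp.linearCombination ℤ fun w => ∑ j : Fin (k + 1),
    (-1 : ℤ) ^ (j : ℕ) • Finsupp.single (w ∘ j.succAbove) (1 : ℤ)

/-- The cone with apex `b`. -/
def cone (b : V) (k : ℕ) : TupleChain V k →ₗ[ℤ] TupleChain V (k + 1) :=
  Finsupp.lmapDomain ℤ ℤ fun w => Fin.cons b w

/-- The chain map induced by a map of vertices. -/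
def push (g : V → V') (k : ℕ) : TupleChain V k →ₗ[ℤ] TupleChain V' k :=
  Finsupp.lmapDomain ℤ ℤ fun w => g ∘ w

lemma bd_single (k : ℕ) (w : Fin (k + 1) → V) :
    bd k (Finsupp.single w 1) = ∑ j : Fin (k + 1),
      (-1 : ℤ) ^ (j : ℕ) • Finsupp.single (w ∘ j.succAbove) (1 : ℤ) := by
  simp [bd]

lemma cone_single (b : V) (k : ℕ) (w : Fin k → V) :
    cone b k (Finsupp.single w 1) = Finsupp.single (Fin.cons b w) 1 := by
  simp [cone]

lemma push_single (g : V → V') (k : ℕ) (w : Fin k → V) :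
    push g k (Finsupp.single w 1) = Finsupp.single (g ∘ w) 1 := by
  simp [push]

lemma linearMap_ext {k : ℕ} {M : Type*} [AddCommGroup M] {f g : TupleChain V k →ₗ[ℤ] M}
    (h : ∀ w, f (Finsupp.single w 1) = g (Finsupp.single w 1)) : f = g :=
  Finsupp.lhom_ext' fun w => LinearMap.ext_ring (h w)

lemma bd_cone_zero (b : V) (c : TupleChain V 0) : bd 0 (cone b 0 c) = c := by
  refine LinearMap.congr_fun (f := bd 0 ∘ₗ cone b 0) (g := LinearMap.id)
    (linearMap_ext fun w => ?_) c
  simp only [LinearMap.comp_apply, cone_single, bd_single, LinearMap.id_apply]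
  simp

lemma bd_cone (b : V) (k : ℕ) (c : TupleChain V (k + 1)) :
    bd (k + 1) (cone b (k + 1) c) = c - cone b k (bd k c) := by
  refine LinearMap.congr_fun (f := bd (k + 1) ∘ₗ cone b (k + 1))
    (g := LinearMap.id - cone b k ∘ₗ bd k) (linearMap_ext fun w => ?_) c
  simp only [LinearMap.comp_apply, cone_single, bd_single, LinearMap.id_apply,
    LinearMap.sub_apply, map_sum, map_zsmul]
  rw [Fin.sum_univ_succ, sub_eq_add_neg, ← Finset.sum_neg_distrib]
  congr 1
  · simp only [Fin.val_zero, pow_zero, one_smul]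
    congr 1
  · refine Finset.sum_congr rfl fun j _ => ?_
    rw [Fin.val_succ, pow_succ, ← neg_smul, mul_neg_one]
    congr 2
    funext l
    refine Fin.cases ?_ (fun l => ?_) l
    · simp
    · simp

/-- A tuple is the cone over its tail with its first entry as apex, so this follows by induction
from the cone formula, without the usual double sum. -/
lemma bd_bd (k : ℕ) (c : TupleChain V (k + 2)) : bd k (bd (k + 1) c) = 0 := by
  refine LinearMap.congr_fun (f := bd k ∘ₗ bd (k + 1)) (g := 0) (linearMap_ext fun w => ?_) c
  clear c
  rw [LinearMap.comp_apply, LinearMap.zero_apply]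
  induction k with
  | zero =>
    rw [← Fin.cons_self_tail w, ← cone_single, bd_cone, map_sub, bd_cone_zero, sub_self]
  | succ k ih =>
    rw [← Fin.cons_self_tail w, ← cone_single, bd_cone, map_sub, bd_cone, ih, map_zero, sub_zero,
      sub_self]

lemma push_bd (g : V → V') (k : ℕ) (c : TupleChain V (k + 1)) :
    push g k (bd k c) = bd k (push g (k + 1) c) := by
  refine LinearMap.congr_fun (f := push g k ∘ₗ bd k) (g := bd k ∘ₗ push g (k + 1))
    (linearMap_ext fun w => ?_) c
  simp only [LinearMap.comp_apply, bd_single, push_single, map_sum, map_zsmul, Function.comp_assoc]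

lemma push_cone (g : V → V') (b : V) (k : ℕ) (c : TupleChain V k) :
    push g (k + 1) (cone b k c) = cone (g b) k (push g k c) := by
  refine LinearMap.congr_fun (f := push g (k + 1) ∘ₗ cone b k) (g := cone (g b) k ∘ₗ push g k)
    (linearMap_ext fun w => ?_) c
  simp only [LinearMap.comp_apply, cone_single, push_single]
  congr 1
  funext l
  refine Fin.cases ?_ (fun l => ?_) l <;> simp

/-! ### Subdivision of chains -/

variable (β : ∀ k, (Fin (k + 1) → V) → V)

/-- The subdivision operator attached to a choice `β` of an interior point of each simplex. -/
def sd : ∀ k, TupleChain V k →ₗ[ℤ] TupleChain V k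
  | 0 => LinearMap.id
  | k + 1 => Finsupp.linearCombination ℤ fun w =>
      cone (β k w) k (sd k (bd k (Finsupp.single w 1)))

/-- The chain homotopy between the identity and the subdivision operator. -/
def sdHomotopy : ∀ k, TupleChain V k →ₗ[ℤ] TupleChain V (k + 1)
  | 0 => 0
  | k + 1 => Finsupp.linearCombination ℤ fun w =>
      cone (β k w) (k + 1) (Finsupp.single w 1 - sdHomotopy k (bd k (Finsupp.single w 1)))

lemma sd_single (k : ℕ) (w : Fin (k + 1) → V) :
    sd β (k + 1) (Finsupp.single w 1) = cone (β k w) k (sd β k (bd k (Finsupp.single w 1))) := by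
  simp [sd]

lemma sdHomotopy_single (k : ℕ) (w : Fin (k + 1) → V) :
    sdHomotopy β (k + 1) (Finsupp.single w 1) =
      cone (β k w) (k + 1) (Finsupp.single w 1 - sdHomotopy β k (bd k (Finsupp.single w 1))) := by
  simp [sdHomotopy]

/-- By the cone formula the boundary of a cone over a cycle is that cycle. One dimension lower the
identity shows that the subdivided boundary is a cycle. The points `β` may be arbitrary. -/
lemma bd_sd (k : ℕ) (c : TupleChain V (k + 1)) :
    bd k (sd β (k + 1) c) = sd β k (bd k c) := by
  refine LinearMap.congr_fun (f := bd k ∘ₗ sd β (k + 1)) (g := sd β k ∘ₗ bd k)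
    (linearMap_ext fun w => ?_) c
  rw [LinearMap.comp_apply, LinearMap.comp_apply]
  induction k with
  | zero => rw [sd_single, bd_cone_zero]
  | succ k ih =>
    -- The induction also generalizes the chain `c`, on which the claim about generators does not
    -- depend; `0` fills that slot.
    have h : bd k ∘ₗ sd β (k + 1) = sd β k ∘ₗ bd k := linearMap_ext (ih 0)
    have h' := LinearMap.congr_fun h (bd (k + 1) (Finsupp.single w 1))
    rw [LinearMap.comp_apply, LinearMap.comp_apply, bd_bd, map_zero] at h'
    rw [sd_single, bd_cone, h', map_zero, sub_zero]

lemma bd_sdHomotopy (k : ℕ) (c : TupleChain V (k + 1)) :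
    bd (k + 1) (sdHomotopy β (k + 1) c) + sdHomotopy β k (bd k c) = c - sd β (k + 1) c := by
  refine LinearMap.congr_fun (f := bd (k + 1) ∘ₗ sdHomotopy β (k + 1) + sdHomotopy β k ∘ₗ bd k)
    (g := LinearMap.id - sd β (k + 1)) (linearMap_ext fun w => ?_) c
  simp only [LinearMap.add_apply, LinearMap.sub_apply, LinearMap.comp_apply, LinearMap.id_apply]
  induction k with
  | zero =>
    rw [sdHomotopy_single, bd_cone, sd_single]
    simp [sdHomotopy, sd]
  | succ k ih =>
    have h : bd (k + 1) ∘ₗ sdHomotopy β (k + 1) + sdHomotopy β k ∘ₗ bd k =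
      LinearMap.id - sd β (k + 1) := linearMap_ext (ih 0)
    have h' := LinearMap.congr_fun h (bd (k + 1) (Finsupp.single w 1))
    simp only [LinearMap.add_apply, LinearMap.sub_apply, LinearMap.comp_apply, LinearMap.id_apply,
      bd_bd, map_zero, add_zero] at h'
    rw [sdHomotopy_single, bd_cone, sd_single, map_sub (bd (k + 1)), h']
    simp only [sub_sub_cancel]
    abel

variable {β} {β' : ∀ k, (Fin (k + 1) → V') → V'} {g : V → V'}

/-- This will be applied to affine maps, which preserve barycenters; it makes subdivision compatible
with passing to faces. -/
lemma push_sd (hg : ∀ k w, g (β k w) = β' k (g ∘ w)) (k : ℕ) (c : TupleChain V k) :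
    push g k (sd β k c) = sd β' k (push g k c) := by
  induction k with
  | zero => rfl
  | succ k ih =>
    refine LinearMap.congr_fun (f := push g (k + 1) ∘ₗ sd β (k + 1))
      (g := sd β' (k + 1) ∘ₗ push g (k + 1)) (linearMap_ext fun w => ?_) c
    simp only [LinearMap.comp_apply]
    rw [sd_single, push_cone, ih, push_bd, push_single, sd_single, hg]

lemma push_sdHomotopy (hg : ∀ k w, g (β k w) = β' k (g ∘ w)) (k : ℕ) (c : TupleChain V k) :
    push g (k + 1) (sdHomotopy β k c) = sdHomotopy β' k (push g k c) := by
  induction k with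
  | zero => simp [sdHomotopy]
  | succ k ih =>
    refine LinearMap.congr_fun (f := push g (k + 2) ∘ₗ sdHomotopy β (k + 1))
      (g := sdHomotopy β' (k + 1) ∘ₗ push g (k + 1)) (linearMap_ext fun w => ?_) c
    simp only [LinearMap.comp_apply]
    rw [sdHomotopy_single, push_cone, map_sub, ih, push_bd, push_single, sdHomotopy_single, hg]

lemma push_sd_pow (hg : ∀ k w, g (β k w) = β' k (g ∘ w)) (k m : ℕ) (c : TupleChain V k) :
    push g k ((sd β k ^ m) c) = (sd β' k ^ m) (push g k c) := by
  induction m with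
  | zero => rfl
  | succ m ih => rw [pow_succ', pow_succ', Module.End.mul_apply, Module.End.mul_apply,
      push_sd hg, ih]

lemma bd_sd_pow (k m : ℕ) (c : TupleChain V (k + 1)) :
    bd k ((sd β (k + 1) ^ m) c) = (sd β k ^ m) (bd k c) := by
  induction m with
  | zero => rfl
  | succ m ih => rw [pow_succ', pow_succ', Module.End.mul_apply, Module.End.mul_apply,
      bd_sd, ih]

/-- The partial sums of `sdHomotopy` form a homotopy from the identity to the iterated
subdivision. -/
lemma sub_sd_pow (k m : ℕ) (c : TupleChain V (k + 1)) :
    c - (sd β (k + 1) ^ m) c =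
      bd (k + 1) (∑ i ∈ Finset.range m, sdHomotopy β (k + 1) ((sd β (k + 1) ^ i) c)) +
        ∑ i ∈ Finset.range m, sdHomotopy β k ((sd β k ^ i) (bd k c)) := by
  induction m with
  | zero => simp
  | succ m ih =>
    have h := bd_sdHomotopy β k ((sd β (k + 1) ^ m) c)
    rw [bd_sd_pow] at h
    rw [Finset.sum_range_succ, Finset.sum_range_succ, map_add, add_add_add_comm, ← ih, h, pow_succ',
      Module.End.mul_apply]
    abel

/-! ### Supports of subdivisions -/

lemma bd_mem_supported {k : ℕ} {P : Set (Fin (k + 1) → V)} {Q : Set (Fin k → V)}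
    (h : ∀ w ∈ P, ∀ j : Fin (k + 1), w ∘ j.succAbove ∈ Q) {c : TupleChain V (k + 1)}
    (hc : c ∈ Finsupp.supported ℤ ℤ P) : bd k c ∈ Finsupp.supported ℤ ℤ Q := by
  rw [Finsupp.supported_eq_span_single] at hc
  induction hc using Submodule.span_induction with
  | mem x hx =>
    obtain ⟨w, hw, rfl⟩ := hx
    rw [bd_single]
    exact sum_mem fun j _ => Submodule.smul_mem _ _ (Finsupp.single_mem_supported ℤ _ (h w hw j))
  | zero => simp
  | add x y _ _ hx hy => rw [map_add]; exact add_mem hx hy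
  | smul a x _ hx => rw [map_smul]; exact Submodule.smul_mem _ _ hx

lemma cone_mem_supported {k : ℕ} {b : V} {P : Set (Fin k → V)} {Q : Set (Fin (k + 1) → V)}
    (h : ∀ w ∈ P, Fin.cons b w ∈ Q) {c : TupleChain V k}
    (hc : c ∈ Finsupp.supported ℤ ℤ P) : cone b k c ∈ Finsupp.supported ℤ ℤ Q := by
  rw [Finsupp.supported_eq_span_single] at hc
  induction hc using Submodule.span_induction with
  | mem x hx =>
    obtain ⟨w, hw, rfl⟩ := hx
    rw [cone_single]
    exact Finsupp.single_mem_supported ℤ _ (h w hw)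
  | zero => simp
  | add x y _ _ hx hy => rw [map_add]; exact add_mem hx hy
  | smul a x _ hx => rw [map_smul]; exact Submodule.smul_mem _ _ hx

lemma map_mem_supported {k l : ℕ} (f : TupleChain V k →ₗ[ℤ] TupleChain V l)
    {P : Set (Fin k → V)} {Q : Set (Fin l → V)}
    (h : ∀ w ∈ P, f (Finsupp.single w 1) ∈ Finsupp.supported ℤ ℤ Q) {c : TupleChain V k}
    (hc : c ∈ Finsupp.supported ℤ ℤ P) : f c ∈ Finsupp.supported ℤ ℤ Q := by
  rw [Finsupp.supported_eq_span_single] at hc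
  induction hc using Submodule.span_induction with
  | mem x hx => obtain ⟨w, hw, rfl⟩ := hx; exact h w hw
  | zero => simp
  | add x y _ _ hx hy => rw [map_add]; exact add_mem hx hy
  | smul a x _ hx => rw [map_smul]; exact Submodule.smul_mem _ _ hx

/-- The tuples with entries in `C`. -/
def tuplesIn (C : Set V) (k : ℕ) : Set (Fin k → V) := {w | ∀ j, w j ∈ C}

lemma cons_mem_tuplesIn {C : Set V} {k : ℕ} {b : V} (hb : b ∈ C) (w : Fin k → V)
    (hw : w ∈ tuplesIn C k) : Fin.cons b w ∈ tuplesIn C (k + 1) :=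
  fun j => Fin.cases (by simpa using hb) (fun j => by simpa using hw j) j

/-- Subdivision adds no vertices beyond the points chosen by `β`, so a set closed under `β` is never
left. It is applied to the image of an affine simplex. -/
lemma sd_mem_supported {C : Set V} (hC : ∀ k w, w ∈ tuplesIn C (k + 1) → β k w ∈ C) {k : ℕ}
    {c : TupleChain V k} (hc : c ∈ Finsupp.supported ℤ ℤ (tuplesIn C k)) :
    sd β k c ∈ Finsupp.supported ℤ ℤ (tuplesIn C k) := by
  induction k with
  | zero => exact hc
  | succ k ih =>
    refine map_mem_supported _ (fun w hw => ?_) hc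
    rw [sd_single]
    refine cone_mem_supported (cons_mem_tuplesIn (hC k w hw)) (ih (bd_mem_supported ?_
      (Finsupp.single_mem_supported ℤ _ hw)))
    exact fun w hw j l => hw _

lemma sdHomotopy_mem_supported {C : Set V} (hC : ∀ k w, w ∈ tuplesIn C (k + 1) → β k w ∈ C) {k : ℕ}
    {c : TupleChain V k} (hc : c ∈ Finsupp.supported ℤ ℤ (tuplesIn C k)) :
    sdHomotopy β k c ∈ Finsupp.supported ℤ ℤ (tuplesIn C (k + 1)) := by
  induction k with
  | zero => simp [sdHomotopy]
  | succ k ih =>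
    refine map_mem_supported _ (fun w hw => ?_) hc
    rw [sdHomotopy_single]
    refine cone_mem_supported (cons_mem_tuplesIn (hC k w hw))
      (sub_mem (Finsupp.single_mem_supported ℤ _ hw) (ih (bd_mem_supported ?_
        (Finsupp.single_mem_supported ℤ _ hw))))
    exact fun w hw j l => hw _

end TupleChain

/-! ### Affine simplices in a standard simplex -/

/-- The standard simplex with vertex set `Fin n`. -/
abbrev Simp (n : ℕ) := stdSimplex ℝ (Fin n)

/-- The affine map between standard simplices with prescribed values at the vertices. -/
def affineSimplex {k n : ℕ} (w : Fin k → Simp n) : C(Simp k, Simp n) where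
  toFun t := ⟨∑ i, t i • (w i : Fin n → ℝ), (convex_stdSimplex ℝ (Fin n)).sum_mem
    (fun i _ => t.2.1 i) t.2.2 (fun i _ => (w i).2)⟩
  continuous_toFun := by
    refine Continuous.subtype_mk (continuous_finsetSum _ fun i _ => ?_) _
    exact ((continuous_apply i).comp (continuous_subtype_val (p := (· ∈ Simp k)))).smul
      (continuous_const (y := (w i : Fin n → ℝ)))

lemma affineSimplex_coe {k n : ℕ} (w : Fin k → Simp n) (t : Simp k) :
    (affineSimplex w t : Fin n → ℝ) = ∑ i, t i • (w i : Fin n → ℝ) := rfl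

lemma affineSimplex_apply {k n : ℕ} (w : Fin k → Simp n) (t : Simp k) (l : Fin n) :
    affineSimplex w t l = ∑ i, t i * w i l := by
  rw [affineSimplex_coe, Finset.sum_apply]
  rfl

lemma simp_ext {n : ℕ} {s t : Simp n} (h : ∀ i, s i = t i) : s = t := Subtype.ext (funext h)

lemma affineSimplex_affineSimplex {k n m : ℕ} (u : Fin n → Simp m) (w : Fin k → Simp n)
    (t : Simp k) :
    affineSimplex u (affineSimplex w t) = affineSimplex (affineSimplex u ∘ w) t := by
  refine simp_ext fun l => ?_
  simp only [affineSimplex_apply, Function.comp_apply, Finset.sum_mul, Finset.mul_sum]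
  rw [Finset.sum_comm]
  simp only [mul_assoc]

lemma vertex_apply {n : ℕ} (i j : Fin n) :
    (stdSimplex.vertex i : Simp n) j = if i = j then 1 else 0 := by
  change (stdSimplex.vertex i : Simp n).1 j = _
  simp [Pi.single_apply, eq_comm]

lemma affineSimplex_vertex {k n : ℕ} (w : Fin k → Simp n) (i : Fin k) :
    affineSimplex w (stdSimplex.vertex i) = w i :=
  simp_ext fun l => by simp [affineSimplex_apply, vertex_apply]

lemma affineSimplex_id {n : ℕ} (t : Simp n) :
    affineSimplex (fun i : Fin n => (stdSimplex.vertex i : Simp n)) t = t :=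
  simp_ext fun l => by simp [affineSimplex_apply, vertex_apply]

lemma map_eq_affineSimplex {k n : ℕ} (g : Fin k → Fin n) (t : Simp k) :
    stdSimplex.map g t = affineSimplex (fun i => (stdSimplex.vertex (g i) : Simp n)) t := by
  refine simp_ext fun l => ?_
  rw [affineSimplex_apply]
  rw [stdSimplex.map_coe]
  simp only [FunOnFinite.linearMap_apply_apply, vertex_apply, mul_ite, mul_one, mul_zero,
    Finset.sum_ite, Finset.sum_const_zero, add_zero]

/-- The barycenter of an affine simplex. -/
def bary {n : ℕ} (k : ℕ) (w : Fin (k + 1) → Simp n) : Simp n :=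
  affineSimplex w stdSimplex.barycenter

lemma affineSimplex_bary {n m : ℕ} (u : Fin n → Simp m) (k : ℕ) (w : Fin (k + 1) → Simp n) :
    affineSimplex u (bary k w) = bary k (affineSimplex u ∘ w) :=
  affineSimplex_affineSimplex u w _

/-- Closed balls are convex. -/
lemma dist_affineSimplex_le {k n : ℕ} (w : Fin k → Simp n) (t : Simp k) (x : Simp n) {d : ℝ}
    (h : ∀ i, dist (w i) x ≤ d) : dist (affineSimplex w t) x ≤ d := by
  have hc := (convex_closedBall (x : Fin n → ℝ) d).sum_mem (t := Finset.univ) (w := fun i => t i)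
    (z := fun i => (w i : Fin n → ℝ)) (fun i _ => t.2.1 i) t.2.2 (fun i _ => h i)
  exact hc

/-- The difference of the barycenter and $w_j$ is $\frac1{k+1}\sum_i(w_i-w_j)$; the term $i=j$
vanishes, leaving $k$ terms of norm at most $d/(k+1)$. -/
lemma dist_bary_le {n k : ℕ} (w : Fin (k + 1) → Simp n) {d : ℝ}
    (h : ∀ i j, dist (w i) (w j) ≤ d) (j : Fin (k + 1)) :
    dist (w j) (bary k w) ≤ k / (k + 1) * d := by
  have hk : (0 : ℝ) < k + 1 := by positivity
  have e : (bary k w : Fin n → ℝ) - w j = ∑ i, ((k : ℝ) + 1)⁻¹ • ((w i : Fin n → ℝ) - w j) := by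
    have hb (i : Fin (k + 1)) : (stdSimplex.barycenter : Simp (k + 1)) i = ((k : ℝ) + 1)⁻¹ := by
      refine (stdSimplex.barycenter_apply (𝕜 := ℝ) i).trans ?_
      simp
    rw [bary, affineSimplex_coe]
    simp only [hb, Fintype.card_fin, smul_sub, Finset.sum_sub_distrib,
      Finset.sum_const, Finset.card_univ]
    rw [← Nat.cast_smul_eq_nsmul ℝ, smul_smul]
    push_cast
    rw [mul_inv_cancel₀ hk.ne', one_smul]
  have hd : 0 ≤ d := dist_nonneg.trans (h j j)
  rw [dist_comm]
  change dist (bary k w : Fin n → ℝ) (w j) ≤ _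
  rw [dist_eq_norm, e, ← Finset.add_sum_erase _ _ (Finset.mem_univ j), sub_self, smul_zero,
    zero_add]
  refine (norm_sum_le _ _).trans ?_
  refine (Finset.sum_le_card_nsmul _ _ (((k : ℝ) + 1)⁻¹ * d) fun i _ => ?_).trans (le_of_eq ?_)
  · rw [norm_smul, Real.norm_of_nonneg (inv_nonneg.2 hk.le), ← dist_eq_norm]
    exact mul_le_mul_of_nonneg_left (h i j) (inv_nonneg.2 hk.le)
  · rw [Finset.card_erase_of_mem (Finset.mem_univ _), Finset.card_univ, Fintype.card_fin,
      Nat.add_sub_cancel, nsmul_eq_mul]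
    ring

/-! ### The mesh of subdivisions -/

open TupleChain

/-- The tuples of diameter at most `d`. -/
def tuplesDiam (n k : ℕ) (d : ℝ) : Set (Fin k → Simp n) := {w | ∀ i j, dist (w i) (w j) ≤ d}

lemma bary_mem_range {n k l : ℕ} (w : Fin k → Simp n) (u : Fin (l + 1) → Simp n)
    (hu : u ∈ tuplesIn (Set.range (affineSimplex w)) (l + 1)) :
    bary l u ∈ Set.range (affineSimplex w) := by
  choose t ht using hu
  obtain rfl : affineSimplex w ∘ t = u := funext ht
  exact ⟨bary l t, affineSimplex_bary w l t⟩

lemma single_mem_supported_range {n k : ℕ} (w : Fin k → Simp n) :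
    (Finsupp.single w 1 : TupleChain (Simp n) k) ∈
      Finsupp.supported ℤ ℤ (tuplesIn (Set.range (affineSimplex w)) k) :=
  Finsupp.single_mem_supported ℤ _ fun j => ⟨_, affineSimplex_vertex w j⟩

/-- A new simplex is a cone from the barycenter over a subdivided face. Two vertices on the face are
close by induction. A vertex on the face lies in the convex hull of `w`, hence is no further from
the barycenter than some vertex of `w`. The factor is the one for dimension `N`, uniform over all
lower dimensions, so that the induction closes. -/
lemma sd_mem_supported_tuplesDiam {n N k : ℕ} (hk : k ≤ N + 1) {d : ℝ} (hd : 0 ≤ d)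
    {c : TupleChain (Simp n) k} (hc : c ∈ Finsupp.supported ℤ ℤ (tuplesDiam n k d)) :
    sd bary k c ∈ Finsupp.supported ℤ ℤ (tuplesDiam n k (N / (N + 1) * d)) := by
  induction k with
  | zero =>
    have : tuplesDiam n 0 (N / (N + 1) * d) = Set.univ :=
      Set.eq_univ_of_forall fun w i => i.elim0
    rw [this, Finsupp.supported_univ]
    trivial
  | succ k ih =>
    refine map_mem_supported _ (fun w hw => ?_) hc
    rw [sd_single]
    have hb : bd k (Finsupp.single w 1) ∈ Finsupp.supported ℤ ℤ (tuplesDiam n k d) :=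
      bd_mem_supported (P := tuplesDiam n (k + 1) d) (Q := tuplesDiam n k d)
        (fun w hw j i i' => hw _ _) (Finsupp.single_mem_supported ℤ _ hw)
    have h₁ := ih (by lia) hb
    have h₂ : sd bary k (bd k (Finsupp.single w 1)) ∈ Finsupp.supported ℤ ℤ
        (tuplesIn (Set.range (affineSimplex w)) k) :=
      sd_mem_supported (fun l u hu => bary_mem_range w u hu)
        (bd_mem_supported (P := tuplesIn (Set.range (affineSimplex w)) (k + 1))
          (Q := tuplesIn (Set.range (affineSimplex w)) k)
          (fun w hw j l => hw _) (single_mem_supported_range w))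
    have h₃ : sd bary k (bd k (Finsupp.single w 1)) ∈ Finsupp.supported ℤ ℤ
        (tuplesDiam n k (N / (N + 1) * d) ∩ tuplesIn (Set.range (affineSimplex w)) k) := by
      rw [Finsupp.supported_inter]
      exact ⟨h₁, h₂⟩
    refine cone_mem_supported (fun u hu => ?_) h₃
    have hN : (k : ℝ) / (k + 1) * d ≤ N / (N + 1) * d := by
      refine mul_le_mul_of_nonneg_right ?_ hd
      rw [div_le_div_iff₀ (by positivity) (by positivity)]
      have : (k : ℝ) ≤ N := by exact_mod_cast (by lia : k ≤ N)
      nlinarith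
    have hb (j) : dist (u j) (bary k w) ≤ N / (N + 1) * d := by
      obtain ⟨t, ht⟩ := hu.2 j
      rw [← ht]
      exact dist_affineSimplex_le w t _ fun i => (dist_bary_le w hw i).trans hN
    have h0 : 0 ≤ (N : ℝ) / (N + 1) * d := by positivity
    intro i j
    refine Fin.cases ?_ (fun i => ?_) i <;> refine Fin.cases ?_ (fun j => ?_) j
    · simpa using h0
    · simpa [dist_comm] using hb j
    · simpa using hb i
    · simpa using hu.1 i j

lemma sd_pow_mem_supported_tuplesDiam {n k : ℕ} (m : ℕ) {d : ℝ} (hd : 0 ≤ d)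
    {c : TupleChain (Simp n) (k + 1)}
    (hc : c ∈ Finsupp.supported ℤ ℤ (tuplesDiam n (k + 1) d)) :
    (sd bary (k + 1) ^ m) c ∈
      Finsupp.supported ℤ ℤ (tuplesDiam n (k + 1) (((k : ℝ) / (k + 1)) ^ m * d)) := by
  induction m with
  | zero => simpa using hc
  | succ m ih =>
    rw [pow_succ' (sd bary (k + 1)), Module.End.mul_apply, pow_succ', mul_assoc]
    exact sd_mem_supported_tuplesDiam le_rfl (by positivity) ih

/-! ### Small simplices -/

section Small

variable {A : Type u} [TopologicalSpace A] {ι : Type w} {R : Type v} [CommRing R]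

/-- The affine simplices `w` in a standard simplex for which `s ∘ w` lies in a member of the
family `W`. -/
def smallTuples (W : ι → Set A) {n : ℕ} (s : C(Simp n, A)) (k : ℕ) : Set (Fin k → Simp n) :=
  {w | ∃ a, ∀ t, s (affineSimplex w t) ∈ W a}

/-- The simplices of the subdivision of `w` have their vertices, hence all their points, in the
image of `w`, so they lie in the same member of the family. -/
lemma sd_mem_supported_smallTuples {W : ι → Set A} {n : ℕ} {s : C(Simp n, A)} {k : ℕ}
    {c : TupleChain (Simp n) k} (hc : c ∈ Finsupp.supported ℤ ℤ (smallTuples W s k)) :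
    sd bary k c ∈ Finsupp.supported ℤ ℤ (smallTuples W s k) := by
  refine map_mem_supported _ (fun w hw => ?_) hc
  obtain ⟨a, ha⟩ := hw
  suffices hw : tuplesIn (Set.range (affineSimplex w)) k ⊆ smallTuples W s k by
    exact Finsupp.supported_mono hw
      (sd_mem_supported (fun l u hu => bary_mem_range w u hu) (single_mem_supported_range w))
  refine fun u hu => ⟨a, fun t => ?_⟩
  choose t' ht' using hu
  obtain rfl : affineSimplex w ∘ t' = u := funext ht'
  rw [← affineSimplex_affineSimplex]
  exact ha _

lemma sdHomotopy_mem_supported_smallTuples {W : ι → Set A} {n : ℕ} {s : C(Simp n, A)} {k : ℕ}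
    {c : TupleChain (Simp n) k} (hc : c ∈ Finsupp.supported ℤ ℤ (smallTuples W s k)) :
    sdHomotopy bary k c ∈ Finsupp.supported ℤ ℤ (smallTuples W s (k + 1)) := by
  refine map_mem_supported _ (fun w hw => ?_) hc
  obtain ⟨a, ha⟩ := hw
  suffices hw : tuplesIn (Set.range (affineSimplex w)) (k + 1) ⊆ smallTuples W s (k + 1) by
    exact Finsupp.supported_mono hw
      (sdHomotopy_mem_supported (fun l u hu => bary_mem_range w u hu) (single_mem_supported_range w))
  refine fun u hu => ⟨a, fun t => ?_⟩
  choose t' ht' using hu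
  obtain rfl : affineSimplex w ∘ t' = u := funext ht'
  rw [← affineSimplex_affineSimplex]
  exact ha _

lemma sd_pow_mem_supported_smallTuples {W : ι → Set A} {n : ℕ} {s : C(Simp n, A)} {k : ℕ}
    {c : TupleChain (Simp n) k} {m m' : ℕ} (hm : m ≤ m')
    (hc : (sd bary k ^ m) c ∈ Finsupp.supported ℤ ℤ (smallTuples W s k)) :
    (sd bary k ^ m') c ∈ Finsupp.supported ℤ ℤ (smallTuples W s k) := by
  induction m', hm using Nat.le_induction with
  | base => exact hc
  | succ m' _ ih =>
    rw [pow_succ', Module.End.mul_apply]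
    exact sd_mem_supported_smallTuples ih

/-- The fundamental chain of the standard simplex. -/
def fundamental (n : ℕ) : TupleChain (Simp n) n :=
  Finsupp.single (fun i => stdSimplex.vertex i) 1

/-- A sufficiently fine iterated subdivision of a singular simplex is small. -/
lemma exists_sd_pow_mem_supported_smallTuples {W : ι → Set A} (hW : ∀ a, IsOpen (W a))
    (hcov : ∀ x, ∃ a, x ∈ W a) {n : ℕ} (s : C(Simp (n + 1), A)) :
    ∃ m, (sd bary (n + 1) ^ m) (fundamental (n + 1)) ∈
      Finsupp.supported ℤ ℤ (smallTuples W s (n + 1)) := by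
  -- A Lebesgue number of the pulled back cover: subdivide until the mesh $(n/(n+1))^m d$ is below
  -- it, where $d$ bounds the diameter of the simplex.
  obtain ⟨δ, hδ, h⟩ := lebesgue_number_lemma_of_metric (isCompact_univ (X := Simp (n + 1)))
    (c := fun a => s ⁻¹' W a) (fun a => (hW a).preimage s.continuous)
    (fun x _ => Set.mem_iUnion.2 (hcov (s x)))
  obtain ⟨d, hd⟩ := Metric.isBounded_iff.1 (isCompact_univ (X := Simp (n + 1))).isBounded
  have hd0 : 0 ≤ d := dist_nonneg.trans
    (hd (Set.mem_univ (stdSimplex.vertex 0)) (Set.mem_univ (stdSimplex.vertex 0)))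
  have hlt : (n : ℝ) / (n + 1) < 1 := by
    rw [div_lt_one (by positivity)]
    linarith
  have hlim : Filter.Tendsto (fun m : ℕ => ((n : ℝ) / (n + 1)) ^ m * d) Filter.atTop (nhds 0) := by
    simpa using (tendsto_pow_atTop_nhds_zero_of_lt_one (by positivity) hlt).mul_const d
  obtain ⟨m, hm⟩ := (hlim.eventually_lt_const hδ).exists
  refine ⟨m, Finsupp.supported_mono ?_ (sd_pow_mem_supported_tuplesDiam m hd0
    (Finsupp.single_mem_supported ℤ _ fun i j => hd (Set.mem_univ _) (Set.mem_univ _)))⟩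
  intro w hw
  obtain ⟨a, ha⟩ := h (w 0) (Set.mem_univ _)
  refine ⟨a, fun t => ha ?_⟩
  exact (dist_affineSimplex_le w t (w 0) fun i => hw i 0).trans_lt hm

/-- The inclusion of the `j`-th face of a standard simplex. -/
def faceMap {n : ℕ} (j : Fin (n + 1)) : C(Simp n, Simp (n + 1)) :=
  affineSimplex fun i => stdSimplex.vertex (j.succAbove i)

/-- The coboundary of a singular cochain. -/
def coboundary {n : ℕ} (φ : C(Simp n, A) → R) (s : C(Simp (n + 1), A)) : R :=
  ∑ j : Fin (n + 1), (-1 : ℤ) ^ (j : ℕ) • φ (s.comp (faceMap j))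

/-- The value of a singular cochain on the image of a chain under a singular simplex. -/
def evalChain {n k : ℕ} (φ : C(Simp k, A) → R) (s : C(Simp n, A)) :
    TupleChain (Simp n) k →ₗ[ℤ] R :=
  Finsupp.linearCombination ℤ fun w => φ (s.comp (affineSimplex w))

lemma evalChain_single {n k : ℕ} (φ : C(Simp k, A) → R) (s : C(Simp n, A)) (w : Fin k → Simp n) :
    evalChain φ s (Finsupp.single w 1) = φ (s.comp (affineSimplex w)) := by
  simp [evalChain]

lemma evalChain_fundamental {n : ℕ} (φ : C(Simp n, A) → R) (s : C(Simp n, A)) :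
    evalChain φ s (fundamental n) = φ s := by
  rw [fundamental, evalChain_single]
  congr 1
  ext t
  exact congrArg s (affineSimplex_id t)

/-- This duality turns identities between chains of a standard simplex into identities between
singular cochains of the space. -/
lemma evalChain_coboundary {n k : ℕ} (φ : C(Simp k, A) → R) (s : C(Simp n, A))
    (c : TupleChain (Simp n) (k + 1)) :
    evalChain (coboundary φ) s c = evalChain φ s (bd k c) := by
  refine LinearMap.congr_fun (f := evalChain (coboundary φ) s) (g := evalChain φ s ∘ₗ bd k)
    (linearMap_ext fun w => ?_) c
  simp only [LinearMap.comp_apply, evalChain_single, bd_single, map_sum, map_zsmul, coboundary]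
  refine Finset.sum_congr rfl fun j _ => ?_
  congr 2
  ext t
  refine congrArg s ((affineSimplex_affineSimplex _ _ t).trans ?_)
  congr 2
  funext i
  exact affineSimplex_vertex _ _

lemma evalChain_push {n m k : ℕ} (φ : C(Simp k, A) → R) (s : C(Simp n, A)) (u : Fin m → Simp n)
    (c : TupleChain (Simp m) k) :
    evalChain φ s (push (affineSimplex u) k c) = evalChain φ (s.comp (affineSimplex u)) c := by
  refine LinearMap.congr_fun (f := evalChain φ s ∘ₗ push (affineSimplex u) k)
    (g := evalChain φ (s.comp (affineSimplex u))) (linearMap_ext fun w => ?_) c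
  simp only [LinearMap.comp_apply, evalChain_single, push_single]
  congr 1
  ext t
  exact congrArg s (affineSimplex_affineSimplex _ _ t).symm

lemma evalChain_eq_zero {W : ι → Set A} {n k : ℕ} {φ : C(Simp k, A) → R}
    (hφ : ∀ s a, (∀ t, s t ∈ W a) → φ s = 0) {s : C(Simp n, A)} {c : TupleChain (Simp n) k}
    (hc : c ∈ Finsupp.supported ℤ ℤ (smallTuples W s k)) : evalChain φ s c = 0 := by
  rw [evalChain, Finsupp.linearCombination_apply]
  refine Finset.sum_eq_zero fun w hw => ?_
  obtain ⟨a, ha⟩ := (Finsupp.mem_supported ℤ c).1 hc hw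
  exact (congrArg _ (hφ _ a ha)).trans (smul_zero _)

/-- With naturality of subdivision, this expresses the homotopy on the boundary of a simplex through
the homotopies of its faces. -/
lemma bd_fundamental (n : ℕ) :
    bd n (fundamental (n + 1)) =
      ∑ j : Fin (n + 1), (-1 : ℤ) ^ (j : ℕ) • push (faceMap j) n (fundamental n) := by
  rw [fundamental, bd_single]
  refine Finset.sum_congr rfl fun j _ => ?_
  rw [fundamental, push_single]
  congr 2
  funext i
  exact (affineSimplex_vertex _ i).symm

/-- The singular cochains vanishing on the simplices which are small with respect to an open cover
form an acyclic complex. -/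
theorem exists_coboundary_eq_of_vanishes_on_small {W : ι → Set A} (hW : ∀ a, IsOpen (W a))
    (hcov : ∀ x, ∃ a, x ∈ W a) {k : ℕ} (φ : C(Simp (k + 2), A) → R)
    (hφ : ∀ s a, (∀ t, s t ∈ W a) → φ s = 0) (hd : coboundary φ = 0) :
    ∃ ψ : C(Simp (k + 1), A) → R, (∀ s a, (∀ t, s t ∈ W a) → ψ s = 0) ∧ coboundary ψ = φ := by
  choose m hm using fun (n : ℕ) (s : C(Simp (n + 1), A)) =>
    exists_sd_pow_mem_supported_smallTuples hW hcov s
  have hT {n i : ℕ} (s : C(Simp (n + 1), A)) (hi : m n s ≤ i) (φ : C(Simp (n + 2), A) → R)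
      (hφ : ∀ s a, (∀ t, s t ∈ W a) → φ s = 0) :
      evalChain φ s (sdHomotopy bary (n + 1) ((sd bary (n + 1) ^ i) (fundamental (n + 1)))) = 0 :=
    evalChain_eq_zero hφ
      (sdHomotopy_mem_supported_smallTuples (sd_pow_mem_supported_smallTuples hi (hm n s)))
  have hstab {n M : ℕ} (s : C(Simp (n + 1), A)) (hM : m n s ≤ M) (φ : C(Simp (n + 2), A) → R)
      (hφ : ∀ s a, (∀ t, s t ∈ W a) → φ s = 0) :
      ∑ i ∈ Finset.range M,
          evalChain φ s (sdHomotopy bary (n + 1) ((sd bary (n + 1) ^ i) (fundamental (n + 1)))) =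
        ∑ i ∈ Finset.range (m n s),
          evalChain φ s (sdHomotopy bary (n + 1) ((sd bary (n + 1) ^ i) (fundamental (n + 1)))) :=
    (Finset.sum_subset (Finset.range_mono hM) fun i _ hi =>
      hT s (not_lt.1 fun h => hi (Finset.mem_range.2 h)) φ hφ).symm
  -- Here $\psi(s)=\sum_{i<m(s)}\varphi(s_*T\,\mathrm{sd}^i)$, with $T$ the subdivision homotopy
  -- applied to the fundamental chain. The number $m(s)$ depends on the simplex. By `hstab` the sum
  -- does not change if it is extended beyond $m(s)$, because the further chains are small and
  -- $\varphi$ vanishes on them.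
  refine ⟨fun s => ∑ i ∈ Finset.range (m k s),
    evalChain φ s (sdHomotopy bary (k + 1) ((sd bary (k + 1) ^ i) (fundamental (k + 1)))),
    fun s a hs => ?_, funext fun s => ?_⟩
  · refine Finset.sum_eq_zero fun i _ => evalChain_eq_zero hφ
      (sdHomotopy_mem_supported_smallTuples (sd_pow_mem_supported_smallTuples (Nat.zero_le i) ?_))
    exact Finsupp.single_mem_supported ℤ _ ⟨a, fun t => hs _⟩
  -- One common number of subdivisions for `s` and all its faces. In the homotopy formula of
  -- `sub_sd_pow` the term $\varphi(\mathrm{sd}^M)$ vanishes by smallness and the term with the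
  -- outer boundary vanishes since $\varphi$ is a cocycle; what is left is the coboundary of $\psi$.
  · obtain ⟨M, hM, hM'⟩ : ∃ M, m (k + 1) s ≤ M ∧ ∀ j, m k (s.comp (faceMap j)) ≤ M :=
      ⟨m (k + 1) s + ∑ j, m k (s.comp (faceMap j)), by lia, fun j =>
        (Finset.single_le_sum (f := fun j => m k (s.comp (faceMap j))) (fun _ _ => Nat.zero_le _)
          (Finset.mem_univ j)).trans (by lia)⟩
    have key := congrArg (evalChain φ s)
      (sub_sd_pow (β := bary) (k + 1) M (fundamental (k + 2)))
    rw [map_sub, evalChain_fundamental, map_add, ← evalChain_coboundary, hd,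
      evalChain_eq_zero hφ (sd_pow_mem_supported_smallTuples hM (hm (k + 1) s)), sub_zero] at key
    rw [key, coboundary]
    have h0 : ∀ c, evalChain (0 : C(Simp (k + 3), A) → R) s c = 0 := fun c => by
      simp [evalChain, Finsupp.linearCombination_apply]
    rw [h0, zero_add]
    simp only [← hstab _ (hM' _) φ hφ]
    simp only [bd_fundamental, map_sum, map_zsmul, Finset.smul_sum]
    rw [Finset.sum_comm]
    refine Finset.sum_congr rfl fun i _ => Finset.sum_congr rfl fun j _ => ?_
    rw [faceMap, ← push_sd_pow (fun k w => affineSimplex_bary _ k w),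
      ← push_sdHomotopy (fun k w => affineSimplex_bary _ k w), evalChain_push]

end Small

/-! ### Graded modules -/

section Grading

variable {M M' : Type*} [AddCommGroup M] [AddCommGroup M']

lemma isInternal_of_sum {gr : ℤ → AddSubgroup M}
    (hspan : ∀ x, ∃ (s : Finset ℤ) (g : ℤ → M), (∀ i, g i ∈ gr i) ∧ x = ∑ i ∈ s, g i)
    (hind : ∀ (s : Finset ℤ) (g : ℤ → M), (∀ i, g i ∈ gr i) → ∑ i ∈ s, g i = 0 →
      ∀ i ∈ s, g i = 0) : DirectSum.IsInternal gr := by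
  classical
  constructor
  · rw [injective_iff_map_eq_zero]
    intro f hf
    rw [DirectSum.coeAddMonoidHom_eq_dfinsuppSum, DFinsupp.sum] at hf
    refine DFinsupp.ext fun i => Subtype.ext ?_
    by_cases hi : i ∈ DFinsupp.support f
    · exact hind _ (fun i => (f i : M)) (fun i => (f i).2) hf i hi
    · exact congrArg Subtype.val (DFinsupp.notMem_support_iff.1 hi)
  · intro x
    obtain ⟨s, g, hg, rfl⟩ := hspan x
    refine ⟨∑ i ∈ s, DirectSum.of (fun i => gr i) i ⟨g i, hg i⟩, ?_⟩
    simp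

/-- The projection to the degree `i` part of a graded group. -/
def gproj {gr : ℤ → AddSubgroup M} (h : DirectSum.IsInternal gr) (i : ℤ) : M →+ M :=
  (gr i).subtype.comp ((DFinsupp.evalAddMonoidHom i).comp
    (AddEquiv.ofBijective (DirectSum.coeAddMonoidHom gr) h).symm.toAddMonoidHom)

section

variable {gr : ℤ → AddSubgroup M} (h : DirectSum.IsInternal gr)
  {gr' : ℤ → AddSubgroup M'} (h' : DirectSum.IsInternal gr')

lemma gproj_mem (i : ℤ) (x : M) : gproj h i x ∈ gr i := SetLike.coe_mem _

lemma gproj_symm_of {i : ℤ} {x : M} (hx : x ∈ gr i) :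
    (AddEquiv.ofBijective (DirectSum.coeAddMonoidHom gr) h).symm x =
      DirectSum.of (fun i => gr i) i ⟨x, hx⟩ := by
  rw [AddEquiv.symm_apply_eq]
  exact (DirectSum.coeAddMonoidHom_of gr i ⟨x, hx⟩).symm

lemma gproj_of_mem {i : ℤ} {x : M} (hx : x ∈ gr i) : gproj h i x = x := by
  change (((AddEquiv.ofBijective (DirectSum.coeAddMonoidHom gr) h).symm x) i : M) = x
  rw [gproj_symm_of h hx, DirectSum.of_eq_same]

lemma gproj_of_mem_of_ne {i j : ℤ} (hij : i ≠ j) {x : M} (hx : x ∈ gr j) : gproj h i x = 0 := by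
  change (((AddEquiv.ofBijective (DirectSum.coeAddMonoidHom gr) h).symm x) i : M) = 0
  rw [gproj_symm_of h hx, DirectSum.of_eq_of_ne _ _ _ hij]
  rfl

lemma exists_eq_sum_gproj (x : M) : ∃ s : Finset ℤ, x = ∑ i ∈ s, gproj h i x := by
  classical
  obtain ⟨f, rfl⟩ := h.2 x
  refine ⟨DFinsupp.support f, ?_⟩
  have hf : (AddEquiv.ofBijective (DirectSum.coeAddMonoidHom gr) h).symm
      (DirectSum.coeAddMonoidHom gr f) = f :=
    (AddEquiv.ofBijective (DirectSum.coeAddMonoidHom gr) h).symm_apply_apply f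
  have e (i : ℤ) : gproj h i (DirectSum.coeAddMonoidHom gr f) = f i := by
    change (((AddEquiv.ofBijective (DirectSum.coeAddMonoidHom gr) h).symm
      (DirectSum.coeAddMonoidHom gr f)) i : M) = f i
    rw [hf]
  simp only [e]
  rw [DirectSum.coeAddMonoidHom_eq_dfinsuppSum, DFinsupp.sum]

lemma gproj_sum {s : Finset ℤ} {g : ℤ → M} (hg : ∀ i, g i ∈ gr i) {i : ℤ} (hi : i ∈ s) :
    gproj h i (∑ j ∈ s, g j) = g i := by
  rw [map_sum, Finset.sum_eq_single_of_mem i hi fun j _ hj => gproj_of_mem_of_ne h hj.symm (hg j),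
    gproj_of_mem h (hg i)]

/-- The freedom to enlarge the set of degrees lets finitely many elements be decomposed over one
common set. -/
lemma exists_forall_eq_sum_gproj (x : M) :
    ∃ s : Finset ℤ, ∀ s', s ⊆ s' → x = ∑ i ∈ s', gproj h i x := by
  obtain ⟨s, hs⟩ := exists_eq_sum_gproj h x
  refine ⟨s, fun s' hs' => ?_⟩
  rw [← Finset.sum_subset hs' fun i _ hi => ?_]
  · exact hs
  · rw [hs, map_sum]
    exact Finset.sum_eq_zero fun j hj => gproj_of_mem_of_ne h (i := i) (j := j)
      (fun hij => hi (hij ▸ hj)) (gproj_mem h j x)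

lemma gproj_comm (φ : M →+ M') (hφ : ∀ i, ∀ x ∈ gr i, φ x ∈ gr' i) (i : ℤ) (x : M) :
    φ (gproj h i x) = gproj h' i (φ x) := by
  obtain ⟨s, hs⟩ := exists_eq_sum_gproj h x
  by_cases hi : i ∈ s
  · conv_rhs => rw [hs, map_sum]
    rw [gproj_sum h' (fun j => hφ j _ (gproj_mem h j x)) hi]
  · have h0 : gproj h i x = 0 := by
      rw [hs, map_sum]
      exact Finset.sum_eq_zero fun j hj =>
        gproj_of_mem_of_ne h (i := i) (j := j) (fun hij => hi (hij ▸ hj)) (gproj_mem h j x)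
    rw [h0, map_zero, hs, map_sum, map_sum]
    exact (Finset.sum_eq_zero fun j hj =>
      gproj_of_mem_of_ne h' (i := i) (j := j) (fun hij => hi (hij ▸ hj))
        (hφ j _ (gproj_mem h j x))).symm

/-- A bijection of degree `0` between graded groups identifies the gradings. -/
lemma map_gr_eq (h : DirectSum.IsInternal gr) (h' : DirectSum.IsInternal gr') (φ : M →+ M')
    (hφ : ∀ i, ∀ x ∈ gr i, φ x ∈ gr' i) (hb : Function.Bijective φ)
    (i : ℤ) : (gr i).map φ = gr' i := by
  refine le_antisymm (AddSubgroup.map_le_iff_le_comap.2 (hφ i)) fun y hy => ?_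
  obtain ⟨x, rfl⟩ := hb.2 y
  refine ⟨gproj h i x, gproj_mem h i x, ?_⟩
  rw [gproj_comm h h' φ hφ, gproj_of_mem h' hy]

end

variable {S : Type*} [Ring S] [Module S M] [Module S M'] {gr' : ℤ → AddSubgroup M'}
  {gr : ℤ → AddSubgroup M}

/-- A submodule is homogeneous if it contains the homogeneous components of its elements. -/
def IsHomogeneousSub (h : DirectSum.IsInternal gr) (N : Submodule S M) : Prop :=
  ∀ i, ∀ x ∈ N, gproj h i x ∈ N

section

variable {h : DirectSum.IsInternal gr} {h' : DirectSum.IsInternal gr'} {N N' : Submodule S M}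

lemma IsHomogeneousSub.sup (hN : IsHomogeneousSub h N) (hN' : IsHomogeneousSub h N') :
    IsHomogeneousSub h (N ⊔ N') := by
  intro i x hx
  obtain ⟨a, ha, b, hb, rfl⟩ := Submodule.mem_sup.1 hx
  rw [map_add]
  exact Submodule.add_mem_sup (hN i a ha) (hN' i b hb)

lemma IsHomogeneousSub.inf (hN : IsHomogeneousSub h N) (hN' : IsHomogeneousSub h N') :
    IsHomogeneousSub h (N ⊓ N') :=
  fun i x hx => ⟨hN i x hx.1, hN' i x hx.2⟩

lemma IsHomogeneousSub.map (hN : IsHomogeneousSub h N) {φ : M →ₗ[S] M'}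
    (hφ : ∀ i, ∀ x ∈ gr i, φ x ∈ gr' i) : IsHomogeneousSub h' (N.map φ) := by
  rintro i _ ⟨x, hx, rfl⟩
  exact ⟨gproj h i x, hN i x hx, gproj_comm h h' φ.toAddMonoidHom hφ i x⟩

lemma IsHomogeneousSub.comap {N : Submodule S M'} (hN : IsHomogeneousSub h' N) {φ : M →ₗ[S] M'}
    (hφ : ∀ i, ∀ x ∈ gr i, φ x ∈ gr' i) : IsHomogeneousSub h (N.comap φ) := by
  intro i x hx
  have := gproj_comm h h' φ.toAddMonoidHom hφ i x
  exact (congrArg (· ∈ N) this).mpr (hN i _ hx)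

lemma IsHomogeneousSub.toAddSubgroup_eq (hN : IsHomogeneousSub h N) :
    N.toAddSubgroup = ⨆ i, N.toAddSubgroup ⊓ gr i := by
  refine le_antisymm (fun x hx => ?_) (iSup_le fun i => inf_le_left)
  obtain ⟨s, hs⟩ := exists_eq_sum_gproj h x
  rw [hs]
  exact sum_mem fun i _ => AddSubgroup.mem_iSup_of_mem i ⟨hN i x hx, gproj_mem h i x⟩

end

lemma mem_submoduleOf_iff {Z B : Submodule S M} {z : Z} : z ∈ B.submoduleOf Z ↔ (z : M) ∈ B :=
  Iff.rfl

/-- The grading induced on the subquotient `Z / B`. -/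
def subquotGrading (gr : ℤ → AddSubgroup M) (Z B : Submodule S M) (i : ℤ) :
    AddSubgroup (Z ⧸ B.submoduleOf Z) :=
  ((gr i).comap Z.subtype.toAddMonoidHom).map (B.submoduleOf Z).mkQ.toAddMonoidHom

/-- Homogeneity of `Z` gives the decomposition of a class, and homogeneity of `B` its uniqueness. -/
lemma isInternal_subquotGrading {h : DirectSum.IsInternal gr} {Z B : Submodule S M}
    (hZ : IsHomogeneousSub h Z) (hB : IsHomogeneousSub h B) :
    DirectSum.IsInternal (subquotGrading gr Z B) := by
  refine isInternal_of_sum (fun x => ?_) fun s g hg hsum i hi => ?_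
  · obtain ⟨z, rfl⟩ := Submodule.mkQ_surjective _ x
    obtain ⟨s, hs⟩ := exists_eq_sum_gproj h (z : M)
    refine ⟨s, fun i => (B.submoduleOf Z).mkQ ⟨gproj h i z, hZ i _ z.2⟩,
      fun i => ⟨_, gproj_mem h i z, rfl⟩, ?_⟩
    rw [← map_sum]
    congr 1
    refine Subtype.ext ?_
    rw [AddSubmonoidClass.coe_finsetSum]
    exact hs
  · choose z hz hzg using hg
    have hmk (i : ℤ) : (B.submoduleOf Z).mkQ (z i) = g i := hzg i
    simp only [← hmk] at hsum ⊢
    rw [← map_sum, Submodule.mkQ_apply, Submodule.Quotient.mk_eq_zero, mem_submoduleOf_iff,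
      AddSubmonoidClass.coe_finsetSum] at hsum
    rw [Submodule.mkQ_apply, Submodule.Quotient.mk_eq_zero, mem_submoduleOf_iff]
    have := hB i _ hsum
    rwa [gproj_sum h (g := fun i => (z i : M)) hz hi] at this

end Grading

lemma isGrading_subquotGrading {R : Type v} [CommRing R] {M : Type*} [AddCommGroup M]
    [Module R[X] M] {gr : ℤ → AddSubgroup M} (h : IsGrading (R := R) gr) {Z B : Submodule R[X] M}
    (hZ : IsHomogeneousSub h.isInternal Z) (hB : IsHomogeneousSub h.isInternal B) :
    IsGrading (R := R) (subquotGrading gr Z B) where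
  isInternal := isInternal_subquotGrading hZ hB
  C_smul_mem := by
    rintro a i _ ⟨z, hz, rfl⟩
    exact ⟨C a • z, h.C_smul_mem a i _ hz, map_smul (B.submoduleOf Z).mkQ _ _⟩
  X_smul_mem := by
    rintro i _ ⟨z, hz, rfl⟩
    exact ⟨(X : R[X]) • z, h.X_smul_mem i _ hz, map_smul (B.submoduleOf Z).mkQ _ _⟩

/-! ### Linear maps and isomorphisms from linear relations -/

section Relation

variable {S : Type*} [Ring S] {M N : Type*} [AddCommGroup M] [Module S M] [AddCommGroup N]
  [Module S N]

/-- A single valued linear relation defines a linear map. -/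
lemma exists_linearMap_of_rel (Z : Submodule S M) (G : Submodule S (M × N))
    (h₁ : ∀ z ∈ Z, ∃ n, (z, n) ∈ G) (h₂ : ∀ n, (0, n) ∈ G → n = 0) :
    ∃ θ : Z →ₗ[S] N, ∀ z : Z, ((z : M), θ z) ∈ G := by
  choose θ hθ using fun z : Z => h₁ z z.2
  have huniq {z : M} {n n' : N} (h : (z, n) ∈ G) (h' : (z, n') ∈ G) : n = n' := by
    refine sub_eq_zero.1 (h₂ _ ?_)
    simpa using sub_mem h h'
  exact ⟨{ toFun := θ
           map_add' := fun x y => huniq (hθ (x + y)) (add_mem (hθ x) (hθ y))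
           map_smul' := fun a x => huniq (hθ (a • x)) (G.smul_mem a (hθ x)) }, hθ⟩

end Relation

/-! ### Cohomology classes of cocycles, as a linear relation -/

section Homology

variable {S : Type v} [Ring S] {κ : Type*} {c : ComplexShape κ}
  (K : HomologicalComplex (ModuleCat.{w} S) c)

lemma iCycles_injective (k : κ) : Function.Injective (K.iCycles k).hom :=
  (ModuleCat.mono_iff_injective _).1 inferInstance

lemma homologyπ_surjective (k : κ) : Function.Surjective (K.homologyπ k).hom :=
  (ModuleCat.epi_iff_surjective _).1 inferInstance

lemma d_iCycles (k l : κ) (y : K.cycles k) : (K.d k l).hom ((K.iCycles k).hom y) = 0 :=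
  congrArg (fun g => g.hom y) (K.iCycles_d k l)

lemma exists_iCycles_eq {k : κ} {x : K.X k} (hx : ∀ l, (K.d k l).hom x = 0) :
    ∃ y : K.cycles k, (K.iCycles k).hom y = x := by
  have hx' : (K.sc k).g.hom x = 0 := hx _
  refine ⟨(K.sc k).moduleCatCyclesIso.inv.hom ⟨x, hx'⟩, ?_⟩
  exact congrArg (fun g => g.hom ⟨x, hx'⟩) (K.sc k).moduleCatCyclesIso_inv_iCycles

lemma homologyπ_eq_zero_iff {k : κ} (y : K.cycles k) :
    (K.homologyπ k).hom y = 0 ↔ ∃ j x, (K.d j k).hom x = (K.iCycles k).hom y := by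
  constructor
  · intro h
    -- If `k` has no predecessor in the shape, `c.prev k` is `k` itself and the differential into it
    -- is zero, so no case distinction is needed.
    have hex : (ShortComplex.mk (K.toCycles (c.prev k) k) (K.homologyπ k)
        (by simp)).Exact := by
      exact ShortComplex.exact_of_g_is_cokernel _ (K.homologyIsCokernel _ k rfl)
    obtain ⟨x, hx⟩ := (ShortComplex.moduleCat_exact_iff _).1 hex y h
    refine ⟨_, x, ?_⟩
    rw [← hx]
    exact (congrArg (fun g => g.hom x) (K.toCycles_i (c.prev k) k)).symm
  · rintro ⟨j, x, hx⟩
    have : (K.toCycles j k).hom x = y := iCycles_injective K k (by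
      rw [← hx]
      exact congrArg (fun g => g.hom x) (K.toCycles_i j k))
    rw [← this]
    exact congrArg (fun g => g.hom x) (K.toCycles_comp_homologyπ j k)

/-- `h` is the cohomology class of the cocycle `z`. -/
def IsClass (k : κ) (z : K.X k) (h : K.homology k) : Prop :=
  ∃ y : K.cycles k, (K.iCycles k).hom y = z ∧ (K.homologyπ k).hom y = h

/-- The relation `IsClass` as a submodule. -/
def classRel (k : κ) : Submodule S (K.X k × K.homology k) :=
  LinearMap.range ((K.iCycles k).hom.prod (K.homologyπ k).hom)

lemma mem_classRel {k : κ} {z : K.X k} {h : K.homology k} :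
    (z, h) ∈ classRel K k ↔ IsClass K k z h := by
  simp [classRel, IsClass]

variable {K}

lemma IsClass.add {k : κ} {z z' : K.X k} {h h' : K.homology k} (hz : IsClass K k z h)
    (hz' : IsClass K k z' h') : IsClass K k (z + z') (h + h') :=
  (mem_classRel K).1 (add_mem ((mem_classRel K).2 hz) ((mem_classRel K).2 hz'))

lemma IsClass.zero (k : κ) : IsClass K k 0 0 := (mem_classRel K).1 (zero_mem _)

lemma IsClass.smul {k : κ} {z : K.X k} {h : K.homology k} (a : S) (hz : IsClass K k z h) :
    IsClass K k (a • z) (a • h) :=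
  (mem_classRel K).1 (Submodule.smul_mem _ a ((mem_classRel K).2 hz))

lemma IsClass.zsmul {k : κ} {z : K.X k} {h : K.homology k} (a : ℤ) (hz : IsClass K k z h) :
    IsClass K k (a • z) (a • h) :=
  (mem_classRel K).1 (zsmul_mem ((mem_classRel K).2 hz) a)

lemma IsClass.sum {α : Type*} {s : Finset α} {k : κ} {z : α → K.X k} {h : α → K.homology k}
    (hz : ∀ a ∈ s, IsClass K k (z a) (h a)) : IsClass K k (∑ a ∈ s, z a) (∑ a ∈ s, h a) := by
  classical
  induction s using Finset.induction_on with
  | empty => exact IsClass.zero k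
  | insert a s ha ih =>
    rw [Finset.sum_insert ha, Finset.sum_insert ha]
    exact (hz a (Finset.mem_insert_self a s)).add
      (ih fun b hb => hz b (Finset.mem_insert_of_mem hb))

lemma IsClass.d_eq_zero {k : κ} {z : K.X k} {h : K.homology k} (hz : IsClass K k z h) (l : κ) :
    (K.d k l).hom z = 0 := by
  obtain ⟨y, rfl, -⟩ := hz
  exact d_iCycles K k l y

lemma exists_isClass {k : κ} {z : K.X k} (hz : ∀ l, (K.d k l).hom z = 0) :
    ∃ h, IsClass K k z h := by
  obtain ⟨y, rfl⟩ := exists_iCycles_eq K hz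
  exact ⟨_, y, rfl, rfl⟩

lemma exists_isClass' {k : κ} (h : K.homology k) : ∃ z, IsClass K k z h := by
  obtain ⟨y, rfl⟩ := homologyπ_surjective K k h
  exact ⟨_, y, rfl, rfl⟩

lemma IsClass.eq_zero {k : κ} {h : K.homology k} (hz : IsClass K k 0 h) : h = 0 := by
  obtain ⟨y, hy, rfl⟩ := hz
  rw [iCycles_injective K k (hy.trans (map_zero _).symm), map_zero]

lemma isClass_zero_iff {k : κ} {z : K.X k} :
    IsClass K k z 0 ↔ ∃ j x, (K.d j k).hom x = z := by
  constructor
  · rintro ⟨y, rfl, hy⟩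
    exact (homologyπ_eq_zero_iff K y).1 hy
  · rintro ⟨j, x, rfl⟩
    obtain ⟨y, hy⟩ := exists_iCycles_eq K (x := (K.d j k).hom x) (fun l =>
      congrArg (fun g => g.hom x) (K.d_comp_d j k l))
    exact ⟨y, hy, (homologyπ_eq_zero_iff K y).2 ⟨j, x, hy.symm⟩⟩

lemma IsClass.map {L : HomologicalComplex (ModuleCat.{w} S) c} (f : K ⟶ L) {k : κ} {z : K.X k}
    {h : K.homology k} (hz : IsClass K k z h) :
    IsClass L k ((f.f k).hom z) ((HomologicalComplex.homologyMap f k).hom h) := by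
  obtain ⟨y, rfl, rfl⟩ := hz
  refine ⟨(HomologicalComplex.cyclesMap f k).hom y, ?_, ?_⟩
  · exact congrArg (fun g => g.hom y) (HomologicalComplex.cyclesMap_i f k)
  · exact congrArg (fun g => g.hom y) (HomologicalComplex.homologyπ_naturality f k).symm

variable (K)

/-- An isomorphism from the homology of a complex of graded modules to a graded module `N` can be
given by a linear relation between cycles and elements of `N`. -/
lemma exists_homology_iso_of_rel {k : κ} {N : ModuleCat.{w} S} (G : Submodule S (K.X k × N))
    (gr : ∀ k, ℤ → AddSubgroup (K.X k)) (grN : ℤ → AddSubgroup N)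
    (h₁ : ∀ x, (∀ l, (K.d k l).hom x = 0) → ∃ n, (x, n) ∈ G)
    (h₁' : ∀ x n, (x, n) ∈ G → ∀ l, (K.d k l).hom x = 0)
    (h₂ : ∀ n, ∃ x, (x, n) ∈ G)
    (h₃ : ∀ x, (x, 0) ∈ G ↔ ∃ j y, (K.d j k).hom y = x)
    (h₄ : ∀ n, (0, n) ∈ G → n = 0)
    (hgr : ∀ x n i, (x, n) ∈ G → x ∈ gr k i → n ∈ grN i)
    (hgr' : ∀ n i, n ∈ grN i → ∃ x ∈ gr k i, (x, n) ∈ G) :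
    ∃ e : K.homology k ≅ N,
      ∀ i, (homologyGrading K gr k i).map e.hom.hom.toAddMonoidHom = grN i := by
  obtain ⟨θ, hθ⟩ := exists_linearMap_of_rel (LinearMap.range (K.iCycles k).hom) G
    (fun x hx => by
      obtain ⟨y, rfl⟩ := hx
      exact h₁ _ fun l => d_iCycles K k l y) h₄
  have huniq {z : K.X k} {n n' : N} (h : (z, n) ∈ G) (h' : (z, n') ∈ G) : n = n' := by
    refine sub_eq_zero.1 (h₄ _ ?_)
    simpa using sub_mem h h'
  let φ : K.cycles k →ₗ[S] N := θ ∘ₗ (K.iCycles k).hom.rangeRestrict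
  have hφ (y) : ((K.iCycles k).hom y, φ y) ∈ G :=
    hθ ((K.iCycles k).hom.rangeRestrict y)
  have hker : LinearMap.ker (K.homologyπ k).hom = LinearMap.ker φ := by
    ext y
    rw [LinearMap.mem_ker, LinearMap.mem_ker, homologyπ_eq_zero_iff, ← h₃]
    exact ⟨fun h => huniq (hφ y) h, fun h => h ▸ hφ y⟩
  have hsurj : Function.Surjective φ := fun n => by
    obtain ⟨x, hx⟩ := h₂ n
    obtain ⟨y, rfl⟩ := exists_iCycles_eq K (h₁' x n hx)
    exact ⟨y, huniq (hφ y) hx⟩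
  let e : K.homology k ≃ₗ[S] N :=
    ((K.homologyπ k).hom.quotKerEquivOfSurjective (homologyπ_surjective K k)).symm.trans
      ((Submodule.quotEquivOfEq _ _ hker).trans (φ.quotKerEquivOfSurjective hsurj))
  have he (y) : e ((K.homologyπ k).hom y) = φ y := by
    have : ((K.homologyπ k).hom.quotKerEquivOfSurjective (homologyπ_surjective K k)).symm
        ((K.homologyπ k).hom y) = Submodule.Quotient.mk y := by
      rw [LinearEquiv.symm_apply_eq]
      rfl
    simp only [e, LinearEquiv.trans_apply, this]
    rfl
  refine ⟨e.toModuleIso, fun i => le_antisymm ?_ ?_⟩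
  · rintro _ ⟨_, ⟨y, hy, rfl⟩, rfl⟩
    refine hgr ((K.iCycles k).hom y) _ i ?_ hy
    exact (congrArg (fun n => ((K.iCycles k).hom y, n) ∈ G) (he y)).mpr (hφ y)
  · intro n hn
    obtain ⟨x, hx, hxn⟩ := hgr' n i hn
    obtain ⟨y, rfl⟩ := exists_iCycles_eq K (h₁' x n hxn)
    exact ⟨_, ⟨y, hx, rfl⟩, (he y).trans (huniq (hφ y) hxn)⟩

end Homology

/-! ### The spectral sequence of a filtered complex of graded modules -/

/-- The map induced on subquotients. -/
def subquotMap {S M M' : Type*} [Ring S] [AddCommGroup M] [Module S M] [AddCommGroup M']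
    [Module S M'] {Z B : Submodule S M} {Z' B' : Submodule S M'} (f : M →ₗ[S] M')
    (hZ : ∀ x ∈ Z, f x ∈ Z') (hB : ∀ x ∈ Z, x ∈ B → f x ∈ B') :
    (Z ⧸ B.submoduleOf Z) →ₗ[S] (Z' ⧸ B'.submoduleOf Z') :=
  Submodule.mapQ _ _ (f.restrict hZ) fun x hx => hB x x.2 hx

/-- A first quadrant filtered complex of graded `R[t]`-modules. The complex is given by a module
`T` with a differential `D`; the submodule `F n p` of `T` is the `p`-th step of the filtration of
the term of degree `n`. -/
structure FilteredComplex (R : Type v) [CommRing R] (T : Type w) [AddCommGroup T]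
    [Module R[X] T] where
  /-- the differential -/
  D : T →ₗ[R[X]] T
  D_D (x : T) : D (D x) = 0
  /-- the filtration -/
  F : ℤ → ℤ → Submodule R[X] T
  anti (n : ℤ) {p p' : ℤ} (h : p ≤ p') : F n p' ≤ F n p
  D_mem (n p : ℤ) (x : T) (hx : x ∈ F n p) : D x ∈ F (n + 1) p
  le_of_nonpos (n p : ℤ) (x : T) (hx : x ∈ F n p) (p' : ℤ) (hp : p' ≤ 0) : x ∈ F n p'
  eq_zero (n p : ℤ) (x : T) (hx : x ∈ F n p) (h : n < p) : x = 0
  /-- the grading -/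
  gr : ℤ → AddSubgroup T
  isGrading : IsGrading (R := R) gr
  D_gr (i : ℤ) (x : T) (hx : x ∈ gr i) : D x ∈ gr i
  F_homogeneous (n p : ℤ) : IsHomogeneousSub isGrading.isInternal (F n p)

namespace FilteredComplex

variable {R : Type v} [CommRing R] {T : Type w} [AddCommGroup T] [Module R[X] T]
  (C : FilteredComplex R T)

lemma mem_of_le {n p p' : ℤ} (h : p ≤ p') {x : T} (hx : x ∈ C.F n p') : x ∈ C.F n p :=
  C.anti n h hx

lemma mem_of_le_zero {n p p' : ℤ} (hp : p' ≤ 0) {x : T} (hx : x ∈ C.F n p) :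
    x ∈ C.F n p' := C.le_of_nonpos n p x hx p' hp

/-- The elements of `F n p` with differential in filtration `m`. -/
def Z (n p m : ℤ) : Submodule R[X] T := C.F n p ⊓ (C.F (n + 1) m).comap C.D

lemma mem_Z {n p m : ℤ} {x : T} : x ∈ C.Z n p m ↔ x ∈ C.F n p ∧ C.D x ∈ C.F (n + 1) m := Iff.rfl

lemma mem_Z_of_D_eq_zero {n p m : ℤ} {x : T} (hx : x ∈ C.F n p) (h : C.D x = 0) :
    x ∈ C.Z n p m := C.mem_Z.2 ⟨hx, h ▸ zero_mem _⟩

/-- The submodule by which `Z n p (p + r)` is divided to obtain the `r`-th page. -/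
def B (r n p : ℤ) : Submodule R[X] T :=
  C.Z n (p + 1) (p + r) ⊔ (C.Z (n - 1) (p - r + 1) p).map C.D

lemma mem_B {r n p : ℤ} {x : T} : x ∈ C.B r n p ↔
    ∃ a ∈ C.Z n (p + 1) (p + r), ∃ b ∈ C.Z (n - 1) (p - r + 1) p, a + C.D b = x := by
  simp [B, Submodule.mem_sup]

lemma Z_homogeneous (n p m : ℤ) : IsHomogeneousSub C.isGrading.isInternal (C.Z n p m) :=
  (C.F_homogeneous n p).inf ((C.F_homogeneous (n + 1) m).comap C.D_gr)

lemma B_homogeneous (r n p : ℤ) : IsHomogeneousSub C.isGrading.isInternal (C.B r n p) :=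
  (C.Z_homogeneous _ _ _).sup ((C.Z_homogeneous _ _ _).map C.D_gr)

/-- The terms of the pages. -/
abbrev E (r n p : ℤ) : Type w := C.Z n p (p + r) ⧸ (C.B r n p).submoduleOf (C.Z n p (p + r))

/-- The class of an element of `Z` in a page. -/
abbrev cls (r n p : ℤ) : C.Z n p (p + r) →ₗ[R[X]] C.E r n p :=
  ((C.B r n p).submoduleOf (C.Z n p (p + r))).mkQ

lemma cls_surjective (r n p : ℤ) : Function.Surjective (C.cls r n p) := Submodule.mkQ_surjective _

lemma cls_eq_zero {r n p : ℤ} {z : C.Z n p (p + r)} : C.cls r n p z = 0 ↔ (z : T) ∈ C.B r n p := by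
  rw [cls, Submodule.mkQ_apply, Submodule.Quotient.mk_eq_zero, mem_submoduleOf_iff]

lemma cls_eq_cls {r n p : ℤ} {z z' : C.Z n p (p + r)} :
    C.cls r n p z = C.cls r n p z' ↔ (z : T) - z' ∈ C.B r n p := by
  rw [← sub_eq_zero, ← map_sub, cls_eq_zero]
  rfl

lemma D_mem_Z {r n p n' p' : ℤ} (hn : n' = n + 1) (hp : p' = p + r) {x : T}
    (hx : x ∈ C.Z n p (p + r)) : C.D x ∈ C.Z n' p' (p' + r) := by
  subst hn hp
  exact C.mem_Z_of_D_eq_zero hx.2 (C.D_D x)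

lemma D_mem_B {r n p n' p' : ℤ} (hn : n' = n + 1) (hp : p' = p + r) {x : T}
    (hx : x ∈ C.Z n (p + 1) (p + r)) : C.D x ∈ C.B r n' p' := by
  subst hn hp
  refine C.mem_B.2 ⟨0, zero_mem _, x, ?_, zero_add _⟩
  rwa [add_sub_cancel_right, add_sub_cancel_right]

/-- The differential of the `r`-th page. -/
def dE (r : ℤ) {n p n' p' : ℤ} (hn : n' = n + 1) (hp : p' = p + r) :
    C.E r n p →ₗ[R[X]] C.E r n' p' :=
  subquotMap C.D (fun _ hx => C.D_mem_Z hn hp hx) fun x _ hx => by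
    obtain ⟨a, ha, b, hb, rfl⟩ := C.mem_B.1 hx
    rw [map_add, C.D_D, add_zero]
    exact C.D_mem_B hn hp ha

/-- The shape of the `r`-th page of a first quadrant cohomological spectral sequence. -/
abbrev shape (r : ℤ) : ComplexShape (ℕ × ℕ) := ComplexShape.spectralSequenceNat (r, 1 - r)

lemma total_eq {r : ℤ} {a b : ℕ × ℕ} (h : (shape r).Rel a b) :
    (b.1 + b.2 : ℤ) = (a.1 + a.2 : ℤ) + 1 := by
  have h' : (a.1 : ℤ) + r = b.1 ∧ (a.2 : ℤ) + (1 - r) = b.2 := h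
  lia

lemma fst_eq {r : ℤ} {a b : ℕ × ℕ} (h : (shape r).Rel a b) : (b.1 : ℤ) = a.1 + r := h.1.symm

open Classical in
/-- The pages of the spectral sequence of a filtered complex. -/
def page (r : ℤ) : HomologicalComplex (ModuleCat.{w} R[X]) (shape r) where
  X a := ModuleCat.of R[X] (C.E r (a.1 + a.2) a.1)
  d a b := if h : (shape r).Rel a b then ModuleCat.ofHom (C.dE r (total_eq h) (fst_eq h)) else 0
  shape a b h := dif_neg h
  d_comp_d' a b c hab hbc := by
    rw [dif_pos hab, dif_pos hbc]
    refine ModuleCat.hom_ext (LinearMap.ext fun x => ?_)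
    obtain ⟨z, rfl⟩ := C.cls_surjective _ _ _ x
    exact C.cls_eq_zero.2 (by
      change C.D (C.D z) ∈ _
      rw [C.D_D]
      exact zero_mem _)

lemma page_d_cls {r : ℤ} {a b : ℕ × ℕ} (h : (shape r).Rel a b)
    (z : C.Z (a.1 + a.2) a.1 (a.1 + r)) :
    ((C.page r).d a b).hom (C.cls r (a.1 + a.2) a.1 z) =
      C.cls r (b.1 + b.2) b.1 ⟨C.D z, C.D_mem_Z (total_eq h) (fst_eq h) z.2⟩ := by
  have : (C.page r).d a b = ModuleCat.ofHom (C.dE r (total_eq h) (fst_eq h)) := dif_pos h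
  rw [this]
  rfl

/-- The gradings of the pages. -/
def pageGr (r : ℤ) (a : ℕ × ℕ) (i : ℤ) : AddSubgroup ((C.page r).X a) :=
  subquotGrading C.gr (C.Z (a.1 + a.2) a.1 (a.1 + r)) (C.B r (a.1 + a.2) a.1) i

lemma page_d_mem (r : ℤ) (a b : ℕ × ℕ) (i : ℤ) (x : (C.page r).X a) (hx : x ∈ C.pageGr r a i) :
    ((C.page r).d a b).hom x ∈ C.pageGr r b i := by
  by_cases h : (shape r).Rel a b
  · obtain ⟨z, hz, rfl⟩ := hx
    exact ⟨_, C.D_gr i _ hz, (C.page_d_cls h z).symm⟩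
  · rw [(C.page r).shape a b h]
    exact zero_mem _

/-- If no differential of the `r`-th page starts at `a`, the differential vanishes on `Z`. -/
lemma D_eq_zero {n p m : ℤ} (h : n + 1 < m) {x : T} (hx : x ∈ C.Z n p m) : C.D x = 0 :=
  C.eq_zero _ _ _ hx.2 h

variable {C} in
-- The target of $d_r$ leaves the first quadrant only if its row $q+1-r$ is negative. The inequality
-- is phrased for use with `D_eq_zero`.
lemma rel_iff_next {r : ℤ} {a : ℕ × ℕ} (hr : 0 ≤ r) (h : ∀ b, ¬ (shape r).Rel a b) :
    (a.1 + a.2 : ℤ) + 1 < a.1 + r := by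
  by_contra hlt
  -- If the inequality fails, both coordinates are nonnegative and `toNat` is exact.
  refine h (((a.1 : ℤ) + r).toNat, ((a.2 : ℤ) + 1 - r).toNat) ?_
  constructor
  · simp only
    lia
  · simp only
    lia

lemma rel_iff_prev {r : ℤ} {a : ℕ × ℕ} (hr : 1 ≤ r) (h : ∀ b, ¬ (shape r).Rel b a) :
    (a.1 : ℤ) < r := by
  by_contra hlt
  refine h (((a.1 : ℤ) - r).toNat, ((a.2 : ℤ) + r - 1).toNat) ?_
  constructor
  · simp only
    lia
  · simp only
    lia

/-- The relation between the cycles of the `r`-th page and the next page. -/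
def pageRel (r r' : ℤ) (h : r ≤ r') (a : ℕ × ℕ) :
    Submodule R[X] ((C.page r).X a × (C.page r').X a) :=
  LinearMap.range (LinearMap.prod
    (C.cls r (a.1 + a.2) a.1 ∘ₗ Submodule.inclusion (p := C.Z (a.1 + a.2) a.1 (a.1 + r'))
      (p' := C.Z (a.1 + a.2) a.1 (a.1 + r)) fun _ hx => ⟨hx.1, C.mem_of_le (by lia) hx.2⟩)
    (C.cls r' (a.1 + a.2) a.1))

lemma Z_le {n p m m' : ℤ} (h : m ≤ m') {x : T} (hx : x ∈ C.Z n p m') : x ∈ C.Z n p m :=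
  ⟨hx.1, C.mem_of_le h hx.2⟩

lemma mem_pageRel {r r' : ℤ} {h : r ≤ r'} {a : ℕ × ℕ} {x : (C.page r).X a}
    {y : (C.page r').X a} : (x, y) ∈ C.pageRel r r' h a ↔
      ∃ (z : T) (hz : z ∈ C.Z (a.1 + a.2) a.1 (a.1 + r')),
        C.cls r (a.1 + a.2) a.1 ⟨z, C.Z_le (by lia) hz⟩ = x ∧
          C.cls r' (a.1 + a.2) a.1 ⟨z, hz⟩ = y := by
  constructor
  · rintro ⟨⟨z, hz⟩, h⟩
    exact ⟨z, hz, congrArg Prod.fst h, congrArg Prod.snd h⟩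
  · rintro ⟨z, hz, rfl, rfl⟩
    exact ⟨⟨z, hz⟩, rfl⟩

/-- A class of $E_r$ and one of $E_{r+1}$ are related if they have a common representative in
$Z_{r+1}\subseteq Z_r$. A $d_r$-cycle has such a representative: if $Dz=u+Dt$ with $u$ one step
deeper in the filtration than required of $Dz$, then $z-t$ lies in $Z_{r+1}$ and has the class of
$z$ in $E_r$. The classes related to $0$ are the images of $d_r$, since $B_{r+1}$ allows boundaries
of elements starting exactly in column $p-r$. -/
lemma exists_page_iso (r r' : ℤ) (hr : 1 ≤ r) (hrr' : r + 1 = r') (a : ℕ × ℕ) :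
    ∃ e : (C.page r).homology a ≅ (C.page r').X a,
      ∀ i, (homologyGrading (C.page r) (C.pageGr r) a i).map e.hom.hom.toAddMonoidHom =
        C.pageGr r' a i := by
  subst hrr'
  have hle : r ≤ r + 1 := by lia
  have hfun : ∀ n, ((0 : (C.page r).X a), n) ∈ C.pageRel r (r + 1) hle a → n = 0 := by
    intro n hn
    obtain ⟨z, hz, h0, rfl⟩ := C.mem_pageRel.1 hn
    obtain ⟨u, hu, b, hb, rfl⟩ := C.mem_B.1 (C.cls_eq_zero.1 h0)
    -- Since $D(Db)=0$, the summand $u$ has the same differential as $z$, which is one step deeper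
    -- than membership in $B_r$ alone would give.
    refine C.cls_eq_zero.2 (C.mem_B.2 ⟨u, C.mem_Z.2 ⟨hu.1, ?_⟩, b,
      ⟨C.mem_of_le (by lia) hb.1, hb.2⟩, rfl⟩)
    have := (C.mem_Z.1 hz).2
    rwa [map_add, C.D_D, add_zero] at this
  refine exists_homology_iso_of_rel (C.page r) (C.pageRel r (r + 1) hle a) (C.pageGr r)
    (C.pageGr (r + 1) a) ?_ ?_ ?_ ?_ hfun ?_ ?_
  · intro x hx
    obtain ⟨⟨z, hz⟩, rfl⟩ := C.cls_surjective _ _ _ x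
    by_cases hnext : ∃ b, (shape r).Rel a b
    · obtain ⟨b, hb⟩ := hnext
      have h0 := hx b
      rw [C.page_d_cls hb] at h0
      obtain ⟨u, hu, t, ht, hut⟩ := C.mem_B.1 (C.cls_eq_zero.1 h0)
      have e₁ : (b.1 + b.2 : ℤ) = (a.1 + a.2 : ℤ) + 1 := total_eq hb
      have e₂ := fst_eq hb
      have ht' : t ∈ C.Z (a.1 + a.2) (a.1 + 1) (a.1 + r) := by
        have := ht
        rwa [e₁, e₂, add_sub_cancel_right, add_sub_cancel_right] at this
      have hzt : z - t ∈ C.Z (a.1 + a.2) a.1 (a.1 + (r + 1)) := by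
        refine C.mem_Z.2 ⟨sub_mem hz.1 (C.mem_of_le (by lia) ht'.1), ?_⟩
        have hut' : C.D z = u + C.D t := hut.symm
        rw [map_sub, hut', add_sub_cancel_right]
        have := hu.1
        rwa [e₁, e₂, add_assoc (a.1 : ℤ) r] at this
      refine ⟨_, C.mem_pageRel.2 ⟨z - t, hzt, ?_, rfl⟩⟩
      refine C.cls_eq_cls.2 ?_
      rw [sub_sub_cancel_left]
      exact neg_mem (C.mem_B.2 ⟨t, ht', 0, zero_mem _, by rw [map_zero, add_zero]⟩)
    · push Not at hnext
      have hD := C.D_eq_zero (rel_iff_next (by lia) hnext) hz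
      have hz' : z ∈ C.Z (a.1 + a.2) a.1 (a.1 + (r + 1)) :=
        C.mem_Z_of_D_eq_zero hz.1 hD
      exact ⟨_, C.mem_pageRel.2 ⟨z, hz', rfl, rfl⟩⟩
  · intro x n hxn b
    obtain ⟨z, hz, rfl, -⟩ := C.mem_pageRel.1 hxn
    by_cases hb : (shape r).Rel a b
    · rw [C.page_d_cls hb]
      refine C.cls_eq_zero.2 (C.mem_B.2 ⟨C.D z, C.mem_Z_of_D_eq_zero ?_ (C.D_D z), 0,
        zero_mem _, by rw [map_zero, add_zero]⟩)
      have := (C.mem_Z.1 hz).2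
      rwa [← add_assoc, ← total_eq hb, ← fst_eq hb] at this
    · rw [(C.page r).shape a b hb]
      rfl
  · intro n
    obtain ⟨⟨z, hz⟩, rfl⟩ := C.cls_surjective _ _ _ n
    exact ⟨_, C.mem_pageRel.2 ⟨z, hz, rfl, rfl⟩⟩
  · intro x
    constructor
    · intro hx
      obtain ⟨z, hz, rfl, h0⟩ := C.mem_pageRel.1 hx
      obtain ⟨u, hu, b, hb, hub⟩ := C.mem_B.1 (C.cls_eq_zero.1 h0)
      simp only at hub
      by_cases hprev : ∃ j, (shape r).Rel j a
      · obtain ⟨j, hj⟩ := hprev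
        have e₁ : (a.1 + a.2 : ℤ) = (j.1 + j.2 : ℤ) + 1 := total_eq hj
        have e₂ := fst_eq hj
        have hb' : b ∈ C.Z (j.1 + j.2) j.1 (j.1 + r) := by
          have := hb
          rwa [e₁, e₂, add_sub_cancel_right,
            (by ring : (j.1 + r - (r + 1) + 1 : ℤ) = j.1)] at this
        refine ⟨j, C.cls r _ _ ⟨b, hb'⟩, ?_⟩
        rw [C.page_d_cls hj]
        refine C.cls_eq_cls.2 (C.mem_B.2 ⟨-u, ?_, 0, zero_mem _, ?_⟩)
        · exact neg_mem (C.Z_le (by lia) hu)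
        · simp only [← hub, map_zero]
          abel
      -- No differential arrives at this position, that is, $p<r$. Then the column $p-r+1$ is
      -- already nonpositive, where the filtration is constant, so the boundary was in $B_r$ from
      -- the start.
      · push Not at hprev
        have hlt := rel_iff_prev hr hprev
        refine ⟨a, 0, ?_⟩
        rw [map_zero]
        refine (C.cls_eq_zero.2 (C.mem_B.2 ⟨u, C.Z_le (by lia) hu, b, ⟨?_, hb.2⟩, hub⟩)).symm
        exact C.mem_of_le_zero (by lia) hb.1
    · rintro ⟨j, y, rfl⟩
      by_cases hj : (shape r).Rel j a
      · obtain ⟨⟨b, hb⟩, rfl⟩ := C.cls_surjective _ _ _ y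
        rw [C.page_d_cls hj]
        have e₁ : (a.1 + a.2 : ℤ) = (j.1 + j.2 : ℤ) + 1 := total_eq hj
        have e₂ := fst_eq hj
        have hDb : C.D b ∈ C.Z (a.1 + a.2) a.1 (a.1 + (r + 1)) :=
          C.mem_Z_of_D_eq_zero (C.D_mem_Z e₁ e₂ hb).1 (C.D_D b)
        refine C.mem_pageRel.2 ⟨C.D b, hDb, rfl, C.cls_eq_zero.2
          (C.mem_B.2 ⟨0, zero_mem _, b, ?_, zero_add _⟩)⟩
        rw [e₁, e₂, add_sub_cancel_right, (by ring : (j.1 + r - (r + 1) + 1 : ℤ) = j.1)]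
        exact hb
      · rw [(C.page r).shape j a hj]
        exact zero_mem _
  -- The representative `z` need not be homogeneous. It differs by an element of $B_r$ from a
  -- representative of degree $i$, and $B_r$ is homogeneous, so `z` and its degree $i$ component
  -- agree in $E_r$, hence by `hfun` also in $E_{r+1}$.
  · intro x n i hxn hx
    obtain ⟨z, hz, rfl, rfl⟩ := C.mem_pageRel.1 hxn
    obtain ⟨⟨t, ht⟩, hti, htz⟩ := hx
    have hti' : t ∈ C.gr i := hti
    have hB := C.cls_eq_cls.1 htz
    have h' := C.B_homogeneous _ _ _ i _ hB
    simp only [map_sub] at h'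
    rw [gproj_of_mem C.isGrading.isInternal hti'] at h'
    have hz' := C.Z_homogeneous _ _ _ i _ hz
    have : C.cls (r + 1) (a.1 + a.2) a.1 ⟨z, hz⟩ = C.cls (r + 1) (a.1 + a.2) a.1 ⟨_, hz'⟩ := by
      rw [← sub_eq_zero]
      refine hfun _ ?_
      refine C.mem_pageRel.2 ⟨z - gproj C.isGrading.isInternal i z, sub_mem hz hz', ?_, rfl⟩
      refine C.cls_eq_zero.2 ?_
      have := sub_mem h' hB
      simpa using this
    rw [this]
    exact ⟨_, gproj_mem C.isGrading.isInternal i z, rfl⟩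
  · rintro _ i ⟨⟨z, hz⟩, hzi, rfl⟩
    exact ⟨_, ⟨⟨z, C.Z_le (by lia) hz⟩, hzi, rfl⟩, C.mem_pageRel.2 ⟨z, hz, rfl, rfl⟩⟩

/-- The spectral sequence of a filtered complex of graded modules. -/
def spectralSequence : GradedSpectralSequence.{v, w} R where
  E :=
    { page := fun r _ => C.page r
      iso := fun r r' a hrr' hr =>
        (C.exists_page_iso r r' (by lia) hrr' a).choose }
  gr r _ a i := C.pageGr r a i
  isGrading r _ a := isGrading_subquotGrading C.isGrading (C.Z_homogeneous _ _ _)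
    (C.B_homogeneous _ _ _)
  d_mem r _ a b i x hx := C.page_d_mem r a b i x hx
  iso_map r hr a i := (C.exists_page_iso r (r + 1) (by lia) rfl a).choose_spec i

/-- The cocycles of degree `n`. -/
abbrev cocycles (n : ℤ) : Submodule R[X] T := C.F n 0 ⊓ LinearMap.ker C.D

/-! ### Convergence of the spectral sequence of a filtered complex -/

section Convergence

variable {A : ℕ → Type*} [∀ n, AddCommGroup (A n)] [∀ n, Module R[X] (A n)]
  {grA : ∀ n, ℤ → AddSubgroup (A n)} (θ : ∀ n : ℕ, C.cocycles n →ₗ[R[X]] A n)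

/-- The filtration induced on the cohomology. -/
def cohomologyFiltration (n p : ℕ) : Submodule R[X] (A n) :=
  ((C.F n p).comap (C.cocycles n).subtype).map (θ n)

lemma mem_cohomologyFiltration {n p : ℕ} {x : A n} : x ∈ C.cohomologyFiltration θ n p ↔
    ∃ z : C.cocycles n, (z : T) ∈ C.F n p ∧ θ n z = x := Iff.rfl

/-- The components of a cocycle are cocycles because $D$ has degree $0$, and they stay in the same
step of the filtration. As `θ` is defined only on cocycles, the decomposition has to be made inside
them. -/
lemma cohomologyFiltration_homogeneous (hA : ∀ n, DirectSum.IsInternal (grA n))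
    (hgr : ∀ (n : ℕ) (i : ℤ) (z : C.cocycles n), (z : T) ∈ C.gr i → θ n z ∈ grA n i) (n p : ℕ) :
    IsHomogeneousSub (hA n) (C.cohomologyFiltration θ n p) := by
  rintro i _ ⟨z, hz, rfl⟩
  have h := C.isGrading.isInternal
  have hker : IsHomogeneousSub h (LinearMap.ker C.D) := by
    intro i x hx
    rw [LinearMap.mem_ker]
    refine (gproj_comm h h C.D.toAddMonoidHom C.D_gr i x).trans ?_
    exact (congrArg _ (LinearMap.mem_ker.1 hx)).trans (map_zero _)
  have hc := (C.F_homogeneous n 0).inf hker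
  obtain ⟨s, hs⟩ := exists_eq_sum_gproj h (z : T)
  let g : ℤ → C.cocycles n := fun j => ⟨gproj h j z, hc j _ z.2⟩
  have hz' : z = ∑ j ∈ s, g j := Subtype.ext (by
    rw [AddSubmonoidClass.coe_finsetSum]
    exact hs)
  have hg (j) : θ n (g j) ∈ grA n j := hgr n j _ (gproj_mem h j z)
  by_cases hi : i ∈ s
  · have e : gproj (hA n) i (θ n z) = θ n (g i) := by
      conv_lhs => rw [hz', map_sum]
      exact gproj_sum (hA n) hg hi
    rw [e]
    exact ⟨g i, C.F_homogeneous n p i _ hz, rfl⟩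
  · rw [hz', map_sum, map_sum, Finset.sum_eq_zero fun j hj =>
      gproj_of_mem_of_ne (hA n) (i := i) (j := j) (fun hij => hi (hij ▸ hj)) (hg j)]
    exact zero_mem _

/-- The spectral sequence of a filtered complex converges to its cohomology. -/
theorem convergesTo (hA : ∀ n, DirectSum.IsInternal (grA n))
    (hgr : ∀ (n : ℕ) (i : ℤ) (z : C.cocycles n), (z : T) ∈ C.gr i → θ n z ∈ grA n i)
    (hsurj : ∀ n, Function.Surjective (θ n))
    (hker : ∀ (n : ℕ) (z : C.cocycles n), θ n z = 0 ↔ ∃ b ∈ C.F (n - 1) 0, C.D b = z) :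
    C.spectralSequence.ConvergesTo A grA := by
  refine ⟨C.cohomologyFiltration θ, ?_, ?_, ?_, ?_, ?_⟩
  · rintro n p p' hp _ ⟨z, hz, rfl⟩
    exact ⟨z, C.mem_of_le (by exact_mod_cast hp) hz, rfl⟩
  · intro n
    refine eq_top_iff.2 fun x _ => ?_
    obtain ⟨z, rfl⟩ := hsurj n x
    exact ⟨z, z.2.1, rfl⟩
  · intro n
    refine eq_bot_iff.2 ?_
    rintro _ ⟨z, hz, rfl⟩
    have : z = 0 := Subtype.ext (C.eq_zero _ _ _ hz (by push_cast; lia))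
    rw [this, map_zero]
    exact zero_mem _
  · exact fun n p => (C.cohomologyFiltration_homogeneous θ hA hgr n p).toAddSubgroup_eq
  · intro p q r hr hp hq
    have hn : ((p + q : ℕ) : ℤ) = p + q := by push_cast; rfl
    -- As $r>q+1$, the differential of `z` lies in a filtration step beyond its total degree, so it
    -- vanishes.
    have hZ {z : T} (hz : z ∈ C.Z (p + q) p (p + r)) : z ∈ C.cocycles (p + q : ℕ) := by
      rw [hn]
      exact ⟨C.mem_of_le (by lia) hz.1, C.D_eq_zero (by lia) hz⟩
    have hZF {z : T} (hz : z ∈ C.Z (p + q) p (p + r)) : z ∈ C.F (p + q : ℕ) p := by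
      rw [hn]
      exact hz.1
    let Fp := C.cohomologyFiltration θ (p + q) p
    let Fp' := C.cohomologyFiltration θ (p + q) (p + 1)
    let ψ₀ : C.Z (p + q) p (p + r) →ₗ[R[X]] Fp :=
      LinearMap.codRestrict Fp (θ (p + q) ∘ₗ Submodule.inclusion fun _ hz => hZ hz)
        fun z => ⟨⟨z, hZ z.2⟩, hZF z.2, rfl⟩
    let ψ : C.Z (p + q) p (p + r) →ₗ[R[X]] (Fp ⧸ Fp'.submoduleOf Fp) :=
      (Fp'.submoduleOf Fp).mkQ ∘ₗ ψ₀
    have hψ : Function.Surjective ψ := by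
      intro y
      obtain ⟨⟨_, ⟨z, hz, rfl⟩⟩, rfl⟩ := Submodule.mkQ_surjective _ y
      have hz' : (z : T) ∈ C.Z (p + q) p (p + r) :=
        C.mem_Z_of_D_eq_zero (by rw [← hn]; exact hz) z.2.2
      exact ⟨⟨z, hz'⟩, rfl⟩
    -- Because $r>p$, the boundary part of $B_r$ consists of all boundaries lying in $F^p$. Its
    -- other part consists of the cocycles in $F^{p+1}$. So $B_r$ is what maps to $F^{p+1}$ of the
    -- cohomology.
    have hkerψ : (C.B r (p + q) p).submoduleOf (C.Z (p + q) p (p + r)) = LinearMap.ker ψ := by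
      ext z
      rw [LinearMap.mem_ker, LinearMap.comp_apply, Submodule.mkQ_apply,
        Submodule.Quotient.mk_eq_zero, mem_submoduleOf_iff, mem_submoduleOf_iff]
      constructor
      · intro h
        obtain ⟨a, ha, b, hb, hab⟩ := C.mem_B.1 h
        have hDz := C.D_eq_zero (by lia) z.2
        have hDa : C.D a = 0 := by
          rw [← hab, map_add, C.D_D, add_zero] at hDz
          exact hDz
        have ha' : a ∈ C.cocycles (p + q : ℕ) := by
          rw [hn]
          exact ⟨C.mem_of_le (by lia) ha.1, hDa⟩
        have haF : a ∈ C.F (p + q : ℕ) (p + 1 : ℕ) := by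
          rw [hn]
          exact_mod_cast ha.1
        refine C.mem_cohomologyFiltration θ |>.2 ⟨⟨a, ha'⟩, haF, ?_⟩
        refine (sub_eq_zero.1 ?_).symm
        change θ (p + q) ⟨z, hZ z.2⟩ - _ = 0
        rw [← map_sub, hker]
        refine ⟨b, ?_, ?_⟩
        · rw [hn]
          exact C.mem_of_le_zero le_rfl hb.1
        · change _ = (z : T) - a
          rw [← hab, add_sub_cancel_left]
      · intro h
        obtain ⟨a, ha, haz⟩ := (C.mem_cohomologyFiltration θ).1 h
        have h0 : θ (p + q) (⟨z, hZ z.2⟩ - a) = 0 := by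
          rw [map_sub, haz]
          exact sub_self _
        obtain ⟨b, hb, hDb⟩ := (hker _ _).1 h0
        have hDb' : C.D b = z - a := hDb
        refine C.mem_B.2 ⟨a, C.mem_Z_of_D_eq_zero ?_ a.2.2, b, C.mem_Z.2 ⟨?_, ?_⟩, ?_⟩
        · rw [← hn]
          exact_mod_cast ha
        · rw [← hn]
          exact C.mem_of_le_zero (by lia) hb
        · rw [hDb', sub_add_cancel]
          refine sub_mem z.2.1 (C.mem_of_le (p' := p + 1) (by lia) ?_)
          rw [← hn]
          exact_mod_cast ha
        · rw [hDb', add_sub_cancel]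
    let e : C.E r (p + q) p ≃ₗ[R[X]] (Fp ⧸ Fp'.submoduleOf Fp) :=
      (Submodule.quotEquivOfEq _ _ hkerψ).trans (ψ.quotKerEquivOfSurjective hψ)
    refine ⟨e, fun i => ?_⟩
    refine map_gr_eq (isGrading_subquotGrading C.isGrading (C.Z_homogeneous _ _ _)
      (C.B_homogeneous _ _ _)).isInternal (isInternal_subquotGrading
        (C.cohomologyFiltration_homogeneous θ hA hgr (p + q) p)
        (C.cohomologyFiltration_homogeneous θ hA hgr (p + q) (p + 1))) e.toLinearMap.toAddMonoidHom
          ?_ e.bijective i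
    rintro i _ ⟨z, hz, rfl⟩
    exact ⟨ψ₀ z, hgr _ i ⟨z, hZ z.2⟩ hz, rfl⟩

end Convergence

end FilteredComplex

/-! ### Double complexes of graded modules -/

/-- A first quadrant double complex of graded `R[t]`-modules with commuting differentials. -/
structure DoubleComplex (R : Type v) [CommRing R] (A : ℕ → ℕ → Type w)
    [∀ p q, AddCommGroup (A p q)] [∀ p q, Module R[X] (A p q)] where
  /-- the horizontal differential -/
  dh (p q : ℕ) : A p q →ₗ[R[X]] A (p + 1) q
  /-- the vertical differential -/
  dv (p q : ℕ) : A p q →ₗ[R[X]] A p (q + 1)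
  dh_dh (p q : ℕ) (x : A p q) : dh (p + 1) q (dh p q x) = 0
  dv_dv (p q : ℕ) (x : A p q) : dv p (q + 1) (dv p q x) = 0
  dh_dv (p q : ℕ) (x : A p q) : dh p (q + 1) (dv p q x) = dv (p + 1) q (dh p q x)
  /-- the gradings -/
  gr (p q : ℕ) : ℤ → AddSubgroup (A p q)
  isGrading (p q : ℕ) : IsGrading (R := R) (gr p q)
  dh_gr (p q : ℕ) (i : ℤ) (x : A p q) (hx : x ∈ gr p q i) : dh p q x ∈ gr (p + 1) q i
  dv_gr (p q : ℕ) (i : ℤ) (x : A p q) (hx : x ∈ gr p q i) : dv p q x ∈ gr p (q + 1) i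

namespace DoubleComplex

variable {R : Type v} [CommRing R] {A : ℕ → ℕ → Type w}
    [∀ p q, AddCommGroup (A p q)] [∀ p q, Module R[X] (A p q)] (C : DoubleComplex R A)

variable (A) in
/-- The direct sum of all terms of a double complex. -/
abbrev Total : Type w := ⨁ a : ℕ × ℕ, A a.1 a.2

variable (R A) in
/-- The inclusion of a term into the direct sum. -/
abbrev inj (p q : ℕ) : A p q →ₗ[R[X]] Total A :=
  DirectSum.lof R[X] (ℕ × ℕ) (fun a => A a.1 a.2) (p, q)

lemma inj_same (p q : ℕ) (x : A p q) : inj R A p q x (p, q) = x :=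
  DirectSum.of_eq_same (β := fun a : ℕ × ℕ => A a.1 a.2) (p, q) x

lemma inj_ne {p q p' q' : ℕ} (h : p' ≠ p ∨ q' ≠ q) (x : A p q) : inj R A p q x (p', q') = 0 :=
  DirectSum.of_eq_of_ne (β := fun a : ℕ × ℕ => A a.1 a.2) (p, q) (p', q') x
    (fun h' => by simp only [Prod.mk.injEq] at h'; lia)

/-- The total differential. -/
def D : Total A →ₗ[R[X]] Total A :=
  DirectSum.toModule R[X] (ℕ × ℕ) _ fun a =>
    inj R A (a.1 + 1) a.2 ∘ₗ C.dh a.1 a.2 + (-1 : ℤ) ^ a.1 • inj R A a.1 (a.2 + 1) ∘ₗ C.dv a.1 a.2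

lemma D_inj (p q : ℕ) (x : A p q) : C.D (inj R A p q x) =
    inj R A (p + 1) q (C.dh p q x) + (-1 : ℤ) ^ p • inj R A p (q + 1) (C.dv p q x) := by
  simp [D, inj]

lemma D_D (x : Total A) : C.D (C.D x) = 0 := by
  refine LinearMap.congr_fun (f := C.D ∘ₗ C.D) (g := 0)
    (DirectSum.linearMap_ext _ fun ⟨p, q⟩ => LinearMap.ext fun x => ?_) x
  change C.D (C.D (inj R A p q x)) = 0
  rw [D_inj, map_add, map_zsmul, D_inj, D_inj, C.dh_dh, C.dv_dv, C.dh_dv, map_zero, map_zero,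
    zero_add, smul_zero, add_zero, pow_succ, mul_neg_one, neg_smul, neg_add_cancel]

/-- The horizontal part of the total differential. -/
def hPart (x : Total A) : ∀ p q, A p q
  | 0, _ => 0
  | p + 1, q => C.dh p q (x (p, q))

/-- The vertical part of the total differential, without sign. -/
def vPart (x : Total A) : ∀ p q, A p q
  | _, 0 => 0
  | p, q + 1 => C.dv p q (x (p, q))

/-- Each coordinate of $Dx$ receives one horizontal and one vertical contribution; defining these by
cases makes the arrows missing in column or row $0$ contribute zero. -/
lemma D_apply (x : Total A) (p q : ℕ) :
    C.D x (p, q) = C.hPart x p q + (-1 : ℤ) ^ p • C.vPart x p q := by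
  induction x using DirectSum.induction_on with
  | zero => cases p <;> cases q <;> simp [hPart, vPart]
  | add x y hx hy =>
    rw [map_add, DirectSum.add_apply, hx, hy]
    cases p <;> cases q <;> simp only [hPart, vPart, DirectSum.add_apply, map_add, smul_add,
      add_zero, zero_add, smul_zero]
    abel
  | of a x =>
    obtain ⟨p', q'⟩ := a
    change C.D (inj R A p' q' x) (p, q) = C.hPart (inj R A p' q' x) p q +
      (-1 : ℤ) ^ p • C.vPart (inj R A p' q' x) p q
    rw [D_inj, DirectSum.add_apply]
    congr 1
    · cases p with
      | zero => exact inj_ne (by lia) _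
      | succ p =>
        by_cases h : p = p' ∧ q = q'
        · obtain ⟨rfl, rfl⟩ := h
          rw [inj_same, hPart, inj_same]
        · rw [inj_ne (by lia), hPart, inj_ne (by lia), map_zero]
    · have hz : ((-1 : ℤ) ^ p' • inj R A p' (q' + 1) (C.dv p' q' x)) (p, q) =
          (-1 : ℤ) ^ p' • inj R A p' (q' + 1) (C.dv p' q' x) (p, q) :=
        map_zsmul (DFinsupp.evalAddMonoidHom (β := fun a : ℕ × ℕ => A a.1 a.2) (p, q)) _ _
      rw [hz]
      cases q with
      | zero => rw [inj_ne (by lia), vPart, smul_zero, smul_zero]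
      | succ q =>
        by_cases h : p = p' ∧ q = q'
        · obtain ⟨rfl, rfl⟩ := h
          rw [inj_same, vPart, inj_same]
        · rw [inj_ne (by lia), vPart, inj_ne (by lia), map_zero, smul_zero, smul_zero]

/-- The filtration of the total complex by columns. -/
def F (R : Type v) [CommRing R] (A : ℕ → ℕ → Type w) [∀ p q, AddCommGroup (A p q)]
    [∀ p q, Module R[X] (A p q)] (n m : ℤ) : Submodule R[X] (Total A) where
  carrier := {x | ∀ p q : ℕ, (p + q : ℤ) ≠ n ∨ p < m → x (p, q) = 0}
  zero_mem' _ _ _ := rfl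
  add_mem' hx hy p q h := by rw [DirectSum.add_apply, hx p q h, hy p q h, add_zero]
  smul_mem' a x hx p q h := by rw [DirectSum.smul_apply, hx p q h, smul_zero]

lemma inj_mem_F {p q : ℕ} {n m : ℤ} (hn : (p + q : ℤ) = n) (hm : m ≤ p) (x : A p q) :
    inj R A p q x ∈ F R A n m :=
  fun _ _ h => inj_ne (by lia) x

/-- The grading of the total complex. -/
def totalGr (i : ℤ) : AddSubgroup (Total A) where
  carrier := {x | ∀ p q : ℕ, x (p, q) ∈ C.gr p q i}
  zero_mem' _ _ := zero_mem _
  add_mem' hx hy p q := by rw [DirectSum.add_apply]; exact add_mem (hx p q) (hy p q)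
  neg_mem' {x} hx p q := by
    have : (-x) (p, q) = -x (p, q) := rfl
    rw [this]
    exact neg_mem (hx p q)

lemma inj_mem_totalGr {p q : ℕ} {i : ℤ} {x : A p q} (hx : x ∈ C.gr p q i) :
    inj R A p q x ∈ C.totalGr i := by
  intro p' q'
  by_cases h : p' = p ∧ q' = q
  · obtain ⟨rfl, rfl⟩ := h
    rwa [inj_same]
  · rw [inj_ne (by lia)]
    exact zero_mem _

lemma isInternal_totalGr : DirectSum.IsInternal C.totalGr := by
  classical
  refine isInternal_of_sum (fun x => ?_) fun s g hg hsum i hi => ?_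
  · choose s hs using fun a : ℕ × ℕ =>
      exists_forall_eq_sum_gproj (C.isGrading a.1 a.2).isInternal (x a)
    -- Only finitely many coordinates are nonzero, and each has finitely many degrees.
    refine ⟨(DFinsupp.support x).biUnion s, fun i => DFinsupp.mapRange
      (fun a => gproj (C.isGrading a.1 a.2).isInternal i) (fun a => map_zero _) x,
      fun i p q => ?_, ?_⟩
    · exact gproj_mem (C.isGrading p q).isInternal i _
    · refine DFinsupp.ext fun a => ?_
      have e : (∑ i ∈ (DFinsupp.support x).biUnion s, DFinsupp.mapRange
          (fun a => gproj (C.isGrading a.1 a.2).isInternal i) (fun a => map_zero _) x) a =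
          ∑ i ∈ (DFinsupp.support x).biUnion s, gproj (C.isGrading a.1 a.2).isInternal i (x a) := by
        rw [DFinsupp.finsetSum_apply]
        rfl
      refine Eq.trans ?_ e.symm
      by_cases ha : a ∈ DFinsupp.support x
      · exact hs a _ (Finset.subset_biUnion_of_mem s ha)
      · have : x a = 0 := DFinsupp.notMem_support_iff.1 ha
        simp [this]
  · refine DFinsupp.ext fun a => ?_
    have h := (C.isGrading a.1 a.2).isInternal
    have e : ∑ i ∈ s, g i a = 0 := by
      have := congrArg (fun y : Total A => y a) hsum
      rw [← DFinsupp.finsetSum_apply]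
      exact this
    have := gproj_sum h (g := fun i => g i a) (fun i => hg i a.1 a.2) hi
    rw [e, map_zero] at this
    exact this.symm

lemma gproj_total_apply (i : ℤ) (x : Total A) (p q : ℕ) :
    gproj C.isInternal_totalGr i x (p, q) = gproj (C.isGrading p q).isInternal i (x (p, q)) :=
  gproj_comm C.isInternal_totalGr (C.isGrading p q).isInternal
    (DFinsupp.evalAddMonoidHom (β := fun a : ℕ × ℕ => A a.1 a.2) (p, q)) (fun _ _ hx => hx p q) i x

lemma isGrading_totalGr : IsGrading (R := R) C.totalGr where
  isInternal := C.isInternal_totalGr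
  C_smul_mem a i x hx p q := by
    rw [DirectSum.smul_apply]
    exact (C.isGrading p q).C_smul_mem a i _ (hx p q)
  X_smul_mem i x hx p q := by
    rw [DirectSum.smul_apply]
    exact (C.isGrading p q).X_smul_mem i _ (hx p q)

lemma D_mem_totalGr (i : ℤ) (x : Total A) (hx : x ∈ C.totalGr i) : C.D x ∈ C.totalGr i := by
  intro p q
  rw [D_apply]
  refine add_mem ?_ (zsmul_mem ?_ _)
  · cases p with
    | zero => exact zero_mem _
    | succ p => exact C.dh_gr p q i _ (hx p q)
  · cases q with
    | zero => exact zero_mem _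
    | succ q => exact C.dv_gr p q i _ (hx p q)

/-- The total complex, filtered by columns. -/
def filtered : FilteredComplex R (Total A) where
  D := C.D
  D_D := C.D_D
  F := F R A
  anti n p p' h x hx a b hab := hx a b (by lia)
  D_mem n m x hx p q h := by
    rw [D_apply]
    have h₁ : C.hPart x p q = 0 := by
      cases p with
      | zero => rfl
      | succ p => rw [hPart, hx p q (by lia), map_zero]
    have h₂ : C.vPart x p q = 0 := by
      cases q with
      | zero => rfl
      | succ q => rw [vPart, hx p q (by lia), map_zero]
    rw [h₁, h₂, smul_zero, add_zero]
  le_of_nonpos n p x hx p' hp := by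
    intro a b hab
    by_cases h : (a : ℤ) < p
    · exact hx a b (Or.inr h)
    · exact hx a b (by lia)
  eq_zero n p x hx h := DFinsupp.ext fun a => hx a.1 a.2 (by lia)
  gr := C.totalGr
  isGrading := C.isGrading_totalGr
  D_gr := C.D_mem_totalGr
  F_homogeneous n m i x hx p q h := by
    rw [gproj_total_apply, hx p q h, map_zero]

end DoubleComplex

/-! ### Cohomology presented by a relation between cochains and classes -/

/-- The relation `ρ` between cochains `z : Q` and elements `c : H` exhibits `H` as the module of
classes of cocycles (the kernel of `d`) modulo the submodule `Bd`, compatibly with the gradings. -/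
structure IsCohomologyRel {S Q Q' H : Type*} [Ring S] [AddCommGroup Q] [Module S Q]
    [AddCommGroup Q'] [Module S Q'] [AddCommGroup H] [Module S H] (d : Q →ₗ[S] Q')
    (Bd : Submodule S Q) (grQ : ℤ → AddSubgroup Q) (grH : ℤ → AddSubgroup H)
    (ρ : Submodule S (Q × H)) : Prop where
  exists_class {z : Q} : d z = 0 → ∃ c, (z, c) ∈ ρ
  exists_rep (c : H) : ∃ z, (z, c) ∈ ρ
  d_eq_zero {z : Q} {c : H} : (z, c) ∈ ρ → d z = 0
  zero_iff {z : Q} : (z, 0) ∈ ρ ↔ z ∈ Bd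
  eq_zero {c : H} : (0, c) ∈ ρ → c = 0
  gr_class {z : Q} {c : H} {i : ℤ} : (z, c) ∈ ρ → z ∈ grQ i → c ∈ grH i
  gr_rep {c : H} {i : ℤ} : c ∈ grH i → ∃ z ∈ grQ i, (z, c) ∈ ρ

namespace IsCohomologyRel

variable {S Q Q' H : Type*} [Ring S] [AddCommGroup Q] [Module S Q]
    [AddCommGroup Q'] [Module S Q'] [AddCommGroup H] [Module S H] {d : Q →ₗ[S] Q'}
    {Bd : Submodule S Q} {grQ : ℤ → AddSubgroup Q} {grH : ℤ → AddSubgroup H}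
    {ρ : Submodule S (Q × H)}

lemma unique (hρ : IsCohomologyRel d Bd grQ grH ρ) {z : Q} {c c' : H} (h : (z, c) ∈ ρ)
    (h' : (z, c') ∈ ρ) : c = c' := by
  refine sub_eq_zero.1 (hρ.eq_zero ?_)
  simpa using sub_mem h h'

end IsCohomologyRel

/-! ### The second page of a double complex: cohomology of the columns, then of the rows -/

namespace DoubleComplex

variable {R : Type v} [CommRing R] {A : ℕ → ℕ → Type w}
    [∀ p q, AddCommGroup (A p q)] [∀ p q, Module R[X] (A p q)] (C : DoubleComplex R A)

/-- The image of the vertical differential. -/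
def vBoundaries (p : ℕ) : ∀ q, Submodule R[X] (A p q)
  | 0 => ⊥
  | q + 1 => LinearMap.range (C.dv p q)

lemma vBoundaries_homogeneous (p q : ℕ) :
    IsHomogeneousSub (C.isGrading p q).isInternal (C.vBoundaries p q) := by
  cases q with
  | zero =>
    rintro i x hx
    rw [(Submodule.mem_bot R[X]).1 hx, map_zero]
    exact zero_mem _
  | succ q =>
    rintro i _ ⟨x, rfl⟩
    exact ⟨_, gproj_comm (C.isGrading p q).isInternal (C.isGrading p (q + 1)).isInternal
      (C.dv p q).toAddMonoidHom (C.dv_gr p q) i x⟩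

/-- A vertical boundary is the leading term of a boundary of the total complex. -/
lemma exists_D_eq_of_mem_vBoundaries {p q : ℕ} {x : A p q} (hx : x ∈ C.vBoundaries p q) :
    ∃ b ∈ F R A (p + q - 1) p, C.D b (p, q) = x := by
  cases q with
  | zero =>
    refine ⟨0, zero_mem _, ?_⟩
    rw [(Submodule.mem_bot R[X]).1 hx, map_zero]
    rfl
  | succ q =>
    obtain ⟨t, rfl⟩ := hx
    -- The sign cancels the one that the total differential puts on the vertical part.
    refine ⟨(-1 : ℤ) ^ p • inj R A p q t, zsmul_mem (inj_mem_F (by push_cast; ring) le_rfl t) _, ?_⟩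
    rw [map_zsmul, D_inj]
    have hz (n : ℤ) (y : Total A) : (n • y) (p, q + 1) = n • y (p, q + 1) :=
      map_zsmul (DFinsupp.evalAddMonoidHom (β := fun a : ℕ × ℕ => A a.1 a.2) (p, q + 1)) _ _
    rw [hz, DirectSum.add_apply, inj_ne (by lia), zero_add, hz, inj_same, smul_smul,
      ← pow_add, Even.neg_one_pow ⟨p, rfl⟩, one_smul]

lemma vPart_mem_vBoundaries (x : Total A) (p q : ℕ) : C.vPart x p q ∈ C.vBoundaries p q := by
  cases q with
  | zero => exact zero_mem _
  | succ q => exact ⟨_, rfl⟩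

section SecondPage

variable {q : ℕ} (K : CochainComplex (ModuleCat.{w} R[X]) ℕ)
  (grK : ∀ p, ℤ → AddSubgroup (K.X p)) (ρ : ∀ p, Submodule R[X] (A p q × K.X p))

/-- The relation between the cohomology of the rows of the first page and the second page. -/
def secondPageRel (p : ℕ) : Submodule R[X] (K.X p × (C.filtered.page 2).X (p, q)) where
  carrier := {x | ∃ (z : Total A) (hz : z ∈ C.filtered.Z (p + q) p (p + 2)),
    C.filtered.cls 2 (p + q) p ⟨z, hz⟩ = x.2 ∧ (z (p, q), x.1) ∈ ρ p}
  zero_mem' := ⟨0, zero_mem _, map_zero _, zero_mem _⟩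
  add_mem' := by
    rintro x x' ⟨z, hz, h₁, h₂⟩ ⟨z', hz', h₁', h₂'⟩
    exact ⟨z + z', add_mem hz hz', (map_add (C.filtered.cls 2 (p + q) p) ⟨z, hz⟩ ⟨z', hz'⟩).trans
      (congrArg₂ _ h₁ h₁'), add_mem h₂ h₂'⟩
  smul_mem' := by
    rintro a x ⟨z, hz, h₁, h₂⟩
    exact ⟨a • z, Submodule.smul_mem _ a hz, (map_smul (C.filtered.cls 2 (p + q) p) a ⟨z, hz⟩).trans
      (congrArg _ h₁), Submodule.smul_mem _ a h₂⟩

lemma mem_secondPageRel {p : ℕ} {c : K.X p} {n : (C.filtered.page 2).X (p, q)} :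
    (c, n) ∈ C.secondPageRel K ρ p ↔
      ∃ (z : Total A) (hz : z ∈ C.filtered.Z (p + q) p (p + 2)),
        C.filtered.cls 2 (p + q) p ⟨z, hz⟩ = n ∧ (z (p, q), c) ∈ ρ p := Iff.rfl

lemma mem_filtered_Z {n m k : ℤ} {x : Total A} :
    x ∈ C.filtered.Z n m k ↔ x ∈ F R A n m ∧ C.D x ∈ F R A (n + 1) k := Iff.rfl

lemma apply_eq_zero {n m : ℤ} {x : Total A} (hx : x ∈ F R A n m) {p q : ℕ}
    (h : (p + q : ℤ) ≠ n ∨ p < m) : x (p, q) = 0 := hx p q h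

/-- An element of the total complex is determined by its leading term modulo the next step of the
filtration. -/
lemma mem_F_succ {n : ℤ} {p q : ℕ} (hn : (p + q : ℤ) = n) {x : Total A} (hx : x ∈ F R A n p)
    (h0 : x (p, q) = 0) : x ∈ F R A n (p + 1) := by
  intro a b hab
  by_cases h : (a + b : ℤ) ≠ n ∨ (a : ℤ) < p
  · exact hx a b h
  · obtain ⟨rfl, rfl⟩ : a = p ∧ b = q := by lia
    exact h0

lemma hPart_succ (x : Total A) (p q : ℕ) : C.hPart x (p + 1) q = C.dh p q (x (p, q)) := rfl

lemma vPart_succ (x : Total A) (p q : ℕ) : C.vPart x p (q + 1) = C.dv p q (x (p, q)) := rfl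

lemma hPart_eq_zero {n m : ℤ} {x : Total A} (hx : x ∈ F R A n m) {p q : ℕ}
    (h : (p + q : ℤ) ≠ n + 1 ∨ p < m + 1) : C.hPart x p q = 0 := by
  cases p with
  | zero => rfl
  | succ p => rw [hPart, hx p q (by lia), map_zero]

lemma vPart_inj_of_ne {p q p' q' : ℕ} (h : p' ≠ p) (x : A p q) :
    C.vPart (inj R A p q x) p' q' = 0 := by
  cases q' with
  | zero => rfl
  | succ q' => rw [vPart, inj_ne (Or.inl h), map_zero]

lemma neg_one_pow_smul_eq_zero {M : Type*} [AddCommGroup M] {p : ℕ} {x : M}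
    (h : (-1 : ℤ) ^ p • x = 0) : x = 0 := by
  have := congrArg (fun y => (-1 : ℤ) ^ p • y) h
  simpa only [smul_smul, ← pow_add, Even.neg_one_pow (⟨p, rfl⟩ : Even (p + p)), one_smul,
    smul_zero] using this

/-- The leading term of an element of `F n p` with boundary in `F (n + 1) (p + 1)` is a vertical
cocycle. -/
lemma dv_eq_zero_of_mem_Z {p q : ℕ} {m : ℤ} (hm : p + 1 ≤ m) {z : Total A}
    (hz : z ∈ C.filtered.Z (p + q) p m) : C.dv p q (z (p, q)) = 0 := by
  have h := apply_eq_zero ((C.mem_filtered_Z).1 hz).2 (p := p) (q := q + 1) (by lia)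
  rw [D_apply, C.hPart_eq_zero ((C.mem_filtered_Z).1 hz).1 (by lia), zero_add] at h
  exact neg_one_pow_smul_eq_zero h

/-- Nothing enters position $(p,q+1)$ from column $p-1$, so the leading coordinate of $Dz$ is, up to
sign, the vertical differential of the leading term. -/
lemma mem_Z_of_dv_eq_zero {p q : ℕ} {z : Total A} (hz : z ∈ F R A (p + q) p)
    (h : C.dv p q (z (p, q)) = 0) : z ∈ C.filtered.Z (p + q) p (p + 1) := by
  refine C.mem_filtered_Z.2 ⟨hz, mem_F_succ (q := q + 1) (by push_cast; ring)
    (C.filtered.D_mem _ _ _ hz) ?_⟩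
  rw [D_apply, C.hPart_eq_zero hz (by lia), vPart_succ, h, smul_zero, add_zero]

/-- The second page of the spectral sequence of a double complex. -/
theorem exists_secondPage_iso (p : ℕ)
    (hρ : ∀ p, IsCohomologyRel (C.dv p q) (C.vBoundaries p q) (C.gr p q) (grK p) (ρ p))
    (hd : ∀ p z c, (z, c) ∈ ρ p → (C.dh p q z, (K.d p (p + 1)).hom c) ∈ ρ (p + 1)) :
    ∃ e : K.homology p ≅ (C.filtered.page 2).X (p, q),
      ∀ i, (homologyGrading K grK p i).map e.hom.hom.toAddMonoidHom =
        C.filtered.pageGr 2 (p, q) i := by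
  -- If the leading term represents $0$ it is a vertical boundary. Subtracting a total boundary with
  -- that leading term moves `z` into the next filtration step, hence into $B_2$.
  have hfun : ∀ n, ((0 : K.X p), n) ∈ C.secondPageRel K ρ p → n = 0 := by
    intro n hn
    obtain ⟨z, hz, rfl, h0⟩ := C.mem_secondPageRel K ρ |>.1 hn
    obtain ⟨b, hb, hbz⟩ := C.exists_D_eq_of_mem_vBoundaries ((hρ p).zero_iff.1 h0)
    have hDb : C.D b ∈ F R A (p + q) p := by
      have := C.filtered.D_mem _ _ _ hb
      rwa [sub_add_cancel] at this
    refine C.filtered.cls_eq_zero.2 (C.filtered.mem_B.2 ⟨z - C.D b, ?_, b, ?_, sub_add_cancel _ _⟩)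
    · refine C.mem_filtered_Z.2 ⟨mem_F_succ rfl (sub_mem hz.1 hDb) ?_, ?_⟩
      · rw [DirectSum.sub_apply, hbz, sub_self]
      · rw [map_sub, C.D_D, sub_zero]
        exact hz.2
    · refine C.mem_filtered_Z.2 ⟨C.filtered.mem_of_le (by lia) hb, ?_⟩
      rwa [sub_add_cancel]
  refine exists_homology_iso_of_rel K (C.secondPageRel K ρ p) grK (C.filtered.pageGr 2 (p, q))
    ?_ ?_ ?_ ?_ hfun ?_ ?_
  · intro c hc
    obtain ⟨x, hx⟩ := (hρ p).exists_rep c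
    have h0 := hd p x c hx
    rw [hc (p + 1), (hρ (p + 1)).zero_iff] at h0
    -- Since $c$ is a cocycle, the horizontal differential of its representative $x$ is a vertical
    -- boundary. A suitable $b$ in column $p+1$ cancels it, so $D(x-b)$ vanishes in columns $p$ and
    -- $p+1$ and $x-b$ lies in $Z_2$.
    obtain ⟨b, hb, hbx⟩ := C.exists_D_eq_of_mem_vBoundaries h0
    have hb' : b ∈ F R A (p + q) (p + 1) := by
      have := hb
      push_cast at this
      rwa [(by ring : (p + 1 + q - 1 : ℤ) = p + q)] at this
    have hz₁ : inj R A p q x - b ∈ F R A (p + q) p :=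
      sub_mem (inj_mem_F rfl le_rfl x) (C.filtered.mem_of_le (by lia) hb')
    have hpq : (inj R A p q x - b) (p, q) = x := by
      rw [DirectSum.sub_apply, inj_same, apply_eq_zero hb' (by lia), sub_zero]
    have hz₂ := (C.mem_filtered_Z.1 (C.mem_Z_of_dv_eq_zero hz₁
      (by rw [hpq]; exact (hρ p).d_eq_zero hx))).2
    refine ⟨_, C.mem_secondPageRel K ρ |>.2
      ⟨inj R A p q x - b, C.mem_filtered_Z.2 ⟨hz₁, ?_⟩, rfl, ?_⟩⟩
    · have := mem_F_succ (n := p + q + 1) (p := p + 1) (q := q) (by push_cast; ring)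
        (x := C.D (inj R A p q x - b)) (by exact_mod_cast hz₂) ?_
      · rwa [(by push_cast; ring : ((p + 1 : ℕ) + 1 : ℤ) = p + 2)] at this
      · rw [map_sub, DirectSum.sub_apply, hbx, D_inj, DirectSum.add_apply, inj_same]
        have hz : ((-1 : ℤ) ^ p • inj R A p (q + 1) (C.dv p q x)) (p + 1, q) = 0 := by
          rw [← map_zsmul]
          exact inj_ne (by lia) _
        rw [hz, add_zero, sub_self]
    · rw [hpq]
      exact hx
  · intro c n hcn l
    by_cases hl : p + 1 = l
    · subst hl
      obtain ⟨z, hz, rfl, hzc⟩ := C.mem_secondPageRel K ρ |>.1 hcn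
      have h := apply_eq_zero ((C.mem_filtered_Z).1 hz).2 (p := p + 1) (q := q) (by lia)
      rw [D_apply, hPart_succ] at h
      refine (hρ (p + 1)).unique (hd p _ c hzc) ((hρ (p + 1)).zero_iff.2 ?_)
      rw [eq_neg_of_add_eq_zero_left h]
      exact neg_mem (zsmul_mem (C.vPart_mem_vBoundaries z (p + 1) q) _)
    · rw [K.shape p l (by simpa using hl)]
      rfl
  · intro n
    obtain ⟨⟨z, hz⟩, rfl⟩ := C.filtered.cls_surjective _ _ _ n
    obtain ⟨c, hc⟩ := (hρ p).exists_class (C.dv_eq_zero_of_mem_Z (by lia) hz)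
    exact ⟨c, z, hz, rfl, hc⟩
  · intro c
    constructor
    · intro hc
      obtain ⟨z, hz, h0, hzc⟩ := C.mem_secondPageRel K ρ |>.1 hc
      obtain ⟨a, ha, b, hb, hab⟩ := C.filtered.mem_B.1 (C.filtered.cls_eq_zero.1 h0)
      -- The part in $F^{p+1}$ has no coordinate here. Up to a vertical boundary the leading term is
      -- therefore the horizontal differential of $b_{p-1,q}$, whose class is a primitive of `c`;
      -- for $p=0$ nothing enters horizontally and $c=0$.
      have hab' : z (p, q) = C.D b (p, q) := by
        have hab'' : z = a + C.D b := hab.symm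
        rw [hab'', DirectSum.add_apply,
          apply_eq_zero ((C.mem_filtered_Z).1 ha).1 (by lia), zero_add]
      rw [hab', D_apply] at hzc
      have hv := (hρ p).zero_iff.2 (zsmul_mem (C.vPart_mem_vBoundaries b p q) ((-1 : ℤ) ^ p))
      have hh := sub_mem hzc hv
      rw [Prod.mk_sub_mk, add_sub_cancel_right, sub_zero] at hh
      cases p with
      | zero => exact ⟨0, 0, by rw [map_zero]; exact ((hρ 0).eq_zero hh).symm⟩
      | succ p =>
        have hb' : b ∈ C.filtered.Z (p + q) p (p + 1) := by
          have := hb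
          push_cast at this
          rwa [(by ring : (p + 1 + q - 1 : ℤ) = p + q), (by ring : (p + 1 - 2 + 1 : ℤ) = p)] at this
        obtain ⟨c', hc'⟩ := (hρ p).exists_class (C.dv_eq_zero_of_mem_Z le_rfl hb')
        exact ⟨p, c', (hρ (p + 1)).unique (hd p _ _ hc') hh⟩
    · rintro ⟨j, y, rfl⟩
      by_cases hj : j + 1 = p
      · subst hj
        obtain ⟨x, hx⟩ := (hρ j).exists_rep y
        have hxF : inj R A j q x ∈ F R A (j + q) j := inj_mem_F rfl le_rfl x
        have hxZ := C.mem_Z_of_dv_eq_zero hxF (by rw [inj_same]; exact (hρ j).d_eq_zero hx)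
        have hxZ' : inj R A j q x ∈ C.filtered.Z ((j + 1 : ℕ) + q - 1) ((j + 1 : ℕ) - 2 + 1)
            (j + 1 : ℕ) := by
          push_cast
          rwa [(by ring : (j + 1 + q - 1 : ℤ) = j + q), (by ring : (j + 1 - 2 + 1 : ℤ) = j)]
        have hDx : C.D (inj R A j q x) ∈ C.filtered.Z ((j + 1 : ℕ) + q) (j + 1 : ℕ)
            ((j + 1 : ℕ) + 2) := by
          refine C.filtered.mem_Z_of_D_eq_zero ?_ (C.D_D _)
          have := (C.mem_filtered_Z.1 hxZ').2
          rwa [sub_add_cancel] at this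
        refine C.mem_secondPageRel K ρ |>.2 ⟨_, hDx, C.filtered.cls_eq_zero.2
          (C.filtered.mem_B.2 ⟨0, zero_mem _, _, hxZ', zero_add _⟩), ?_⟩
        rw [D_apply, hPart_succ, inj_same, C.vPart_inj_of_ne (by lia), smul_zero, add_zero]
        exact hd j _ _ hx
      · rw [K.shape j p (by simpa using hj)]
        exact zero_mem _
  · intro c n i hcn hc
    obtain ⟨z, hz, rfl, hzc⟩ := C.mem_secondPageRel K ρ |>.1 hcn
    have hz' := C.filtered.Z_homogeneous _ _ _ i _ hz
    -- A representative of degree $i$ differs from the leading term of `z` by a vertical boundary.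
    -- These are homogeneous, so the degree $i$ component of `z` also has a leading term
    -- representing `c`.
    obtain ⟨x, hx, hxc⟩ := (hρ p).gr_rep hc
    have h0 := sub_mem hzc hxc
    rw [Prod.mk_sub_mk, sub_self, (hρ p).zero_iff] at h0
    have h0' := C.vBoundaries_homogeneous p q i _ h0
    rw [map_sub, gproj_of_mem (C.isGrading p q).isInternal hx, ← C.gproj_total_apply,
      ← (hρ p).zero_iff] at h0'
    have h1 := add_mem h0' hxc
    rw [Prod.mk_add_mk, sub_add_cancel, zero_add] at h1
    have : C.filtered.cls 2 (p + q) p ⟨z, hz⟩ = C.filtered.cls 2 (p + q) p ⟨_, hz'⟩ := by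
      rw [← sub_eq_zero]
      refine hfun _ (C.mem_secondPageRel K ρ |>.2 ⟨_, sub_mem hz hz', rfl, ?_⟩)
      have := sub_mem hzc h1
      rwa [Prod.mk_sub_mk, sub_self, ← DirectSum.sub_apply] at this
    rw [this]
    exact ⟨_, gproj_mem C.isInternal_totalGr i z, rfl⟩
  · rintro _ i ⟨⟨z, hz⟩, hzi, rfl⟩
    obtain ⟨c, hc⟩ := (hρ p).exists_class (C.dv_eq_zero_of_mem_Z (by lia) hz)
    exact ⟨c, (hρ p).gr_class hc (hzi p q), z, hz, rfl, hc⟩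

end SecondPage

/-! ### Total cohomology of an augmented double complex with exact rows -/

section Augmentation

variable {Q : ℕ → Type*} [∀ q, AddCommGroup (Q q)] [∀ q, Module R[X] (Q q)]

/-- An augmentation of a double complex by a complex of graded modules such that the augmented rows
are exact and the kernel of the augmentation is acyclic. -/
structure Augmentation (Q : ℕ → Type*) [∀ q, AddCommGroup (Q q)] [∀ q, Module R[X] (Q q)] where
  /-- the differential of the augmenting complex -/
  d (q : ℕ) : Q q →ₗ[R[X]] Q (q + 1)
  d_d (q : ℕ) (s : Q q) : d (q + 1) (d q s) = 0
  /-- the augmentation -/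
  ε (q : ℕ) : Q q →ₗ[R[X]] A 0 q
  ε_d (q : ℕ) (s : Q q) : ε (q + 1) (d q s) = C.dv 0 q (ε q s)
  dh_ε (q : ℕ) (s : Q q) : C.dh 0 q (ε q s) = 0
  row_exact (p q : ℕ) (x : A (p + 1) q) : C.dh (p + 1) q x = 0 → ∃ y, C.dh p q y = x
  exists_ε (q : ℕ) (x : A 0 q) : C.dh 0 q x = 0 → ∃ s, ε q s = x
  ker_zero (s : Q 0) : d 0 s = 0 → ε 0 s = 0 → s = 0
  ker_succ (q : ℕ) (s : Q (q + 1)) : d (q + 1) s = 0 → ε (q + 1) s = 0 →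
    ∃ s', d q s' = s ∧ ε q s' = 0
  /-- the gradings of the augmenting complex -/
  gr (q : ℕ) : ℤ → AddSubgroup (Q q)
  isInternal (q : ℕ) : DirectSum.IsInternal (gr q)
  d_gr (q : ℕ) (i : ℤ) (s : Q q) (hs : s ∈ gr q i) : d q s ∈ gr (q + 1) i
  ε_gr (q : ℕ) (i : ℤ) (s : Q q) (hs : s ∈ gr q i) : ε q s ∈ C.gr 0 q i

variable {C} (ξ : C.Augmentation Q)

/-- The boundaries of the augmenting complex. -/
def Augmentation.boundaries : ∀ q, Submodule R[X] (Q q)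
  | 0 => ⊥
  | q + 1 => LinearMap.range (ξ.d q)

lemma Augmentation.ker_mem_boundaries {q : ℕ} {s : Q q} (hd : ξ.d q s = 0) (hε : ξ.ε q s = 0) :
    s ∈ ξ.boundaries q := by
  cases q with
  | zero => exact ξ.ker_zero s hd hε
  | succ q =>
    obtain ⟨s', rfl, -⟩ := ξ.ker_succ q s hd hε
    exact ⟨s', rfl⟩

/-- Every total cochain whose boundary is concentrated in the first column is cohomologous to one
concentrated in the first column. -/
lemma Augmentation.exists_sub_D_first_column (ξ : C.Augmentation Q) {n : ℤ} {y : Total A}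
    (hy : y ∈ F R A n 0)
    (hDy : ∀ p q, C.D y (p + 1, q) = 0) :
    ∃ b ∈ F R A (n - 1) 0, ∀ p q, (y - C.D b) (p + 1, q) = 0 := by
  -- Induction on a bound `m` for the columns where `y` is nonzero. The rightmost entry is a
  -- horizontal cocycle, because $Dy$ vanishes one column further right and `y` has no entry there.
  -- Exactness of the row gives a total boundary cancelling this entry.
  have key : ∀ (m : ℕ) (y : Total A), y ∈ F R A n 0 → (∀ p q, C.D y (p + 1, q) = 0) →
      (∀ p q, m < p → y (p, q) = 0) →
      ∃ b ∈ F R A (n - 1) 0, ∀ p q, (y - C.D b) (p + 1, q) = 0 := by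
    intro m
    induction m with
    | zero =>
      intro y _ _ h
      refine ⟨0, zero_mem _, fun p q => ?_⟩
      rw [map_zero, sub_zero, h _ _ (by lia)]
    | succ m ih =>
      intro y hy hDy h
      by_cases hq : ∃ q : ℕ, (m + 1 + q : ℤ) = n
      · obtain ⟨q, hq⟩ := hq
        have h0 : C.dh (m + 1) q (y (m + 1, q)) = 0 := by
          have := hDy (m + 1) q
          rw [D_apply, hPart_succ] at this
          have hv : C.vPart y (m + 1 + 1) q = 0 := by
            cases q with
            | zero => rfl
            | succ q => rw [vPart, h _ _ (by lia), map_zero]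
          rwa [hv, smul_zero, add_zero] at this
        obtain ⟨t, ht⟩ := ξ.row_exact m q _ h0
        have htF : inj R A m q t ∈ F R A (n - 1) 0 := inj_mem_F (by lia) (by lia) t
        have hDt : C.D (inj R A m q t) ∈ F R A n 0 := by
          have := C.filtered.D_mem _ _ _ htF
          rwa [sub_add_cancel] at this
        obtain ⟨b, hb, hb'⟩ := ih (y - C.D (inj R A m q t)) (sub_mem hy hDt)
          (fun p q => by rw [map_sub, C.D_D, sub_zero, hDy]) (fun p q' hp => by
            by_cases hpq : p = m + 1 ∧ q' = q
            · obtain ⟨rfl, rfl⟩ := hpq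
              rw [DirectSum.sub_apply, D_apply, hPart_succ, inj_same, ht,
                C.vPart_inj_of_ne (by lia), smul_zero, add_zero, sub_self]
            · by_cases hpm : p = m + 1
              · exact sub_mem hy hDt p q' (by lia)
              · rw [DirectSum.sub_apply, h p q' (by lia), D_inj, DirectSum.add_apply,
                  inj_ne (by lia), ← map_zsmul, inj_ne (by lia), add_zero, sub_zero])
        refine ⟨inj R A m q t + b, add_mem htF hb, fun p q => ?_⟩
        rw [map_add, ← sub_sub, hb']
      · refine ih y hy hDy fun p q hp => ?_
        by_cases hpm : p = m + 1
        · subst hpm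
          exact hy _ _ (Or.inl fun h => hq ⟨q, by push_cast at h; lia⟩)
        · exact h p q (by lia)
  -- In total degree $n$ there is nothing in columns beyond $n$.
  refine key n.toNat y hy hDy fun p q hp => hy p q (by lia)

lemma eq_inj_of_first_column {n : ℕ} {y : Total A} (hy : y ∈ F R A n 0)
    (h : ∀ p q, y (p + 1, q) = 0) : y = inj R A 0 n (y (0, n)) := by
  refine DFinsupp.ext fun ⟨p, q⟩ => ?_
  cases p with
  | zero =>
    by_cases hq : q = n
    · subst hq
      exact (inj_same 0 q _).symm
    · exact (hy 0 q (by lia)).trans (inj_ne (by lia) _).symm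
  | succ p => exact (h p q).trans (inj_ne (by lia) _).symm

lemma dh_eq_zero_and_dv_eq {q : ℕ} {c : A 0 q} {x : A 0 (q + 1)}
    (h : C.D (inj R A 0 q c) = inj R A 0 (q + 1) x) : C.dh 0 q c = 0 ∧ C.dv 0 q c = x := by
  constructor
  · have := congrArg (fun y : Total A => y (1, q)) h
    simp only at this
    rwa [D_apply, C.vPart_inj_of_ne (by lia), hPart_succ, inj_same, smul_zero, add_zero,
      inj_ne (by lia)] at this
  · have := congrArg (fun y : Total A => y (0, q + 1)) h
    simp only at this
    rwa [D_apply, vPart_succ, inj_same, inj_same, hPart, pow_zero, one_smul, zero_add] at this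

lemma Augmentation.D_inj_ε (q : ℕ) (s : Q q) :
    C.D (inj R A 0 q (ξ.ε q s)) = inj R A 0 (q + 1) (ξ.ε (q + 1) (ξ.d q s)) := by
  rw [D_inj, ξ.dh_ε, map_zero, pow_zero, one_smul, zero_add, ξ.ε_d]

/-- Every total cocycle is cohomologous to the image of a cocycle of the augmenting complex. -/
lemma Augmentation.exists_cocycle {n : ℕ} {z : Total A} (hz : z ∈ F R A n 0) (hDz : C.D z = 0) :
    ∃ s : Q n, ξ.d n s = 0 ∧ ∃ b ∈ F R A (n - 1) 0, z - inj R A 0 n (ξ.ε n s) = C.D b := by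
  obtain ⟨b, hb, hb'⟩ := ξ.exists_sub_D_first_column hz (fun p q => by rw [hDz]; rfl)
  have hDb : C.D b ∈ F R A n 0 := by
    have := C.filtered.D_mem _ _ _ hb
    rwa [sub_add_cancel] at this
  have e := eq_inj_of_first_column (sub_mem hz hDb) hb'
  set c := (z - C.D b) (0, n)
  have hDc : C.D (inj R A 0 n c) = inj R A 0 (n + 1) 0 := by
    rw [← e, map_sub, C.D_D, hDz, sub_zero, map_zero]
  obtain ⟨h₁, h₂⟩ := dh_eq_zero_and_dv_eq hDc
  obtain ⟨s, hs⟩ := ξ.exists_ε n c h₁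
  -- The lift `s` need not be a cocycle, but $ds$ is a cocycle in the kernel of the augmentation. By
  -- acyclicity of the kernel it is $ds'$ with $\varepsilon s'=0$, and $s-s'$ is a cocycle with the
  -- same image.
  obtain ⟨s', hs', hs''⟩ := ξ.ker_succ n (ξ.d n s) (ξ.d_d n s) (by rw [ξ.ε_d, hs, h₂])
  refine ⟨s - s', by rw [map_sub, hs', sub_self], b, hb, ?_⟩
  rw [map_sub, hs'', sub_zero, hs, ← e, sub_sub_cancel]

/-- A cocycle of the augmenting complex whose image is a boundary is a boundary. -/
lemma Augmentation.mem_boundaries_of_eq_D {n : ℕ} {s : Q n} (hs : ξ.d n s = 0) {y : Total A}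
    (hy : y ∈ F R A (n - 1) 0) (h : inj R A 0 n (ξ.ε n s) = C.D y) : s ∈ ξ.boundaries n := by
  cases n with
  | zero =>
    have h0 : y = 0 := C.filtered.eq_zero _ _ _ hy (by lia)
    rw [h0, map_zero] at h
    refine ξ.ker_mem_boundaries hs ?_
    rw [← inj_same (R := R) 0 0 (ξ.ε 0 s), h]
    rfl
  | succ m =>
    have hy' : y ∈ F R A m 0 := by
      have := hy
      push_cast at this
      rwa [add_sub_cancel_right] at this
    obtain ⟨b, hb, hb'⟩ := ξ.exists_sub_D_first_column hy'
      (fun p q => by rw [← h]; exact inj_ne (by lia) _)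
    have hDb : C.D b ∈ F R A m 0 := by
      have := C.filtered.D_mem _ _ _ hb
      rwa [sub_add_cancel] at this
    have e := eq_inj_of_first_column (sub_mem hy' hDb) hb'
    set c := (y - C.D b) (0, m)
    have hDc : C.D (inj R A 0 m c) = inj R A 0 (m + 1) (ξ.ε (m + 1) s) := by
      rw [← e, map_sub, C.D_D, sub_zero, h]
    obtain ⟨h₁, h₂⟩ := dh_eq_zero_and_dv_eq hDc
    obtain ⟨s', hs'⟩ := ξ.exists_ε m c h₁
    have h3 := ξ.ker_mem_boundaries (s := s - ξ.d m s') (by rw [map_sub, hs, ξ.d_d, sub_zero])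
      (by rw [map_sub, ξ.ε_d, hs', h₂, sub_self])
    have := add_mem h3 (⟨s', rfl⟩ : ξ.d m s' ∈ ξ.boundaries (m + 1))
    rwa [sub_add_cancel] at this

lemma Augmentation.exists_D_eq_of_mem_boundaries {n : ℕ} {s : Q n} (hs : s ∈ ξ.boundaries n) :
    ∃ b ∈ F R A (n - 1) 0, inj R A 0 n (ξ.ε n s) = C.D b := by
  cases n with
  | zero =>
    refine ⟨0, zero_mem _, ?_⟩
    rw [(Submodule.mem_bot R[X]).1 hs, map_zero, map_zero, map_zero]
  | succ n =>
    obtain ⟨s', rfl⟩ := hs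
    exact ⟨inj R A 0 n (ξ.ε n s'), inj_mem_F (by push_cast; ring) (by lia) _, (ξ.D_inj_ε n s').symm⟩

/-- The spectral sequence of an augmented double complex converges to the cohomology of the
augmenting complex. -/
theorem Augmentation.convergesTo {H : ℕ → Type*} [∀ n, AddCommGroup (H n)]
    [∀ n, Module R[X] (H n)] {grH : ∀ n, ℤ → AddSubgroup (H n)}
    (hH : ∀ n, DirectSum.IsInternal (grH n)) (ρ : ∀ n, Submodule R[X] (Q n × H n))
    (hρ : ∀ n, IsCohomologyRel (ξ.d n) (ξ.boundaries n) (ξ.gr n) (grH n) (ρ n)) :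
    C.filtered.spectralSequence.ConvergesTo H grH := by
  -- A total cochain is related to a class `h` if, modulo a total boundary, it is the image of a
  -- cocycle of the augmenting complex representing `h`.
  let G (n : ℕ) : Submodule R[X] (Total A × H n) :=
    { carrier := {x | ∃ s, (s, x.2) ∈ ρ n ∧
        ∃ b ∈ F R A (n - 1) 0, x.1 - inj R A 0 n (ξ.ε n s) = C.D b}
      zero_mem' := ⟨0, zero_mem _, 0, zero_mem _, by simp⟩
      add_mem' := by
        rintro x x' ⟨s, hs, b, hb, h⟩ ⟨s', hs', b', hb', h'⟩
        refine ⟨s + s', add_mem hs hs', b + b', add_mem hb hb', ?_⟩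
        rw [map_add (ξ.ε n), map_add C.D, ← h, ← h', map_add (inj R A 0 n), Prod.fst_add]
        abel
      smul_mem' := by
        rintro a x ⟨s, hs, b, hb, h⟩
        refine ⟨a • s, Submodule.smul_mem _ a hs, a • b, Submodule.smul_mem _ a hb, ?_⟩
        rw [map_smul, map_smul C.D, ← h, map_smul, smul_sub, Prod.smul_fst] }
  have hG0 (n : ℕ) (h : H n) (hh : (0, h) ∈ G n) : h = 0 := by
    obtain ⟨s, hs, b, hb, e⟩ := hh
    have hs' := ξ.mem_boundaries_of_eq_D ((hρ n).d_eq_zero hs) (neg_mem hb)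
      (by rw [map_neg, ← e]; simp)
    exact (hρ n).unique hs ((hρ n).zero_iff.2 hs')
  have hGu {n : ℕ} {z : Total A} {h h' : H n} (hh : (z, h) ∈ G n) (hh' : (z, h') ∈ G n) :
      h = h' := by
    refine sub_eq_zero.1 (hG0 n _ ?_)
    simpa using sub_mem hh hh'
  choose θ hθ using fun n : ℕ => exists_linearMap_of_rel (C.filtered.cocycles n) (G n)
    (fun z hz => by
      obtain ⟨s, hs, b, hb, e⟩ := ξ.exists_cocycle hz.1 hz.2
      obtain ⟨h, hh⟩ := (hρ n).exists_class hs
      exact ⟨h, s, hh, b, hb, e⟩) (hG0 n)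
  refine C.filtered.convergesTo θ hH ?_ ?_ ?_
  · intro n i z hz
    obtain ⟨s, hs, b, hb, e⟩ := hθ n z
    -- For `z` of degree $i$, taking degree $i$ components of `s` and `b` preserves the relation to
    -- `z`, so the class of `z` has a representative of degree $i$.
    have hs₀ : gproj (ξ.isInternal n) i s ∈ ξ.gr n i := gproj_mem _ i s
    have hds : ξ.d n (gproj (ξ.isInternal n) i s) = 0 := by
      refine (gproj_comm (ξ.isInternal n) (ξ.isInternal (n + 1)) (ξ.d n).toAddMonoidHom
        (ξ.d_gr n) i s).trans ?_
      exact (congrArg _ ((hρ n).d_eq_zero hs)).trans (map_zero _)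
    obtain ⟨h', hh'⟩ := (hρ n).exists_class hds
    have hzh' : ((z : Total A), h') ∈ G n := by
      refine ⟨_, hh', gproj C.isInternal_totalGr i b, C.filtered.F_homogeneous _ _ i b hb, ?_⟩
      have hD : C.D (gproj C.isInternal_totalGr i b) = gproj C.isInternal_totalGr i (C.D b) :=
        gproj_comm C.isInternal_totalGr C.isInternal_totalGr C.D.toAddMonoidHom C.D_mem_totalGr i b
      have hε : inj R A 0 n (ξ.ε n (gproj (ξ.isInternal n) i s)) =
          gproj C.isInternal_totalGr i (inj R A 0 n (ξ.ε n s)) :=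
        gproj_comm (ξ.isInternal n) C.isInternal_totalGr (inj R A 0 n ∘ₗ ξ.ε n).toAddMonoidHom
          (fun i s hs => C.inj_mem_totalGr (ξ.ε_gr n i s hs)) i s
      rw [hD, hε, ← e, map_sub, gproj_of_mem C.isInternal_totalGr hz]
    rw [hGu (hθ n z) hzh']
    exact (hρ n).gr_class hh' hs₀
  · intro n h
    obtain ⟨s, hs⟩ := (hρ n).exists_rep h
    have hz : inj R A 0 n (ξ.ε n s) ∈ C.filtered.cocycles n := by
      refine ⟨inj_mem_F (by lia) (by lia) _, ?_⟩
      refine (ξ.D_inj_ε n s).trans ?_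
      rw [(hρ n).d_eq_zero hs, map_zero, map_zero]
    refine ⟨⟨_, hz⟩, hGu (hθ n ⟨_, hz⟩) ⟨s, hs, 0, zero_mem _, ?_⟩⟩
    rw [map_zero]
    exact sub_self _
  · intro n z
    constructor
    · intro h
      have hz := hθ n z
      rw [h] at hz
      obtain ⟨s, hs, b, hb, e⟩ := hz
      obtain ⟨b', hb', e'⟩ := ξ.exists_D_eq_of_mem_boundaries ((hρ n).zero_iff.1 hs)
      refine ⟨b + b', add_mem hb hb', ?_⟩
      refine (map_add C.D b b').trans ?_
      rw [← e, ← e', sub_add_cancel]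
    · rintro ⟨b, hb, e⟩
      refine hGu (hθ n z) ⟨0, zero_mem _, b, hb, ?_⟩
      rw [map_zero, map_zero, sub_zero]
      exact e.symm

end Augmentation

end DoubleComplex

/-! ### Singular cochains of subspaces -/

lemma alternatingCofaceMapComplex_d_apply {R : Type v} [CommRing R]
    (Y : CosimplicialObject (ModuleCat.{w} R)) (q : ℕ)
    (x : ((AlgebraicTopology.alternatingCofaceMapComplex _).obj Y).X q) :
    (((AlgebraicTopology.alternatingCofaceMapComplex _).obj Y).d q (q + 1)).hom x =
      ∑ j : Fin (q + 2), (-1 : ℤ) ^ (j : ℕ) • (Y.δ j).hom x := by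
  have h : ((AlgebraicTopology.alternatingCofaceMapComplex _).obj Y).d q (q + 1) =
      AlgebraicTopology.AlternatingCofaceMapComplex.objD Y q :=
    CochainComplex.of_d _ (AlgebraicTopology.AlternatingCofaceMapComplex.objD Y) _
  rw [h, AlgebraicTopology.AlternatingCofaceMapComplex.objD]
  refine (LinearMap.congr_fun (ModuleCat.hom_sum _ _) x).trans ?_
  rw [LinearMap.sum_apply]
  rfl

section SubspaceCochains

variable (R : Type v) [CommRing R] (X : Type u) [TopologicalSpace X]

/-- The singular cochain complex of the subspaces of `X`. -/
def subspaceCochains : (Set X)ᵒᵖ ⥤ CochainComplex (ModuleCat.{max u v} R) ℕ :=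
  (subspaceFunctor X).op ⋙ singularCochainFunctor R

variable {R X}

/-- The singular simplices of a subspace are the continuous maps from a standard simplex. -/
def simplexEquiv (B : Set X) (q : ℕ) :
    (TopCat.toSSet.obj (TopCat.of B)).obj (op (SimplexCategory.mk q)) ≃ C(Simp (q + 1), B) :=
  TopCat.toSSetObjEquiv (TopCat.of B) (op (SimplexCategory.mk q))

/-- A singular cochain of a subspace as a function on continuous maps. -/
def cochainEquiv (B : Set X) (q : ℕ) :
    ((subspaceCochains R X).obj (op B)).X q ≃ₗ[R] (C(Simp (q + 1), B) → R) :=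
  LinearEquiv.funCongrLeft R R (simplexEquiv B q).symm

/-- The inclusion of subspaces as a continuous map. -/
def inclMap {B B' : Set X} (h : B ⊆ B') : C(B, B') := ⟨Set.inclusion h, continuous_inclusion h⟩

lemma cochainEquiv_res {B B' : Set X} (h : B ⊆ B') (q : ℕ)
    (x : ((subspaceCochains R X).obj (op B')).X q) (s : C(Simp (q + 1), B)) :
    cochainEquiv B q ((((subspaceCochains R X).map (homOfLE h).op).f q).hom x) s =
      cochainEquiv B' q x ((inclMap h).comp s) := rfl

/-- This identifies the differential of the categorical singular cochain complex with the explicit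
face sum to which subdivision applies. -/
lemma cochainEquiv_d (B : Set X) (q : ℕ)
    (x : ((subspaceCochains R X).obj (op B)).X q) :
    cochainEquiv B (q + 1) ((((subspaceCochains R X).obj (op B)).d q (q + 1)).hom x) =
      coboundary (cochainEquiv B q x) := by
  funext s
  refine (congrFun (congrArg (cochainEquiv B (q + 1)) (alternatingCofaceMapComplex_d_apply
    (((CosimplicialObject.whiskering _ _).obj (functionsFunctor R)).obj
      ((simplicialCosimplicialEquiv (Type u)).functor.obj
        (op (TopCat.toSSet.obj (TopCat.of B))))) q x)) s).trans ?_
  refine (congrFun (map_sum (cochainEquiv B (q + 1)) _ _) s).trans ?_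
  rw [Finset.sum_apply, coboundary]
  refine Finset.sum_congr rfl fun j _ => ?_
  refine (congrFun (map_zsmul (cochainEquiv B (q + 1)) _ _) s).trans ?_
  rw [Pi.smul_apply]
  congr 1
  -- The coface is precomposition with the map of standard simplices induced by `succAbove`, which
  -- is affine and hence equals `faceMap`.
  refine congrArg (fun s' : C(Simp (q + 1), B) => x ((simplexEquiv B q).symm s')) ?_
    (a₁ := s.comp ⟨_, stdSimplex.continuous_map (j.succAbove)⟩)
  ext t
  exact congrArg (fun t => (s t : X)) (map_eq_affineSimplex _ t)

/-- A simplex of `X` with values in `B`, as a simplex of `B`. -/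
def liftSimplex {n : ℕ} {B : Set X} (s : C(Simp n, X)) (h : ∀ t, s t ∈ B) : C(Simp n, B) :=
  ⟨fun t => ⟨s t, h t⟩, s.continuous.subtype_mk h⟩

/-- The inclusion of a subspace. -/
def valMap (B : Set X) : C(B, X) := ⟨Subtype.val, continuous_subtype_val⟩

open Classical in
/-- The value of a singular cochain of the subspace `B` on a simplex of `X`, which is zero if the
simplex does not lie in `B`. -/
def evalAt {q : ℕ} (B : Set X) (s : C(Simp (q + 1), X)) :
    ((subspaceCochains R X).obj (op B)).X q →ₗ[R] R :=
  if h : ∀ t, s t ∈ B then LinearMap.proj (liftSimplex s h) ∘ₗ (cochainEquiv B q).toLinearMap else 0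

lemma evalAt_of_mem {q : ℕ} {B : Set X} {s : C(Simp (q + 1), X)} (h : ∀ t, s t ∈ B)
    (x : ((subspaceCochains R X).obj (op B)).X q) :
    evalAt B s x = cochainEquiv B q x (liftSimplex s h) := by
  rw [evalAt, dif_pos h]
  rfl

/-- The restriction of singular cochains to a smaller subspace. -/
abbrev resCochain {B B' : Set X} (h : B ⊆ B') (q : ℕ) :
    ((subspaceCochains R X).obj (op B')).X q →ₗ[R] ((subspaceCochains R X).obj (op B)).X q :=
  (((subspaceCochains R X).map (homOfLE h).op).f q).hom

/-- Evaluating on simplices of the ambient `X` makes restriction invisible. For fixed `s`, cochains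
on varying subspaces become plain elements of `R`, and the Čech differential becomes a combinatorial
one. -/
lemma evalAt_res {B B' : Set X} (hB : B ⊆ B') {q : ℕ} {s : C(Simp (q + 1), X)}
    (h : ∀ t, s t ∈ B) (x : ((subspaceCochains R X).obj (op B')).X q) :
    evalAt B s (resCochain hB q x) = evalAt B' s x := by
  rw [evalAt_of_mem h, evalAt_of_mem fun t => hB (h t), cochainEquiv_res]
  rfl

lemma cochain_ext {B : Set X} {q : ℕ} {x y : ((subspaceCochains R X).obj (op B)).X q}
    (h : ∀ s : C(Simp (q + 1), X), (∀ t, s t ∈ B) → evalAt B s x = evalAt B s y) : x = y := by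
  refine (cochainEquiv B q).injective (funext fun s => ?_)
  have := h ((valMap B).comp s) fun t => (s t).2
  rwa [evalAt_of_mem fun t => (s t).2, evalAt_of_mem fun t => (s t).2] at this

/-- The singular cochain of `B` given by a function on the simplices of `X`. -/
def cochainOf (B : Set X) (q : ℕ) (φ : C(Simp (q + 1), X) → R) :
    ((subspaceCochains R X).obj (op B)).X q :=
  (cochainEquiv B q).symm fun s => φ ((valMap B).comp s)

lemma evalAt_cochainOf {B : Set X} {q : ℕ} (φ : C(Simp (q + 1), X) → R) {s : C(Simp (q + 1), X)}
    (h : ∀ t, s t ∈ B) : evalAt B s (cochainOf B q φ) = φ s := by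
  rw [evalAt_of_mem h, cochainOf, LinearEquiv.apply_symm_apply]
  rfl

/-! ### Exactness of the Čech complex of singular cochains -/

section Cone

variable {ι : Type w} [LinearOrder ι]

/-- The sequence consisting of one element. -/
def singleEmb (m : ι) : Fin 1 ↪o ι :=
  OrderEmbedding.ofStrictMono (fun _ => m) fun _ _ h => absurd h (by simp)

/-- Insert an element in front of an increasing sequence. -/
def consEmb {p : ℕ} (m : ι) (σ : Fin (p + 1) ↪o ι) (h : m < σ 0) : Fin (p + 2) ↪o ι :=
  OrderEmbedding.ofStrictMono (Fin.cons m σ) (by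
    intro i j
    refine Fin.cases ?_ (fun i => ?_) i <;> refine Fin.cases ?_ (fun j => ?_) j
    · exact fun h => absurd h (lt_irrefl _)
    · intro _
      simpa using h.trans_le (σ.monotone (Fin.zero_le j))
    · exact fun h => absurd h (by simp)
    · intro hij
      simpa using hij)

lemma cechFace_consEmb_zero {p : ℕ} (m : ι) (σ : Fin (p + 1) ↪o ι) (h : m < σ 0) :
    cechFace (consEmb m σ h) 0 = σ :=
  RelEmbedding.ext fun _ => rfl

lemma cechFace_consEmb_succ {p : ℕ} (m : ι) (σ : Fin (p + 2) ↪o ι) (h : m < σ 0)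
    (j : Fin (p + 2)) (h' : m < cechFace σ j 0) :
    cechFace (consEmb m σ h) j.succ = consEmb m (cechFace σ j) h' := by
  refine RelEmbedding.ext fun l => ?_
  change (Fin.cons m σ : Fin (p + 3) → ι) (j.succ.succAbove l) =
    (Fin.cons m (cechFace σ j) : Fin (p + 2) → ι) l
  refine Fin.cases ?_ (fun l => ?_) l
  · simp
  · simp only [Fin.succ_succAbove_succ, Fin.cons_succ]
    rfl

open Classical in
/-- The contracting homotopy of the cochain complex of a simplex with first vertex `m`. -/
def coneHomotopy {G : Type*} [AddCommGroup G] {p : ℕ} (m : ι) (x : (Fin (p + 2) ↪o ι) → G)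
    (σ : Fin (p + 1) ↪o ι) : G :=
  if h : m < σ 0 then x (consEmb m σ h) else 0

/-- If $m<\sigma_0$, this is the cocycle condition for $(m,\sigma)$. If $m=\sigma_0$, only the face
omitting $\sigma_0$ allows $m$ to be inserted, and inserting it gives $\sigma$ back. The cocycle
condition is needed only for sequences in `J`. -/
lemma sum_coneHomotopy {G : Type*} [AddCommGroup G] {p : ℕ} {J : Set ι} {m : ι} (hm : m ∈ J)
    (hmin : ∀ a ∈ J, m ≤ a) (x : (Fin (p + 2) ↪o ι) → G)
    (hx : ∀ τ : Fin (p + 3) ↪o ι, (∀ k, τ k ∈ J) →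
      ∑ j : Fin (p + 3), (-1 : ℤ) ^ (j : ℕ) • x (cechFace τ j) = 0)
    (σ : Fin (p + 2) ↪o ι) (hσ : ∀ k, σ k ∈ J) :
    ∑ j : Fin (p + 2), (-1 : ℤ) ^ (j : ℕ) • coneHomotopy m x (cechFace σ j) = x σ := by
  rcases (hmin _ (hσ 0)).lt_or_eq with h | h
  · have hf (j : Fin (p + 2)) : m < cechFace σ j 0 := h.trans_le (σ.monotone (Fin.zero_le _))
    have hτ := hx (consEmb m σ h) (fun k => Fin.cases hm (fun k => hσ k) k)
    rw [Fin.sum_univ_succ] at hτ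
    simp only [Fin.val_zero, pow_zero, one_smul, cechFace_consEmb_zero, Fin.val_succ, pow_succ,
      mul_neg_one, neg_smul, Finset.sum_neg_distrib] at hτ
    rw [eq_comm, ← sub_eq_zero, sub_eq_add_neg, ← hτ]
    congr 2
    refine Finset.sum_congr rfl fun j _ => ?_
    rw [coneHomotopy, dif_pos (hf j), cechFace_consEmb_succ m σ h j (hf j)]
  · rw [Fin.sum_univ_succ, Finset.sum_eq_zero, add_zero]
    · have h' : m < cechFace σ 0 0 := by
        rw [h]
        exact σ.strictMono (by simp)
      simp only [Fin.val_zero, pow_zero, one_smul]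
      rw [coneHomotopy, dif_pos h']
      congr 1
      refine RelEmbedding.ext fun l => ?_
      exact Fin.cases h (fun l => rfl) l
    · intro j _
      rw [coneHomotopy, dif_neg, smul_zero]
      rw [h]
      change ¬ σ 0 < σ (j.succ.succAbove 0)
      simp

end Cone

/-! ### Exactness simplex by simplex, and cochains vanishing on small simplices -/

section Exactness

variable {Y : Type*} [TopologicalSpace Y] (f : C(X, Y)) {ι : Type w} [LinearOrder ι]
  (U : ι → Set Y)

/-- The indices of the members of the cover which contain the image of a simplex. -/
def simplexIndices {ι : Type w} (U : ι → Set Y) {n : ℕ} (s : C(Simp n, X)) : Set ι :=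
  {a | ∀ t, f (s t) ∈ U a}

variable {f} {U}

/-- A member containing the simplex contains its first vertex, and a locally finite family is point
finite. -/
lemma finite_simplexIndices {ι : Type w} {U : ι → Set Y}
    (hfin : LocallyFinite fun a => f ⁻¹' U a) {q : ℕ}
    (s : C(Simp (q + 1), X)) : (simplexIndices f U s).Finite :=
  (hfin.point_finite (s (stdSimplex.vertex 0))).subset fun _ ha => ha _

/-- The smallest index is the apex of the contraction at `s`. The value `none` marks simplices
contained in no member, where the constructed cochains are set to zero. -/
lemma exists_min_simplexIndices (hfin : LocallyFinite fun a => f ⁻¹' U a) (q : ℕ) :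
    ∃ m : C(Simp (q + 1), X) → Option ι, ∀ s a, a ∈ simplexIndices f U s →
      ∃ b ∈ simplexIndices f U s, m s = some b ∧ ∀ c ∈ simplexIndices f U s, b ≤ c := by
  have h (s : C(Simp (q + 1), X)) : ∃ m : Option ι, ∀ a, a ∈ simplexIndices f U s →
      ∃ b ∈ simplexIndices f U s, m = some b ∧ ∀ c ∈ simplexIndices f U s, b ≤ c := by
    by_cases hne : (simplexIndices f U s).Nonempty
    · obtain ⟨b, hb, hmin⟩ := Set.exists_min_image _ id (finite_simplexIndices hfin s) hne
      exact ⟨some b, fun _ _ => ⟨b, hb, rfl, hmin⟩⟩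
    · exact ⟨none, fun a ha => absurd ⟨a, ha⟩ hne⟩
  choose m hm using h
  exact ⟨m, hm⟩

/-- At a fixed simplex of `A`, the Čech complex only sees increasing sequences in one set of
indices, so it is the cochain complex of a full simplex. -/
lemma forall_mem_cech_iff {A : Set X} {p n : ℕ} {σ : Fin (p + 1) ↪o ι} {s : C(Simp n, X)} :
    (∀ t, s t ∈ A ∩ f ⁻¹' cechInter U σ) ↔ (∀ t, s t ∈ A) ∧ ∀ k, σ k ∈ simplexIndices f U s := by
  simp only [cechInter, Set.mem_inter_iff, Set.mem_preimage, Set.mem_iInter, simplexIndices,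
    Set.mem_ofPred_eq]
  exact ⟨fun h => ⟨fun t => (h t).1, fun k t => (h t).2 k⟩, fun h t => ⟨h.1 t, fun k => h.2 k t⟩⟩

lemma cech_subset (f : C(X, Y)) (U : ι → Set Y) (A : Set X) {p : ℕ} (σ : Fin (p + 2) ↪o ι)
    (j : Fin (p + 2)) : A ∩ f ⁻¹' cechInter U σ ⊆ A ∩ f ⁻¹' cechInter U (cechFace σ j) :=
  Set.inter_subset_inter_right _ (Set.preimage_mono (cechInter_subset U σ j))

variable {A : Set X} {q : ℕ}

lemma sum_evalAt {p : ℕ}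
    (x : ∀ σ : Fin (p + 1) ↪o ι, ((subspaceCochains R X).obj (op (A ∩ f ⁻¹' cechInter U σ))).X q)
    {τ : Fin (p + 2) ↪o ι} {s : C(Simp (q + 1), X)} (hs : ∀ t, s t ∈ A ∩ f ⁻¹' cechInter U τ) :
    evalAt (A ∩ f ⁻¹' cechInter U τ) s (∑ j : Fin (p + 2), (-1 : ℤ) ^ (j : ℕ) •
        resCochain (cech_subset f U A τ j) q (x (cechFace τ j))) =
      ∑ j : Fin (p + 2), (-1 : ℤ) ^ (j : ℕ) • evalAt _ s (x (cechFace τ j)) := by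
  rw [map_sum]
  refine Finset.sum_congr rfl fun j _ => ?_
  rw [map_zsmul, evalAt_res _ hs]

/-- Čech cocycles of positive degree with values in singular cochains are coboundaries. -/
lemma cech_row_exact (hfin : LocallyFinite fun a => f ⁻¹' U a) {p : ℕ}
    (x : ∀ σ : Fin (p + 2) ↪o ι, ((subspaceCochains R X).obj (op (A ∩ f ⁻¹' cechInter U σ))).X q)
    (hx : ∀ τ : Fin (p + 3) ↪o ι, ∑ j : Fin (p + 3), (-1 : ℤ) ^ (j : ℕ) •
      resCochain (cech_subset f U A τ j) q (x (cechFace τ j)) = 0) :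
    ∃ y : ∀ σ : Fin (p + 1) ↪o ι, ((subspaceCochains R X).obj (op (A ∩ f ⁻¹' cechInter U σ))).X q,
      ∀ σ : Fin (p + 2) ↪o ι, ∑ j : Fin (p + 2), (-1 : ℤ) ^ (j : ℕ) •
        resCochain (cech_subset f U A σ j) q (y (cechFace σ j)) = x σ := by
  obtain ⟨m, hm⟩ := exists_min_simplexIndices hfin q
  obtain ⟨y, hy⟩ : ∃ y : ∀ σ : Fin (p + 1) ↪o ι, ((subspaceCochains R X).obj
      (op (A ∩ f ⁻¹' cechInter U σ))).X q, ∀ σ, y σ = cochainOf _ q fun s => (m s).elim 0 fun b =>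
        coneHomotopy b (fun τ => evalAt _ s (x τ)) σ := ⟨_, fun _ => rfl⟩
  refine ⟨y, fun σ => cochain_ext fun s hs => ?_⟩
  rw [sum_evalAt y hs]
  obtain ⟨hA, hσ⟩ := forall_mem_cech_iff.1 hs
  obtain ⟨b, hb, hmb, hmin⟩ := hm s _ (hσ 0)
  rw [← sum_coneHomotopy hb hmin (fun τ => evalAt _ s (x τ)) (fun τ hτ => ?_) σ hσ]
  · refine Finset.sum_congr rfl fun j _ => ?_
    rw [hy, evalAt_cochainOf _ fun t => cech_subset f U A σ j (hs t), hmb]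
    rfl
  · have hs' := forall_mem_cech_iff.2 ⟨hA, hτ⟩
    rw [← sum_evalAt _ hs', hx, map_zero]

/-- A Čech `0`-cocycle with values in singular cochains is the restriction of a singular
cochain. -/
lemma cech_exists_glue (hfin : LocallyFinite fun a => f ⁻¹' U a)
    (x : ∀ σ : Fin 1 ↪o ι, ((subspaceCochains R X).obj (op (A ∩ f ⁻¹' cechInter U σ))).X q)
    (hx : ∀ τ : Fin 2 ↪o ι, ∑ j : Fin 2, (-1 : ℤ) ^ (j : ℕ) •
      resCochain (cech_subset f U A τ j) q (x (cechFace τ j)) = 0) :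
    ∃ y : ((subspaceCochains R X).obj (op A)).X q,
      ∀ σ : Fin 1 ↪o ι, resCochain Set.inter_subset_left q y = x σ := by
  obtain ⟨m, hm⟩ := exists_min_simplexIndices hfin q
  -- The value on `s` is read off on the member of smallest index containing `s`; the cocycle
  -- condition on the pair $(b,\sigma_0)$ shows that any other such member gives the same value.
  refine ⟨cochainOf _ q fun s => (m s).elim 0 fun b => evalAt _ s (x (singleEmb b)),
    fun σ => cochain_ext fun s hs => ?_⟩
  obtain ⟨hA, hσ⟩ := forall_mem_cech_iff.1 hs
  obtain ⟨b, hb, hmb, hmin⟩ := hm s _ (hσ 0)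
  rw [evalAt_res _ hs, evalAt_cochainOf _ hA, hmb]
  change evalAt _ s (x (singleEmb b)) = _
  rcases (hmin _ (hσ 0)).lt_or_eq with h | h
  · have hs' := (forall_mem_cech_iff (A := A) (σ := consEmb b σ h)).2
      ⟨hA, fun k => Fin.cases hb (fun k => hσ k) k⟩
    have e := sum_evalAt x hs'
    rw [hx, map_zero, Fin.sum_univ_two, cechFace_consEmb_zero] at e
    have e' : cechFace (consEmb b σ h) 1 = singleEmb b :=
      RelEmbedding.ext fun (l : Fin 1) => by rw [Subsingleton.elim l 0]; rfl
    rw [e'] at e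
    simp only [Fin.val_zero, pow_zero, one_smul, Fin.val_one, pow_one, neg_smul] at e
    exact (neg_add_eq_zero.1 ((add_comm _ _).trans e.symm))
  · have : singleEmb b = σ := RelEmbedding.ext fun (l : Fin 1) => by
      rw [Subsingleton.elim l 0]; exact h
    rw [this]

lemma cochainEquiv_eq_zero_of_small {x : ((subspaceCochains R X).obj (op A)).X q}
    (hx : ∀ σ : Fin 1 ↪o ι, resCochain
      (Set.inter_subset_left : A ∩ f ⁻¹' cechInter U σ ⊆ A) q x = 0)
    (s : C(Simp (q + 1), A)) (a : ι) (h : ∀ t, f (s t) ∈ U a) : cochainEquiv A q x s = 0 := by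
  have hs := (forall_mem_cech_iff (A := A) (f := f) (U := U) (σ := singleEmb a)
    (s := (valMap A).comp s)).2 ⟨fun t => (s t).2, fun _ => h⟩
  have h0 := evalAt_res Set.inter_subset_left hs x
  rw [hx, map_zero, evalAt_of_mem fun t => (s t).2] at h0
  exact h0.symm

/-- With `cochainEquiv_eq_zero_of_small`, this identifies the kernel of the augmentation with the
cochains vanishing on small simplices. -/
lemma res_eq_zero_of_small {x : ((subspaceCochains R X).obj (op A)).X q}
    (hx : ∀ (s : C(Simp (q + 1), A)) (a : ι), (∀ t, f (s t) ∈ U a) → cochainEquiv A q x s = 0)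
    (σ : Fin 1 ↪o ι) : resCochain
      (Set.inter_subset_left : A ∩ f ⁻¹' cechInter U σ ⊆ A) q x = 0 := by
  refine cochain_ext fun s hs => ?_
  obtain ⟨hA, hσ⟩ := forall_mem_cech_iff.1 hs
  rw [evalAt_res _ hs, map_zero, evalAt_of_mem hA]
  exact hx _ (σ 0) (hσ 0)

/-- A singular `0`-cochain which vanishes on the members of a cover is zero. -/
lemma cochain_eq_zero_of_small (hcover : ⋃ a, U a = Set.univ)
    {x : ((subspaceCochains R X).obj (op A)).X 0}
    (hx : ∀ σ : Fin 1 ↪o ι, resCochain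
      (Set.inter_subset_left : A ∩ f ⁻¹' cechInter U σ ⊆ A) 0 x = 0) : x = 0 := by
  refine (cochainEquiv A 0).injective (funext fun s => ?_)
  obtain ⟨a, ha⟩ := Set.mem_iUnion.1 (hcover.symm ▸ Set.mem_univ (f (s (stdSimplex.vertex 0))))
  rw [cochainEquiv_eq_zero_of_small hx s a fun t => ?_, map_zero]
  · rfl
  · have : t = stdSimplex.vertex (S := ℝ) (0 : Fin 1) := Subsingleton.elim _ _
    rwa [this]

/-- A singular cocycle which vanishes on the members of an open cover is the coboundary of such a
cochain. -/
lemma exists_d_eq_of_small (hU : ∀ a, IsOpen (U a)) (hcover : ⋃ a, U a = Set.univ)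
    {x : ((subspaceCochains R X).obj (op A)).X (q + 1)}
    (hd : (((subspaceCochains R X).obj (op A)).d (q + 1) (q + 1 + 1)).hom x = 0)
    (hx : ∀ σ : Fin 1 ↪o ι, resCochain
      (Set.inter_subset_left : A ∩ f ⁻¹' cechInter U σ ⊆ A) (q + 1) x = 0) :
    ∃ y : ((subspaceCochains R X).obj (op A)).X q,
      (((subspaceCochains R X).obj (op A)).d q (q + 1)).hom y = x ∧
        ∀ σ : Fin 1 ↪o ι, resCochain
          (Set.inter_subset_left : A ∩ f ⁻¹' cechInter U σ ⊆ A) q y = 0 := by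
  obtain ⟨ψ, hψ, hψ'⟩ := exists_coboundary_eq_of_vanishes_on_small
    (W := fun a => {z : A | f z ∈ U a})
    (fun a => (hU a).preimage (f.continuous.comp continuous_subtype_val))
    (fun z => by
      obtain ⟨a, ha⟩ := Set.mem_iUnion.1 (hcover.symm ▸ Set.mem_univ (f (z : X)))
      exact ⟨a, ha⟩)
    (cochainEquiv A (q + 1) x) (cochainEquiv_eq_zero_of_small hx) (by
      rw [← cochainEquiv_d, hd, map_zero])
  refine ⟨(cochainEquiv A q).symm ψ, (cochainEquiv A (q + 1)).injective ?_,
    res_eq_zero_of_small fun s a h => ?_⟩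
  · rw [cochainEquiv_d, LinearEquiv.apply_symm_apply, hψ']
  · rw [LinearEquiv.apply_symm_apply]
    exact hψ s a h

end Exactness

end SubspaceCochains

/-! ### Homogeneous components of graded modules -/

/-- A module whose elements are finite sums of components in `N i` is graded. -/
lemma isInternal_of_components {M : Type*} [AddCommGroup M] {N : ℤ → Type*}
    [∀ i, AddCommGroup (N i)] (comp : ∀ i, M →+ N i) (hinj : ∀ x, (∀ i, comp i x = 0) → x = 0)
    (hpiece : ∀ x i, ∃ y, comp i y = comp i x ∧ ∀ j, j ≠ i → comp j y = 0)
    (hsupp : ∀ x, ∃ s : Finset ℤ, ∀ i ∉ s, comp i x = 0) {gr : ℤ → AddSubgroup M}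
    (hgr : ∀ i x, x ∈ gr i ↔ ∀ j, j ≠ i → comp j x = 0) : DirectSum.IsInternal gr := by
  have hsum (s : Finset ℤ) (g : ℤ → M) (hg : ∀ i, g i ∈ gr i) (j : ℤ) :
      comp j (∑ i ∈ s, g i) = if j ∈ s then comp j (g j) else 0 := by
    rw [map_sum]
    split_ifs with hj
    · exact Finset.sum_eq_single_of_mem j hj fun i _ hi => (hgr i _).1 (hg i) j hi.symm
    · exact Finset.sum_eq_zero fun i hi =>
        (hgr i _).1 (hg i) j fun h => hj (h ▸ hi)
  refine isInternal_of_sum (fun x => ?_) fun s g hg h0 i hi => ?_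
  · choose y hy hy' using hpiece x
    obtain ⟨s, hs⟩ := hsupp x
    have hyg (i : ℤ) : y i ∈ gr i := (hgr i _).2 (hy' i)
    refine ⟨s, y, hyg, sub_eq_zero.1 (hinj _ fun j => ?_)⟩
    rw [map_sub, hsum s y hyg]
    split_ifs with hj
    · rw [hy, sub_self]
    · rw [hs j hj, sub_zero]
  · refine hinj _ fun j => ?_
    by_cases hj : j = i
    · subst hj
      have := hsum s g hg j
      rw [h0, map_zero, if_pos hi] at this
      exact this.symm
    · exact (hgr i _).1 (hg i) j hj

/-- A subgroup of an `R[t]`-module which is stable under `R` and `t` is a submodule. -/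
def submoduleOfStable {R : Type v} [CommRing R] {M : Type*} [AddCommGroup M] [Module R[X] M]
    (N : AddSubgroup M) (hC : ∀ (a : R) (m : M), m ∈ N → (C a : R[X]) • m ∈ N)
    (hX : ∀ m ∈ N, (X : R[X]) • m ∈ N) : Submodule R[X] M :=
  { N with
    smul_mem' := by
      intro P
      induction P using Polynomial.induction_on with
      | C a => exact fun {m} hm => hC a m hm
      | add P Q hP hQ => intro m hm; rw [add_smul]; exact N.add_mem (hP hm) (hQ hm)
      | monomial n a ih =>
        intro m hm
        rw [pow_succ, ← mul_assoc, mul_smul]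
        exact ih (hX m hm) }

/-! ### Degree components of $\alpha(M)$ -/

section Alpha

variable {R : Type v} [CommRing R] {M M' : PersistenceModule.{v, w} R}

lemma Alpha.exists_support (m : Alpha M) : ∃ s : Finset ℤ, ∀ i ∉ s, Alpha.component M i m = 0 := by
  classical
  exact ⟨DFinsupp.support ((Alpha.of M).symm m), fun i hi => DFinsupp.notMem_support_iff.1 hi⟩

lemma Alpha.exists_components (s : Finset ℤ) (y : ∀ i, M.obj i) (hy : ∀ i ∉ s, y i = 0) :
    ∃ m : Alpha M, ∀ i, Alpha.component M i m = y i := by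
  refine ⟨Alpha.of M (DFinsupp.mk s fun i => y i), fun i => ?_⟩
  change (DFinsupp.mk s (fun i => y i) : ⨁ i, M.obj i) i = y i
  by_cases hi : i ∈ s
  · exact DFinsupp.mk_of_mem hi
  · exact (DFinsupp.mk_of_notMem hi).trans (hy i hi).symm

lemma Alpha.mem_grading_iff {i : ℤ} {m : Alpha M} :
    m ∈ Alpha.grading M i ↔ ∀ j, j ≠ i → Alpha.component M j m = 0 := by
  constructor
  · rintro ⟨x, rfl⟩ j hj
    exact DirectSum.of_eq_of_ne _ _ _ hj
  · intro h
    refine ⟨Alpha.component M i m, Alpha.ext fun j => ?_⟩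
    by_cases hj : j = i
    · subst hj
      exact DirectSum.of_eq_same (β := fun i => M.obj i) _ _
    · rw [h j hj]
      exact DirectSum.of_eq_of_ne _ _ _ hj

lemma Alpha.isInternal_grading (M : PersistenceModule.{v, w} R) :
    DirectSum.IsInternal (Alpha.grading M) := by
  classical
  refine isInternal_of_components (fun i => (Alpha.component M i).toAddMonoidHom)
    (fun x h => Alpha.ext fun i => (h i).trans (map_zero _).symm) (fun x i => ?_)
    Alpha.exists_support fun i x => Alpha.mem_grading_iff
  obtain ⟨m, hm⟩ := Alpha.exists_components (M := M) {i}
    (fun j => if j = i then Alpha.component M j x else 0)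
    (fun j hj => if_neg (by simpa using hj))
  exact ⟨m, (hm i).trans (if_pos rfl), fun j hj => (hm j).trans (if_neg hj)⟩

lemma Alpha.map_mem_grading (g : M ⟶ M') {i : ℤ} {m : Alpha M} (hm : m ∈ Alpha.grading M i) :
    Alpha.map g m ∈ Alpha.grading M' i :=
  Alpha.mem_grading_iff.2 fun j hj => by
    rw [Alpha.component_map, Alpha.mem_grading_iff.1 hm j hj, map_zero]

lemma Alpha.component_C_smul (a : R) (m : Alpha M) (i : ℤ) :
    Alpha.component M i ((C a : R[X]) • m) = a • Alpha.component M i m := by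
  rw [Alpha.C_smul, map_smul]

end Alpha

/-! ### Degree components of Čech cochains and of the maps between them -/

section CechComponents

variable {R : Type v} [CommRing R] {Y : Type*} {ι : Type*} [LinearOrder ι] {U : ι → Set Y}
  {F F' F'' : (Set Y)ᵒᵖ ⥤ PersistenceModule.{v, w} R} {p p' : ℕ}

/-- The components of degree `i` of a Čech cochain. -/
def cechComponent (i : ℤ) : cechCochains U F p →+
    (∀ σ : Fin (p + 1) ↪o ι, (F.obj (op (cechInter U σ))).obj i) where
  toFun c σ := Alpha.component _ i (c.1 σ)
  map_zero' := funext fun _ => map_zero _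
  map_add' _ _ := funext fun _ => map_add _ _ _

lemma cechComponent_apply (i : ℤ) (c : cechCochains U F p) (σ : Fin (p + 1) ↪o ι) :
    cechComponent i c σ = Alpha.component _ i (c.1 σ) := rfl

lemma cech_ext {c c' : cechCochains U F p}
    (h : ∀ i σ, cechComponent i c σ = cechComponent i c' σ) : c = c' :=
  Subtype.ext (funext fun σ => Alpha.ext fun i => h i σ)

lemma cech_exists_support (c : cechCochains U F p) :
    ∃ s : Finset ℤ, ∀ i ∉ s, cechComponent i c = 0 := by
  obtain ⟨s, hs⟩ := c.2
  exact ⟨s, fun i hi => funext fun σ => hs σ i hi⟩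

lemma cech_exists_components (s : Finset ℤ)
    (y : ∀ i, ∀ σ : Fin (p + 1) ↪o ι, (F.obj (op (cechInter U σ))).obj i)
    (hy : ∀ i ∉ s, y i = 0) : ∃ c : cechCochains U F p, ∀ i, cechComponent i c = y i := by
  choose m hm using fun σ => Alpha.exists_components (M := F.obj (op (cechInter U σ))) s
    (fun i => y i σ) fun i hi => congrFun (hy i hi) σ
  refine ⟨⟨m, s, fun σ i hi => ?_⟩, fun i => funext fun σ => hm σ i⟩
  rw [hm, hy i hi]
  rfl

/-- Čech cochains can be chosen degree by degree. -/
lemma cech_exists_of_forall (s : Finset ℤ)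
    (P : ∀ i, (∀ σ : Fin (p + 1) ↪o ι, (F.obj (op (cechInter U σ))).obj i) → Prop)
    (h0 : ∀ i ∉ s, P i 0) (h : ∀ i, ∃ y, P i y) :
    ∃ c : cechCochains U F p, ∀ i, P i (cechComponent i c) := by
  classical
  choose y hy using h
  obtain ⟨c, hc⟩ := cech_exists_components (U := U) (F := F) (p := p) s
    (fun i => if i ∈ s then y i else 0) (fun i hi => if_neg hi)
  refine ⟨c, fun i => ?_⟩
  rw [hc]
  split_ifs with hi
  · exact hy i
  · exact h0 i hi

/-- A choice in each degree need not have finite support, so `0` is taken outside `s`, where `h0`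
allows it. -/
lemma Alpha.exists_of_forall {M : PersistenceModule.{v, w} R} (s : Finset ℤ)
    (P : ∀ i, M.obj i → Prop) (h0 : ∀ i ∉ s, P i 0) (h : ∀ i, ∃ y, P i y) :
    ∃ m : Alpha M, ∀ i, P i (Alpha.component M i m) := by
  classical
  choose y hy using h
  obtain ⟨c, hc⟩ := Alpha.exists_components (M := M) s
    (fun i => if i ∈ s then y i else 0) (fun i hi => if_neg hi)
  refine ⟨c, fun i => ?_⟩
  rw [hc]
  split_ifs with hi
  · exact hy i
  · exact h0 i hi

variable (U F) in
/-- The grading of the Čech cochains. -/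
def cochainGrading (p : ℕ) (i : ℤ) : AddSubgroup (cechCochains U F p) := cechGrading U F p i

lemma mem_cochainGrading_iff {i : ℤ} {c : cechCochains U F p} :
    c ∈ cochainGrading U F p i ↔ ∀ j, j ≠ i → cechComponent j c = 0 := by
  have : c ∈ cochainGrading U F p i ↔
      ∀ σ, σ ∈ Set.univ → c.1 σ ∈ Alpha.grading (F.obj (op (cechInter U σ))) i := Iff.rfl
  rw [this]
  constructor
  · exact fun h j hj => funext fun σ => Alpha.mem_grading_iff.1 (h σ trivial) j hj
  · exact fun h σ _ => Alpha.mem_grading_iff.2 fun j hj => congrFun (h j hj) σ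

lemma cechComponent_X_smul (c : cechCochains U F p) (j : ℤ) (σ : Fin (p + 1) ↪o ι) :
    cechComponent (j + 1) ((X : R[X]) • c) σ =
      ((F.obj (op (cechInter U σ))).map (homOfLE (Int.le_add_one le_rfl) : j ⟶ j + 1)).hom
        (cechComponent j c σ) :=
  Alpha.component_X_smul _ _ j

lemma cechComponent_C_smul (a : R) (c : cechCochains U F p) (i : ℤ) (σ : Fin (p + 1) ↪o ι) :
    cechComponent i ((C a : R[X]) • c) σ = a • cechComponent i c σ :=
  Alpha.component_C_smul _ _ i

variable (U F p) in
lemma isGrading_cochainGrading : IsGrading (R := R) (cochainGrading U F p) where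
  isInternal := by
    classical
    refine isInternal_of_components cechComponent
      (fun x h => cech_ext fun i σ => congrFun (h i) σ) (fun x i => ?_)
      cech_exists_support fun i x => mem_cochainGrading_iff
    obtain ⟨m, hm⟩ := cech_exists_components (U := U) (F := F) (p := p) {i}
      (fun j => if j = i then cechComponent j x else 0)
      (fun j hj => if_neg (by simpa using hj))
    exact ⟨m, (hm i).trans (if_pos rfl), fun j hj => (hm j).trans (if_neg hj)⟩
  C_smul_mem a i c hc := mem_cochainGrading_iff.2 fun j hj => funext fun σ => by
    rw [cechComponent_C_smul, mem_cochainGrading_iff.1 hc j hj]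
    exact smul_zero _
  X_smul_mem i c hc := mem_cochainGrading_iff.2 fun j hj => funext fun σ => by
    obtain ⟨j, rfl⟩ : ∃ k, j = k + 1 := ⟨j - 1, by ring⟩
    rw [cechComponent_X_smul, mem_cochainGrading_iff.1 hc j (by lia)]
    exact map_zero _

lemma cechComponent_cechDelta (c : cechCochains U F p) (i : ℤ) (σ : Fin (p + 2) ↪o ι) :
    cechComponent i (cechDelta U F p c) σ = ∑ j : Fin (p + 2), (-1 : ℤ) ^ (j : ℕ) •
      ((F.map (homOfLE (cechInter_subset U σ j)).op).app i).hom
        (cechComponent i c (cechFace σ j)) := by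
  rw [cechComponent_apply, cechDelta_apply, map_sum]
  refine Finset.sum_congr rfl fun j _ => ?_
  rw [map_zsmul]
  rfl

lemma cechDelta_mem_cochainGrading {i : ℤ} {c : cechCochains U F p}
    (hc : c ∈ cochainGrading U F p i) : cechDelta U F p c ∈ cochainGrading U F (p + 1) i :=
  mem_cochainGrading_iff.2 fun j hj => funext fun σ => by
    rw [cechComponent_cechDelta, mem_cochainGrading_iff.1 hc j hj]
    exact Finset.sum_eq_zero fun k _ =>
      (congrArg _ (map_zero _)).trans (smul_zero _)

variable (U) in
/-- The map of Čech cochains induced by a morphism of presheaves. -/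
def cechMap (g : F ⟶ F') (p : ℕ) : cechCochains U F p →ₗ[R[X]] cechCochains U F' p :=
  LinearMap.codRestrict _
    (LinearMap.pi fun σ => Alpha.map (g.app (op (cechInter U σ))) ∘ₗ LinearMap.proj σ ∘ₗ
      (cechCochains U F p).subtype)
    (by
      rintro ⟨c, S, hS⟩
      refine ⟨S, fun σ i hi => ?_⟩
      exact (Alpha.component_map _ _ i).trans ((congrArg _ (hS σ i hi)).trans (map_zero _)))

lemma cechComponent_cechMap (g : F ⟶ F') (c : cechCochains U F p) (i : ℤ) (σ : Fin (p + 1) ↪o ι) :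
    cechComponent i (cechMap U g p c) σ =
      ((g.app (op (cechInter U σ))).app i).hom (cechComponent i c σ) := rfl

lemma cechMap_mem_cochainGrading (g : F ⟶ F') {i : ℤ} {c : cechCochains U F p}
    (hc : c ∈ cochainGrading U F p i) : cechMap U g p c ∈ cochainGrading U F' p i :=
  mem_cochainGrading_iff.2 fun j hj => funext fun σ => by
    rw [cechComponent_cechMap, mem_cochainGrading_iff.1 hc j hj]
    exact map_zero _

lemma cechDelta_cechMap (g : F ⟶ F') (c : cechCochains U F p) :
    cechDelta U F' p (cechMap U g p c) = cechMap U g (p + 1) (cechDelta U F p c) := by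
  refine cech_ext fun i σ => ?_
  rw [cechComponent_cechDelta, cechComponent_cechMap, cechComponent_cechDelta, map_sum]
  refine Finset.sum_congr rfl fun j _ => ?_
  rw [map_zsmul, cechComponent_cechMap]
  congr 1
  exact congrArg (fun h => (h.app i).hom (cechComponent i c (cechFace σ j)))
    (g.naturality (homOfLE (cechInter_subset U σ j)).op).symm

end CechComponents

/-! ### Cohomology of complexes of graded modules, degree by degree -/

section Components

variable {R : Type v} [CommRing R] {Λ : Type*}

/-- The elements of the graded `R[t]`-module `M` are the families, indexed by `Λ`, of elements of
`N i a` which vanish for almost all degrees `i`, and `t` acts by `φ`. -/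
structure HasComponents {M : Type*} [AddCommGroup M] [Module R[X] M]
    (N : ℤ → Λ → ModuleCat.{w} R) (φ : ∀ i a, N i a ⟶ N (i + 1) a) (gr : ℤ → AddSubgroup M)
    (comp : ∀ i, M →+ ∀ a, N i a) : Prop where
  eq_zero (x : M) : (∀ i, comp i x = 0) → x = 0
  exists_support (x : M) : ∃ s : Finset ℤ, ∀ i ∉ s, comp i x = 0
  exists_of_forall (s : Finset ℤ) (P : ∀ i, (∀ a, N i a) → Prop) (h0 : ∀ i ∉ s, P i 0)
    (h : ∀ i, ∃ y, P i y) : ∃ x, ∀ i, P i (comp i x)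
  C_smul (r : R) (x : M) (i : ℤ) (a : Λ) : comp i ((C r : R[X]) • x) a = r • comp i x a
  X_smul (x : M) (i : ℤ) (a : Λ) : comp (i + 1) ((X : R[X]) • x) a = (φ i a).hom (comp i x a)
  mem_gr (i : ℤ) (x : M) : x ∈ gr i ↔ ∀ j, j ≠ i → comp j x = 0

variable {L : ℤ → Λ → CochainComplex (ModuleCat.{w} R) ℕ} {Φ : ∀ i a, L i a ⟶ L (i + 1) a} {q : ℕ}
  {Q Q' H : Type*} [AddCommGroup Q] [Module R[X] Q] [AddCommGroup Q'] [Module R[X] Q']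
  [AddCommGroup H] [Module R[X] H] {grQ : ℤ → AddSubgroup Q} {grQ' : ℤ → AddSubgroup Q'}
  {grH : ℤ → AddSubgroup H} {cQ : ∀ i, Q →+ ∀ a, (L i a).X q}
  {cQ' : ∀ i, Q' →+ ∀ a, (L i a).X (q + 1)} {cH : ∀ i, H →+ ∀ a, (L i a).homology q}

/-- The relation between cocycles and cohomology classes whose components correspond. -/
def componentRel
    (hQ : HasComponents (fun i a => (L i a).X q) (fun i a => (Φ i a).f q) grQ cQ)
    (hH : HasComponents (fun i a => (L i a).homology q)
      (fun i a => HomologicalComplex.homologyMap (Φ i a) q) grH cH) :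
    Submodule R[X] (Q × H) :=
  submoduleOfStable
    { carrier := {x | ∀ i a, IsClass (L i a) q (cQ i x.1 a) (cH i x.2 a)}
      zero_mem' := fun i a => by
        simp only [Prod.fst_zero, Prod.snd_zero, map_zero]
        exact IsClass.zero q
      add_mem' := fun {x y} hx hy i a => by
        simp only [Prod.fst_add, Prod.snd_add, map_add]
        exact (hx i a).add (hy i a)
      neg_mem' := fun {x} hx i a => by
        have := (hx i a).zsmul (-1)
        rw [neg_one_zsmul, neg_one_zsmul] at this
        simp only [Prod.fst_neg, Prod.snd_neg, map_neg]
        exact this }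
    (fun r x hx i a => by
      have := (hx i a).smul r
      rw [← hQ.C_smul, ← hH.C_smul] at this
      exact this)
    -- Stability under $t$: the degree $k+1$ component of $tx$ is the image of the degree $k$
    -- component under a chain map, and chain maps respect classes.
    (fun x hx i a => by
      obtain ⟨i, rfl⟩ : ∃ k, i = k + 1 := ⟨i - 1, by ring⟩
      have := (hx i a).map (Φ i a)
      have h₁ := hQ.X_smul x.1 i a
      have h₂ := hH.X_smul x.2 i a
      rw [← h₁, ← h₂] at this
      exact this)

lemma mem_componentRel
    {hQ : HasComponents (fun i a => (L i a).X q) (fun i a => (Φ i a).f q) grQ cQ}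
    {hH : HasComponents (fun i a => (L i a).homology q)
      (fun i a => HomologicalComplex.homologyMap (Φ i a) q) grH cH} {z : Q} {c : H} :
    (z, c) ∈ componentRel hQ hH ↔ ∀ i a, IsClass (L i a) q (cQ i z a) (cH i c a) := Iff.rfl

/-- Cohomology commutes with the graded product: products are exact, and finite support lets
cocycles and classes be matched degree by degree. It serves both for Čech cochains, indexed by `σ`,
and for $\alpha(M)$, indexed by a point. -/
lemma isCohomologyRel_componentRel
    (hQ : HasComponents (fun i a => (L i a).X q) (fun i a => (Φ i a).f q) grQ cQ)
    (hQ' : HasComponents (fun i a => (L i a).X (q + 1)) (fun i a => (Φ i a).f (q + 1)) grQ' cQ')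
    (hH : HasComponents (fun i a => (L i a).homology q)
      (fun i a => HomologicalComplex.homologyMap (Φ i a) q) grH cH)
    {d : Q →ₗ[R[X]] Q'} {Bd : Submodule R[X] Q}
    (hd : ∀ z i a, cQ' i (d z) a = ((L i a).d q (q + 1)).hom (cQ i z a))
    (hBd : ∀ z, z ∈ Bd ↔ ∀ i a, ∃ j x, ((L i a).d j q).hom x = cQ i z a) :
    IsCohomologyRel d Bd grQ grH (componentRel hQ hH) := by
  -- The second clause forces the representative to vanish wherever the class does, so that
  -- homogeneous classes get homogeneous representatives.
  have hrep (c : H) : ∃ z, ∀ i, (∀ a, IsClass (L i a) q (cQ i z a) (cH i c a)) ∧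
      (cH i c = 0 → cQ i z = 0) := by
    obtain ⟨s, hs⟩ := hH.exists_support c
    refine hQ.exists_of_forall s (fun i y => (∀ a, IsClass (L i a) q (y a) (cH i c a)) ∧
      (cH i c = 0 → y = 0)) (fun i hi => ⟨fun a => ?_, fun _ => rfl⟩) fun i => ?_
    · rw [hs i hi]
      exact IsClass.zero q
    · by_cases h : cH i c = 0
      · refine ⟨0, fun a => ?_, fun _ => rfl⟩
        rw [h]
        exact IsClass.zero q
      · choose y hy using fun a => exists_isClass' (cH i c a)
        exact ⟨y, hy, fun h' => absurd h' h⟩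
  refine ⟨fun {z} hz => ?_, fun c => ?_, fun {z c} hzc => ?_, fun {z} => ?_, fun {c} hc => ?_,
    fun {z c i} hzc hz => ?_, fun {c i} hc => ?_⟩
  · obtain ⟨s, hs⟩ := hQ.exists_support z
    obtain ⟨c, hc⟩ := hH.exists_of_forall s (fun i y => ∀ a, IsClass (L i a) q (cQ i z a) (y a))
      (fun i hi a => by
        rw [hs i hi]
        exact IsClass.zero q)
      (fun i => by
        have (a : Λ) : ∃ h, IsClass (L i a) q (cQ i z a) h := by
          refine exists_isClass fun l => ?_
          by_cases hl : q + 1 = l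
          · subst hl
            rw [← hd, hz, map_zero]
            rfl
          · rw [(L i a).shape q l (by simpa using hl)]
            rfl
        choose y hy using this
        exact ⟨y, hy⟩)
    exact ⟨c, hc⟩
  · obtain ⟨z, hz⟩ := hrep c
    exact ⟨z, fun i => (hz i).1⟩
  · refine hQ'.eq_zero _ fun i => funext fun a => ?_
    rw [hd]
    exact (hzc i a).d_eq_zero (q + 1)
  · rw [hBd, mem_componentRel]
    refine forall_congr' fun i => forall_congr' fun a => ?_
    rw [map_zero]
    exact isClass_zero_iff
  · refine hH.eq_zero _ fun i => funext fun a => ?_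
    have := hc i a
    simp only [map_zero] at this
    exact this.eq_zero
  · refine (hH.mem_gr i c).2 fun j hj => funext fun a => ?_
    have := hzc j a
    simp only [(hQ.mem_gr i z).1 hz j hj] at this
    exact this.eq_zero
  · obtain ⟨z, hz⟩ := hrep c
    exact ⟨z, (hQ.mem_gr i z).2 fun j hj => (hz j).2 ((hH.mem_gr i c).1 hc j hj),
      fun i => (hz i).1⟩

lemma mem_bot_iff_components {cQ : ∀ i, Q →+ ∀ a, (L i a).X 0}
    (hQ : HasComponents (fun i a => (L i a).X 0) (fun i a => (Φ i a).f 0) grQ cQ) (z : Q) :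
    z ∈ (⊥ : Submodule R[X] Q) ↔ ∀ i a, ∃ j x, ((L i a).d j 0).hom x = cQ i z a := by
  rw [Submodule.mem_bot]
  constructor
  · rintro rfl i a
    refine ⟨0, 0, ?_⟩
    rw [map_zero, map_zero]
    rfl
  · intro h
    refine hQ.eq_zero _ fun i => funext fun a => ?_
    obtain ⟨j, x, hx⟩ := h i a
    rw [← hx, (L i a).shape j 0 (by simp)]
    rfl

lemma mem_range_iff_components
    (hQ : HasComponents (fun i a => (L i a).X q) (fun i a => (Φ i a).f q) grQ cQ)
    (hQ' : HasComponents (fun i a => (L i a).X (q + 1)) (fun i a => (Φ i a).f (q + 1)) grQ' cQ')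
    {d : Q →ₗ[R[X]] Q'} (hd : ∀ z i a, cQ' i (d z) a = ((L i a).d q (q + 1)).hom (cQ i z a))
    (z : Q') : z ∈ LinearMap.range d ↔
      ∀ i a, ∃ j x, ((L i a).d j (q + 1)).hom x = cQ' i z a := by
  constructor
  · rintro ⟨y, rfl⟩ i a
    exact ⟨q, cQ i y a, (hd y i a).symm⟩
  · intro h
    have h' (i : ℤ) (a : Λ) : ∃ x, ((L i a).d q (q + 1)).hom x = cQ' i z a := by
      obtain ⟨j, x, hx⟩ := h i a
      by_cases hj : j = q
      · subst hj
        exact ⟨x, hx⟩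
      · refine ⟨0, ?_⟩
        rw [← hx, (L i a).shape j (q + 1) (by simpa using hj), map_zero]
        rfl
    obtain ⟨s, hs⟩ := hQ'.exists_support z
    obtain ⟨y, hy⟩ := hQ.exists_of_forall s
      (fun i y => ∀ a, ((L i a).d q (q + 1)).hom (y a) = cQ' i z a)
      (fun i hi a => by
        rw [hs i hi]
        exact map_zero _)
      (fun i => by
        choose y hy using h' i
        exact ⟨y, hy⟩)
    refine ⟨y, sub_eq_zero.1 (hQ'.eq_zero _ fun i => funext fun a => ?_)⟩
    rw [map_sub, Pi.sub_apply, hd, hy, sub_self]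
    rfl

end Components

/-! ### The components of `α(M)` and of Čech cochains -/

section

variable {R : Type v} [CommRing R]

/-- The components of an element of `α(M)`, as families indexed by a point. -/
def Alpha.components (M : PersistenceModule.{v, w} R) (i : ℤ) : Alpha M →+ (Unit → M.obj i) where
  toFun m _ := Alpha.component M i m
  map_zero' := funext fun _ => map_zero _
  map_add' _ _ := funext fun _ => map_add _ _ _

lemma Alpha.hasComponents (M : PersistenceModule.{v, w} R) :
    HasComponents (fun i (_ : Unit) => M.obj i)
      (fun i _ => M.map (homOfLE (Int.le_add_one le_rfl) : i ⟶ i + 1)) (Alpha.grading M)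
      (Alpha.components M) where
  eq_zero x h := Alpha.ext fun i => (congrFun (h i) ()).trans (map_zero _).symm
  exists_support x := by
    obtain ⟨s, hs⟩ := Alpha.exists_support x
    exact ⟨s, fun i hi => funext fun _ => hs i hi⟩
  exists_of_forall s P h0 h :=
    Alpha.exists_of_forall s (fun i y => P i fun _ => y) h0 fun i => by
      obtain ⟨y, hy⟩ := h i
      exact ⟨y (), hy⟩
  C_smul r x i _ := Alpha.component_C_smul r x i
  X_smul x i _ := Alpha.component_X_smul M x i
  mem_gr i x := Alpha.mem_grading_iff.trans
    (forall_congr' fun _ => forall_congr' fun _ =>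
      ⟨fun h => funext fun _ => h, fun h => congrFun h ()⟩)

lemma cech_hasComponents {Y : Type*} {ι : Type*} [LinearOrder ι] (U : ι → Set Y)
    (F : (Set Y)ᵒᵖ ⥤ PersistenceModule.{v, w} R) (p : ℕ) :
    HasComponents (fun i (σ : Fin (p + 1) ↪o ι) => (F.obj (op (cechInter U σ))).obj i)
      (fun i σ => (F.obj (op (cechInter U σ))).map (homOfLE (Int.le_add_one le_rfl) : i ⟶ i + 1))
      (cochainGrading U F p) cechComponent where
  eq_zero _ h := cech_ext fun i σ => (congrFun (h i) σ).trans
    (congrFun (map_zero (cechComponent i)) σ).symm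
  exists_support := cech_exists_support
  exists_of_forall := cech_exists_of_forall
  C_smul := cechComponent_C_smul
  X_smul := cechComponent_X_smul
  mem_gr _ _ := mem_cochainGrading_iff

end

/-! ### The double complex of Čech cochains with values in singular cochains -/

section Presheaf

variable (R : Type v) [CommRing R] {X : Type u} [TopologicalSpace X] {Y : Type*}

/-- The persistence module `i ↦ S^q(L_i; R)` of singular cochains. -/
def persistentCochains (L : ℕ → Set X) (hL : Antitone L) (q : ℕ) :
    PersistenceModule.{v, max u v} R where
  obj i := ((subspaceCochains R X).obj (op (L i.toNat))).X q
  map h := ((subspaceCochains R X).map (homOfLE (hL (Int.toNat_le_toNat (leOfHom h)))).op).f q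
  map_id _ := (subspaceCochains R X ⋙ HomologicalComplex.eval _ _ q).map_id _
  map_comp _ _ := (subspaceCochains R X ⋙ HomologicalComplex.eval _ _ q).map_comp _ _

/-- The coboundary of singular cochains as a morphism of persistence modules. -/
def persistentCochainsD (L : ℕ → Set X) (hL : Antitone L) (q : ℕ) :
    persistentCochains R L hL q ⟶ persistentCochains R L hL (q + 1) where
  app i := ((subspaceCochains R X).obj (op (L i.toNat))).d q (q + 1)
  naturality _ _ h := ((subspaceCochains R X).map
    (homOfLE (hL (Int.toNat_le_toNat (leOfHom h)))).op).comm q (q + 1)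

/-- The restriction of singular cochains as a morphism of persistence modules. -/
def persistentCochainsRes {L L' : ℕ → Set X} (hL : Antitone L) (hL' : Antitone L')
    (h : ∀ i, L' i ⊆ L i) (q : ℕ) :
    persistentCochains R L hL q ⟶ persistentCochains R L' hL' q where
  app i := ((subspaceCochains R X).map (homOfLE (h i.toNat)).op).f q
  naturality _ _ _ := by
    dsimp only [persistentCochains]
    rw [← HomologicalComplex.comp_f, ← HomologicalComplex.comp_f,
      ← (subspaceCochains R X).map_comp, ← (subspaceCochains R X).map_comp]
    rfl

variable (f : X → Y) (K : ℕ → Set X) (hK : Antitone K)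

/-- The presheaf of persistence modules `V ↦ (i ↦ S^q(K_i ∩ f⁻¹ V; R))` on `Y`. -/
def cochainPresheaf (q : ℕ) : (Set Y)ᵒᵖ ⥤ PersistenceModule.{v, max u v} R where
  obj V := persistentCochains R (fun i => K i ∩ f ⁻¹' V.unop)
    (fun _ _ h => Set.inter_subset_inter_left _ (hK h)) q
  map h := persistentCochainsRes R _ _ (fun i => Set.inter_subset_inter_right (K i)
    (Set.preimage_mono (f := f) (leOfHom h.unop))) q
  map_id _ := by
    ext1; funext i
    exact (subspaceCochains R X ⋙ HomologicalComplex.eval _ _ q).map_id _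
  map_comp _ _ := by
    ext1; funext i
    exact (subspaceCochains R X ⋙ HomologicalComplex.eval _ _ q).map_comp _ _

/-- The coboundary of singular cochains as a morphism of presheaves. -/
def cochainPresheafD (q : ℕ) : cochainPresheaf R f K hK q ⟶ cochainPresheaf R f K hK (q + 1) where
  app V := persistentCochainsD R (fun i => K i ∩ f ⁻¹' V.unop)
    (fun _ _ h => Set.inter_subset_inter_left _ (hK h)) q
  naturality _ _ h := by
    ext1; funext i
    exact ((subspaceCochains R X).map (homOfLE (Set.inter_subset_inter_right (K i.toNat)
      (Set.preimage_mono (f := f) (leOfHom h.unop)))).op).comm q (q + 1)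

variable {ι : Type w} [LinearOrder ι] (U : ι → Set Y)

/-- The double complex of Čech cochains with values in singular cochains. -/
def cechDoubleComplex :
    DoubleComplex R (fun p q => cechCochains U (cochainPresheaf R f K hK q) p) where
  dh p q := cechDelta U (cochainPresheaf R f K hK q) p
  dv p q := cechMap U (cochainPresheafD R f K hK q) p
  dh_dh p q := cechDelta_cechDelta U (cochainPresheaf R f K hK q) p
  dv_dv p q c := cech_ext fun i σ => by
    rw [map_zero]
    exact LinearMap.congr_fun (congrArg ModuleCat.Hom.hom (((subspaceCochains R X).obj
      (op (K i.toNat ∩ f ⁻¹' cechInter U σ))).d_comp_d q (q + 1) (q + 1 + 1)))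
      (cechComponent i c σ)
  dh_dv p q := cechDelta_cechMap (cochainPresheafD R f K hK q)
  gr p q := cochainGrading U (cochainPresheaf R f K hK q) p
  isGrading p q := isGrading_cochainGrading U (cochainPresheaf R f K hK q) p
  dh_gr _ _ _ _ hx := cechDelta_mem_cochainGrading hx
  dv_gr _ _ _ _ hx := cechMap_mem_cochainGrading _ hx

/-- The relation between Čech cochains with values in singular cocycles and Čech cochains with
values in singular cohomology. -/
def cechClassRel (p q : ℕ) : Submodule R[X]
    (cechCochains U (cochainPresheaf R f K hK q) p ×
      (cechComplex U (persistentCohomologyPresheaf R f K hK q)).X p) :=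
  componentRel
    (L := fun i σ => (subspaceCochains R X).obj (op (K i.toNat ∩ f ⁻¹' cechInter U σ)))
    (Φ := fun _ _ => (subspaceCochains R X).map (homOfLE (Set.inter_subset_inter_left _
      (hK (Int.toNat_le_toNat (Int.le_add_one le_rfl))))).op)
    (cech_hasComponents U (cochainPresheaf R f K hK q) p)
    (cech_hasComponents U (persistentCohomologyPresheaf R f K hK q) p)

/-- The first page: the cohomology of column $p$ is $C^p(\mathcal U,PH^q)$. -/
lemma isCohomologyRel_cechClassRel (p q : ℕ) :
    IsCohomologyRel ((cechDoubleComplex R f K hK U).dv p q)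
      ((cechDoubleComplex R f K hK U).vBoundaries p q) ((cechDoubleComplex R f K hK U).gr p q)
      (cechGrading U (persistentCohomologyPresheaf R f K hK q) p)
      (cechClassRel R f K hK U p q) := by
  refine isCohomologyRel_componentRel
    (cech_hasComponents U (cochainPresheaf R f K hK q) p)
    (cech_hasComponents U (cochainPresheaf R f K hK (q + 1)) p)
    (cech_hasComponents U (persistentCohomologyPresheaf R f K hK q) p) (fun z i σ => rfl) ?_
  cases q with
  | zero =>
    exact mem_bot_iff_components
      (L := fun i σ => (subspaceCochains R X).obj (op (K i.toNat ∩ f ⁻¹' cechInter U σ)))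
      (Φ := fun _ _ => (subspaceCochains R X).map (homOfLE (Set.inter_subset_inter_left _
        (hK (Int.toNat_le_toNat (Int.le_add_one le_rfl))))).op)
      (cech_hasComponents U (cochainPresheaf R f K hK 0) p)
  | succ q =>
    exact mem_range_iff_components
      (L := fun i σ => (subspaceCochains R X).obj (op (K i.toNat ∩ f ⁻¹' cechInter U σ)))
      (Φ := fun _ _ => (subspaceCochains R X).map (homOfLE (Set.inter_subset_inter_left _
        (hK (Int.toNat_le_toNat (Int.le_add_one le_rfl))))).op)
      (cech_hasComponents U (cochainPresheaf R f K hK q) p)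
      (cech_hasComponents U (cochainPresheaf R f K hK (q + 1)) p) (fun z i σ => rfl)

/-- Restriction in cohomology is induced by restriction of cochains, so the horizontal differential
induces the Čech differential on classes. -/
lemma cechClassRel_cechDelta (p q : ℕ) (z : cechCochains U (cochainPresheaf R f K hK q) p)
    (c : (cechComplex U (persistentCohomologyPresheaf R f K hK q)).X p)
    (h : (z, c) ∈ cechClassRel R f K hK U p q) :
    (cechDelta U (cochainPresheaf R f K hK q) p z,
      ((cechComplex U (persistentCohomologyPresheaf R f K hK q)).d p (p + 1)).hom c) ∈
        cechClassRel R f K hK U (p + 1) q := by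
  have hd : (cechComplex U (persistentCohomologyPresheaf R f K hK q)).d p (p + 1) =
      ModuleCat.ofHom (cechDelta U (persistentCohomologyPresheaf R f K hK q) p) :=
    CochainComplex.of_d (fun p => ModuleCat.of R[X] (cechCochains U
      (persistentCohomologyPresheaf R f K hK q) p))
      (fun p => ModuleCat.ofHom (cechDelta U (persistentCohomologyPresheaf R f K hK q) p)) _
  rw [hd]
  intro i σ
  have h' (τ) : IsClass ((subspaceCochains R X).obj (op (K i.toNat ∩ f ⁻¹' cechInter U τ))) q
      (cechComponent i z τ)
      (cechComponent (F := persistentCohomologyPresheaf R f K hK q) i c τ) := h i τ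
  have key := IsClass.sum (s := Finset.univ) fun j _ =>
    ((h' (cechFace σ j)).map ((subspaceCochains R X).map
      (homOfLE (Set.inter_subset_inter_right (K i.toNat)
        (Set.preimage_mono (f := f) (cechInter_subset U σ j)))).op)).zsmul ((-1) ^ (j : ℕ))
  have e₁ := cechComponent_cechDelta z i σ
  have e₂ := cechComponent_cechDelta (F := persistentCohomologyPresheaf R f K hK q) c i σ
  refine (iff_of_eq (congr (congrArg _ ?_) ?_)).2 key
  · exact e₁
  · exact e₂

end Presheaf

/-! ### The augmentation by the singular cochains of the total space -/

section Augmentation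

variable (R : Type v) [CommRing R] {X : Type u} [TopologicalSpace X]

/-- The relation between singular cocycles and cohomology classes in a filtered space. -/
def persistentClassRel (K : ℕ → Set X) (hK : Antitone K) (q : ℕ) : Submodule R[X]
    (Alpha (persistentCochains R K hK q) × Alpha (persistentCohomology R K hK q)) :=
  componentRel
    (L := fun i (_ : Unit) => (subspaceCochains R X).obj (op (K i.toNat)))
    (Φ := fun _ _ => (subspaceCochains R X).map
      (homOfLE (hK (Int.toNat_le_toNat (Int.le_add_one le_rfl)))).op)
    (Alpha.hasComponents (persistentCochains R K hK q))
    (Alpha.hasComponents (persistentCohomology R K hK q))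

/-- The restriction of a singular cochain to the members of the cover. -/
def cechAugmentation {Y : Type*} (f : X → Y) (K : ℕ → Set X) (hK : Antitone K) {ι : Type w}
    [LinearOrder ι] (U : ι → Set Y) (q : ℕ) : Alpha (persistentCochains R K hK q) →ₗ[R[X]]
      cechCochains U (cochainPresheaf R f K hK q) 0 :=
  LinearMap.codRestrict _
    (LinearMap.pi fun σ => Alpha.map (persistentCochainsRes R hK
      (fun _ _ h => Set.inter_subset_inter_left (f ⁻¹' cechInter U σ) (hK h))
      (fun _ => Set.inter_subset_left) q))
    (by
      intro s
      obtain ⟨S, hS⟩ := Alpha.exists_support s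
      refine ⟨S, fun σ i hi => ?_⟩
      exact (Alpha.component_map _ _ i).trans ((congrArg _ (hS i hi)).trans (map_zero _)))

lemma cechComponent_cechAugmentation {Y : Type*} (f : X → Y) (K : ℕ → Set X) (hK : Antitone K)
    {ι : Type w} [LinearOrder ι] (U : ι → Set Y) (q : ℕ)
    (s : Alpha (persistentCochains R K hK q)) (i : ℤ) (σ : Fin 1 ↪o ι) :
    cechComponent i (cechAugmentation R f K hK U q s) σ =
      resCochain (Set.inter_subset_left : K i.toNat ∩ f ⁻¹' cechInter U σ ⊆ K i.toNat) q
        (Alpha.component _ i s) := rfl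

variable {Y : Type*} [TopologicalSpace Y] (f : C(X, Y)) (K : ℕ → Set X) (hK : Antitone K)
  {ι : Type w} [LinearOrder ι] (U : ι → Set Y)

variable {R f K hK U} in
lemma component_cechDelta_cochainPresheaf {p q : ℕ}
    (c : cechCochains U (cochainPresheaf R f K hK q) p) (i : ℤ) (σ : Fin (p + 2) ↪o ι) :
    cechComponent i (cechDelta U (cochainPresheaf R f K hK q) p c) σ =
      ∑ j : Fin (p + 2), (-1 : ℤ) ^ (j : ℕ) •
        resCochain (cech_subset f U (K i.toNat) σ j) q (cechComponent i c (cechFace σ j)) :=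
  cechComponent_cechDelta c i σ

variable {R f K hK U} in
lemma resCochain_eq_zero_of_cechAugmentation {q : ℕ} {s : Alpha (persistentCochains R K hK q)}
    (hs : cechAugmentation R f K hK U q s = 0) (i : ℤ) (σ : Fin 1 ↪o ι) :
    resCochain (Set.inter_subset_left : K i.toNat ∩ f ⁻¹' cechInter U σ ⊆ K i.toNat) q
      (Alpha.component _ i s) = 0 := by
  rw [← cechComponent_cechAugmentation, hs, map_zero]
  rfl

/-- The singular cochains of the total space augment the Čech double complex. -/
def singularAugmentation (hU : ∀ a, IsOpen (U a)) (hcover : ⋃ a, U a = Set.univ)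
    (hfin : LocallyFinite fun a => f ⁻¹' U a) :
    (cechDoubleComplex R f K hK U).Augmentation
      (fun q => Alpha (persistentCochains R K hK q)) where
  d q := Alpha.map (persistentCochainsD R K hK q)
  d_d q s := Alpha.ext fun i => by
    rw [map_zero]
    exact LinearMap.congr_fun (congrArg ModuleCat.Hom.hom (((subspaceCochains R X).obj
      (op (K i.toNat))).d_comp_d q (q + 1) (q + 1 + 1))) (Alpha.component _ i s)
  ε := cechAugmentation R f K hK U
  ε_d q s := cech_ext fun i σ => LinearMap.congr_fun (congrArg ModuleCat.Hom.hom
    (((subspaceCochains R X).map (homOfLE (Set.inter_subset_left :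
      K i.toNat ∩ f ⁻¹' cechInter U σ ⊆ K i.toNat)).op).comm q (q + 1)).symm)
        (Alpha.component _ i s)
  dh_ε q s := cech_ext fun i σ => by
    refine (component_cechDelta_cochainPresheaf _ i σ).trans ?_
    have h (j : Fin 2) : resCochain (cech_subset f U (K i.toNat) σ j) q
        (cechComponent i (cechAugmentation R f K hK U q s) (cechFace σ j)) =
          resCochain (Set.inter_subset_left : K i.toNat ∩ f ⁻¹' cechInter U σ ⊆ K i.toNat) q
            (Alpha.component _ i s) := by
      have := congrArg (fun g => ModuleCat.Hom.hom (HomologicalComplex.Hom.f g q))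
        ((subspaceCochains R X).map_comp (homOfLE (Set.inter_subset_left :
          K i.toNat ∩ f ⁻¹' cechInter U (cechFace σ j) ⊆ K i.toNat)).op
          (homOfLE (cech_subset f U (K i.toNat) σ j)).op).symm
      exact LinearMap.congr_fun this (Alpha.component _ i s)
    -- Both faces restrict the same cochain to the double intersection, with opposite signs.
    rw [Fin.sum_univ_two, h, h, map_zero]
    simp only [Fin.val_zero, pow_zero, one_smul, Fin.val_one, pow_one, neg_smul]
    exact add_neg_cancel _
  row_exact p q x hx := by
    -- The rows split by degree: each $K_i$ is treated separately, and outside the support of `x`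
    -- the zero solution is available. The same pattern serves for gluing and for the kernel.
    obtain ⟨S, hS⟩ := cech_exists_support x
    obtain ⟨y, hy⟩ := cech_exists_of_forall (U := U) (F := cochainPresheaf R f K hK q) (p := p) S
      (fun i y => ∀ σ : Fin (p + 2) ↪o ι, ∑ j : Fin (p + 2), (-1 : ℤ) ^ (j : ℕ) •
        resCochain (cech_subset f U (K i.toNat) σ j) q (y (cechFace σ j)) = cechComponent i x σ)
      (fun i hi σ => by
        rw [hS i hi]
        exact Finset.sum_eq_zero fun j _ => (congrArg _ (map_zero _)).trans (smul_zero _))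
      (fun i => cech_row_exact hfin (cechComponent i x) fun τ => by
        refine (component_cechDelta_cochainPresheaf x i τ).symm.trans ?_
        refine (congrArg (fun c => cechComponent i c τ) hx).trans ?_
        rw [map_zero]
        rfl)
    exact ⟨y, cech_ext fun i σ => (component_cechDelta_cochainPresheaf y i σ).trans (hy i σ)⟩
  exists_ε q x hx := by
    obtain ⟨S, hS⟩ := cech_exists_support x
    obtain ⟨y, hy⟩ := Alpha.exists_of_forall (M := persistentCochains R K hK q) S
      (fun i y => ∀ σ : Fin 1 ↪o ι, resCochain
        (Set.inter_subset_left : K i.toNat ∩ f ⁻¹' cechInter U σ ⊆ K i.toNat) q y =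
          cechComponent i x σ)
      (fun i hi σ => by
        rw [hS i hi]
        exact map_zero _)
      (fun i => cech_exists_glue hfin (cechComponent i x) fun τ => by
        refine (component_cechDelta_cochainPresheaf x i τ).symm.trans ?_
        refine (congrArg (fun c => cechComponent i c τ) hx).trans ?_
        rw [map_zero]
        rfl)
    exact ⟨y, cech_ext hy⟩
  ker_zero s _ hs := Alpha.ext fun i => by
    rw [map_zero]
    exact cochain_eq_zero_of_small hcover (resCochain_eq_zero_of_cechAugmentation hs i)
  ker_succ q s hd hs := by
    obtain ⟨S, hS⟩ := Alpha.exists_support s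
    obtain ⟨y, hy⟩ := Alpha.exists_of_forall (M := persistentCochains R K hK q) S
      (fun i y => (((subspaceCochains R X).obj (op (K i.toNat))).d q (q + 1)).hom y =
          Alpha.component _ i s ∧ ∀ σ : Fin 1 ↪o ι, resCochain
        (Set.inter_subset_left : K i.toNat ∩ f ⁻¹' cechInter U σ ⊆ K i.toNat) q y = 0)
      (fun i hi => by
        rw [hS i hi]
        exact ⟨map_zero _, fun σ => map_zero _⟩)
      (fun i => exists_d_eq_of_small hU hcover
        ((congrArg (Alpha.component _ i) hd).trans (map_zero _))
        (resCochain_eq_zero_of_cechAugmentation hs i))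
    refine ⟨y, Alpha.ext fun i => (hy i).1, cech_ext fun i σ => ?_⟩
    rw [map_zero]
    exact (hy i).2 σ
  gr q := Alpha.grading (persistentCochains R K hK q)
  isInternal q := Alpha.isInternal_grading _
  d_gr _ _ _ hs := Alpha.map_mem_grading _ hs
  ε_gr q i s hs := mem_cochainGrading_iff.2 fun j hj => funext fun σ => by
    rw [cechComponent_cechAugmentation, Alpha.mem_grading_iff.1 hs j hj]
    exact map_zero _

/-- The cohomology of the augmenting complex is $PH^*(X)$, which is thus the limit of the spectral
sequence. -/
lemma isCohomologyRel_persistentClassRel (hU : ∀ a, IsOpen (U a)) (hcover : ⋃ a, U a = Set.univ)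
    (hfin : LocallyFinite fun a => f ⁻¹' U a) (q : ℕ) :
    IsCohomologyRel ((singularAugmentation R f K hK U hU hcover hfin).d q)
      ((singularAugmentation R f K hK U hU hcover hfin).boundaries q)
      ((singularAugmentation R f K hK U hU hcover hfin).gr q)
      (Alpha.grading (persistentCohomology R K hK q)) (persistentClassRel R K hK q) := by
  refine isCohomologyRel_componentRel
    (Alpha.hasComponents (persistentCochains R K hK q))
    (Alpha.hasComponents (persistentCochains R K hK (q + 1)))
    (Alpha.hasComponents (persistentCohomology R K hK q)) (fun z i σ => rfl) ?_
  cases q with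
  | zero =>
    exact mem_bot_iff_components
      (L := fun i (_ : Unit) => (subspaceCochains R X).obj (op (K i.toNat)))
      (Φ := fun _ _ => (subspaceCochains R X).map
        (homOfLE (hK (Int.toNat_le_toNat (Int.le_add_one le_rfl)))).op)
      (Alpha.hasComponents (persistentCochains R K hK 0))
  | succ q =>
    exact mem_range_iff_components
      (L := fun i (_ : Unit) => (subspaceCochains R X).obj (op (K i.toNat)))
      (Φ := fun _ _ => (subspaceCochains R X).map
        (homOfLE (hK (Int.toNat_le_toNat (Int.le_add_one le_rfl)))).op)
      (Alpha.hasComponents (persistentCochains R K hK q))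
      (Alpha.hasComponents (persistentCochains R K hK (q + 1))) (fun z i σ => rfl)

end Augmentation

end PersistentLeray

end

/-! ### The persistent Leray spectral sequence -/

open PersistentLeray in
theorem mainTheorem1 {R : Type v} [CommRing R] {X : Type u} [TopologicalSpace X]
    {Y : Type*} [TopologicalSpace Y] (f : C(X, Y))
    {ι : Type w} [LinearOrder ι] (U : ι → Set Y) (hU : ∀ a, IsOpen (U a))
    (hcover : ⋃ a, U a = Set.univ) (hfin : LocallyFinite fun a => f ⁻¹' U a)
    (N : ℕ) (K : ℕ → Set X) (hK : Antitone K) (hK0 : K 0 = Set.univ) (hKN : K N = ∅) :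
    ∃ 𝓔 : GradedSpectralSequence.{v, max u v w} R,
      (∀ p q : ℕ,
        ∃ e : (𝓔.E.page 2).X (p, q) ≃ₗ[R[X]]
            cechCohomology U (persistentCohomologyPresheaf R f K hK q) p,
          ∀ i : ℤ, (𝓔.gr 2 le_rfl (p, q) i).map e.toLinearMap.toAddMonoidHom =
            homologyGrading (cechComplex U (persistentCohomologyPresheaf R f K hK q))
              (cechGrading U (persistentCohomologyPresheaf R f K hK q)) p i) ∧
      𝓔.ConvergesTo (fun n => Alpha (persistentCohomology R K hK n))
        (fun n => Alpha.grading (persistentCohomology R K hK n)) := by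
  refine ⟨(cechDoubleComplex R f K hK U).filtered.spectralSequence, fun p q => ?_,
    (singularAugmentation R f K hK U hU hcover hfin).convergesTo
      (fun n => Alpha.isInternal_grading _) (persistentClassRel R K hK)
      (isCohomologyRel_persistentClassRel R f K hK U hU hcover hfin)⟩
  obtain ⟨e, he⟩ := (cechDoubleComplex R f K hK U).exists_secondPage_iso
    (cechComplex U (persistentCohomologyPresheaf R f K hK q))
    (cechGrading U (persistentCohomologyPresheaf R f K hK q))
    (fun p => cechClassRel R f K hK U p q) p
    (fun p => isCohomologyRel_cechClassRel R f K hK U p q)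
    (fun p => cechClassRel_cechDelta R f K hK U p q)
  -- The isomorphism was built from Čech cohomology to $E_2$; its inverse is required, and the
  -- statement on gradings is inverted along with it.
  refine ⟨e.toLinearEquiv.symm, fun i => ?_⟩
  have h : (cechDoubleComplex R f K hK U).filtered.spectralSequence.gr 2 le_rfl (p, q) i =
      (homologyGrading _ _ p i).map e.hom.hom.toAddMonoidHom := (he i).symm
  rw [h]
  ext x
  constructor
  · rintro ⟨_, ⟨y, hy, rfl⟩, rfl⟩
    exact Set.mem_of_eq_of_mem (e.toLinearEquiv.symm_apply_apply y) hy
  · exact fun hx => ⟨_, ⟨x, hx, rfl⟩, e.toLinearEquiv.symm_apply_apply x⟩
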